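/- Let $n\ge 2$, let $\mathcal A=\{\ell_1,\dots,\ell_d\}$ be a finite set of $d\ge 0$ distinct affine lines in $\mathbb R^n$, and let $M(\mathcal A)=\mathbb R^n\setminus\bigcup_{i=1}^d \ell_i$. For $2\le i\le d$ let $t_i$ be the number of points of $\mathbb R^n$ that lie on exactly $i$ of the lines, and set $$g = d+\sum_{i=2}^d (i-1)\,t_i .$$ Then $M(\mathcal A)$ is homotopy equivalent to the bouquet $\bigvee_{k=1}^g S^{n-2}$ of $g$ copies of the sphere $S^{n-2}$ (a single point if $g=0$; $g+1$ discrete points if $n=2$). In particular $M(\mathcal A)$ is a minimal space, that is, it is homotopy equivalent to a CW complex such that, for every $i\ge 0$, the number of $i$-cells is finite and equal to the $i$-th Betti number of the complex. -/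

import Mathlib

open scoped ContinuousMap

/-- An affine line of `ℝⁿ`: a non-empty affine subspace of dimension one. -/
def IsAffineLine {n : ℕ} (ℓ : AffineSubspace ℝ (EuclideanSpace ℝ (Fin n))) : Prop :=
  (ℓ : Set (EuclideanSpace ℝ (Fin n))).Nonempty ∧ Module.finrank ℝ ℓ.direction = 1

/-- The complement in `ℝⁿ` of the union of a finite set of affine subspaces. -/
def arrangementComplement {n : ℕ} (A : Finset (AffineSubspace ℝ (EuclideanSpace ℝ (Fin n)))) :
    Set (EuclideanSpace ℝ (Fin n)) :=
  (⋃ ℓ ∈ A, (ℓ : Set (EuclideanSpace ℝ (Fin n))))ᶜ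

/-- The multiplicity of a point: the number of members of the arrangement through it. -/
noncomputable def pointMultiplicity {n : ℕ}
    (A : Finset (AffineSubspace ℝ (EuclideanSpace ℝ (Fin n))))
    (x : EuclideanSpace ℝ (Fin n)) : ℕ :=
  {ℓ | ℓ ∈ A ∧ x ∈ ℓ}.ncard

/-- The number `tᵢ` of points of multiplicity exactly `i`. For an arrangement of lines and `2 ≤ i`
(the only values used) there are finitely many such points. -/
noncomputable def numPointsOfMultiplicity {n : ℕ}
    (A : Finset (AffineSubspace ℝ (EuclideanSpace ℝ (Fin n)))) (i : ℕ) : ℕ :=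
  {x : EuclideanSpace ℝ (Fin n) | pointMultiplicity A x = i}.ncard

/-- Gluing relation of the wedge sum: the extra point `inl ()` is identified with each of the base
points. -/
inductive WedgeRel {ι : Type} (X : ι → Type) (x : ∀ i, X i) :
    Unit ⊕ (Σ i, X i) → Unit ⊕ (Σ i, X i) → Prop
  | glue (i : ι) : WedgeRel X x (Sum.inl ()) (Sum.inr ⟨i, x i⟩)

/-- The wedge sum of a family of pointed spaces, with the quotient topology. The extra point makes
the wedge of the empty family a point and changes nothing for a non-empty family. -/
def Wedge {ι : Type} (X : ι → Type) (x : ∀ i, X i) : Type :=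
  Quot (WedgeRel X x)

instance {ι : Type} (X : ι → Type) [∀ i, TopologicalSpace (X i)] (x : ∀ i, X i) :
    TopologicalSpace (Wedge X x) :=
  inferInstanceAs (TopologicalSpace (Quot (WedgeRel X x)))

/-- The unit sphere `Sᵐ` of `ℝᵐ⁺¹`. -/
abbrev UnitSphere (m : ℕ) : Type :=
  Metric.sphere (0 : EuclideanSpace ℝ (Fin (m + 1))) 1

/-- The base point `(1, 0, …, 0)` of `Sᵐ`. -/
noncomputable def UnitSphere.base (m : ℕ) : UnitSphere m :=
  ⟨EuclideanSpace.single 0 1, by simp⟩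

/-- The bouquet of `g` copies of `Sᵐ`. -/
abbrev SphereBouquet (g m : ℕ) : Type :=
  Wedge (fun _ : Fin g => UnitSphere m) (fun _ => UnitSphere.base m)

/-- The `i`-th Betti number: the rank of the `i`-th integral singular homology group. It is a
cardinal, so that no convention is made for groups of infinite rank. -/
noncomputable def bettiNumber (X : Type) [TopologicalSpace X] (i : ℕ) : Cardinal.{0} :=
  Module.rank ℤ (((AlgebraicTopology.singularHomologyFunctor (ModuleCat.{0} ℤ) i).obj
    (ModuleCat.of ℤ ℤ)).obj (TopCat.of X))

/-- A minimal space: one that is homotopy equivalent to a (Hausdorff) CW complex whose number of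
`i`-cells is finite and equal to its `i`-th Betti number, for every `i`. -/
def IsMinimalSpace (X : Type) [TopologicalSpace X] : Prop :=
  ∃ (Y : Type) (_ : TopologicalSpace Y) (_ : T2Space Y)
    (_ : Topology.CWComplex (Set.univ : Set Y)),
    Nonempty (X ≃ₕ Y) ∧
      ∀ i : ℕ, Finite (Topology.RelCWComplex.cell (Set.univ : Set Y) i) ∧
        Cardinal.mk (Topology.RelCWComplex.cell (Set.univ : Set Y) i) = bettiNumber Y i

/-!
The complement is swept by a generic linear function `t`. In suitable linear coordinates `(t, x, z)`
every line is a graph `a + t • b` over the `t`-axis, so that the slice of the complement at time `t`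
is a space from which finitely many moving points have been removed; the second coordinate `x`
separates the slopes of lines that are not parallel.

Let `L` be the finite set of the pairs `(a, b)`. The homotopy type of the part of the complement
over the interval `(a₀, s)` is followed as `s` grows (`nonempty_lineComplement_Ioo_homotopyEquiv`).

* Before all collisions it is that of a slice, a space without `d` points with distinct first
  coordinates, hence of a bouquet of `d` spheres (`eventually_nhdsGT_homotopyEquiv_of_injOn`).
* Nothing changes while `s` approaches a time from the left (`eventually_nhdsLT_homotopyEquiv`) or
  tends to infinity (`eventually_atTop_homotopyEquiv`): the points move along with the lines.
* When `s` passes a time at which `k` lines meet in a point, the complement of a cone with this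
  point as apex has the homotopy type of the past, and the cone is filled in. In the coordinates
  of the cone (`coneChart`) the `k` lines are parallel. They are crossed one at a time in the order
  of their slopes: each but the last attaches a homotopy sphere along a contractible set, and the
  last attaches nothing (`fill_box`). So `k - 1` spheres are added
  (`eventually_nhdsGT_homotopyEquiv`).

The sum over all collisions is `d + ∑ (i - 1) tᵢ` (`sum_collisionDefect`). That a sphere attached
along a contractible open intersection adds a wedge summand is
`nonempty_union_homotopyEquiv_bouquet`; no condition on base points is needed, because spheres and
bouquets are homotopy homogeneous (`IsHomotopyHomogeneous`).

For minimality, a bouquet of `g` spheres of positive dimension is given the cell structure with one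
`0`-cell and `g` top cells, and `S⁰`-bouquets are finite discrete spaces. The Betti numbers of a
bouquet follow from the Mayer–Vietoris sequence, which is derived here for singular homology from
barycentric subdivision.
-/

/-! ### Barycentric subdivision of affine chains -/

section OrderedChains

variable {α β : Type*}

/-- Ordered chains on a set of vertices: the free abelian group on the `n`-tuples. The degree is
the number of vertices, so that degree `0` is the augmentation. -/
abbrev TupleChain (n : ℕ) (α : Type*) : Type _ := (Fin n → α) →₀ ℤ

/-- The augmented simplicial boundary on ordered chains. -/
noncomputable def tupleBoundary (n : ℕ) : TupleChain (n + 1) α →ₗ[ℤ] TupleChain n α :=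
  Finsupp.linearCombination ℤ fun v =>
    ∑ i : Fin (n + 1), (-1 : ℤ) ^ (i : ℕ) • Finsupp.single (fun j => v (i.succAbove j)) (1 : ℤ)

/-- The cone with apex `b` on ordered chains. -/
noncomputable def tupleCone {n : ℕ} (b : α) : TupleChain n α →ₗ[ℤ] TupleChain (n + 1) α :=
  Finsupp.lmapDomain ℤ ℤ fun v => (Fin.cons b v : Fin (n + 1) → α)

/-- The map induced on ordered chains by a map of vertices. -/
noncomputable def tupleMap {n : ℕ} (f : α → β) : TupleChain n α →ₗ[ℤ] TupleChain n β :=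
  Finsupp.lmapDomain ℤ ℤ fun v => f ∘ v

lemma tupleBoundary_single {n : ℕ} (v : Fin (n + 1) → α) :
    tupleBoundary n (Finsupp.single v 1) =
      ∑ i : Fin (n + 1), (-1 : ℤ) ^ (i : ℕ) •
        Finsupp.single (fun j => v (i.succAbove j)) (1 : ℤ) := by
  simp [tupleBoundary]

@[simp] lemma tupleCone_single {n : ℕ} (b : α) (v : Fin n → α) (c : ℤ) :
    tupleCone b (Finsupp.single v c) = Finsupp.single (Fin.cons b v : Fin (n + 1) → α) c := by
  simp [tupleCone]

@[simp] lemma tupleMap_single {n : ℕ} (f : α → β) (v : Fin n → α) (c : ℤ) :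
    tupleMap f (Finsupp.single v c) = Finsupp.single (f ∘ v) c := by
  simp [tupleMap]

lemma tupleChain_hom_ext {n : ℕ} {M : Type*} [AddCommGroup M]
    {f g : TupleChain n α →ₗ[ℤ] M}
    (h : ∀ v, f (Finsupp.single v 1) = g (Finsupp.single v 1)) : f = g := by
  refine Finsupp.lhom_ext' fun v => LinearMap.ext_ring ?_
  simpa using h v

lemma tupleBoundary_cone_zero (b : α) (c : TupleChain 0 α) :
    tupleBoundary 0 (tupleCone b c) = c := by
  suffices h : tupleBoundary 0 ∘ₗ tupleCone b = LinearMap.id from LinearMap.congr_fun h c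
  refine tupleChain_hom_ext fun v => ?_
  simp only [LinearMap.comp_apply, tupleCone_single, tupleBoundary_single, LinearMap.id_apply]
  simp only [Fin.sum_univ_succ, Finset.univ_eq_empty, Finset.sum_empty]
  simp

lemma tupleBoundary_cone {n : ℕ} (b : α) (c : TupleChain (n + 1) α) :
    tupleBoundary (n + 1) (tupleCone b c) = c - tupleCone b (tupleBoundary n c) := by
  suffices h : tupleBoundary (n + 1) ∘ₗ tupleCone b =
      LinearMap.id - tupleCone b ∘ₗ tupleBoundary n from LinearMap.congr_fun h c
  refine tupleChain_hom_ext fun v => ?_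
  simp only [LinearMap.comp_apply, tupleCone_single, tupleBoundary_single, LinearMap.id_apply,
    LinearMap.sub_apply, map_sum, map_smul]
  rw [Fin.sum_univ_succ, sub_eq_add_neg, ← Finset.sum_neg_distrib]
  congr 1
  · simp
  · refine Finset.sum_congr rfl fun i _ => ?_
    rw [← neg_smul]
    congr 1
    · simp [pow_succ]
    · congr 1
      ext j
      refine Fin.cases ?_ (fun j => ?_) j
      · simp
      · simp

lemma tupleBoundary_boundary {n : ℕ} (c : TupleChain (n + 2) α) :
    tupleBoundary n (tupleBoundary (n + 1) c) = 0 := by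
  suffices h : tupleBoundary n ∘ₗ tupleBoundary (n + 1) =
      (0 : TupleChain (n + 2) α →ₗ[ℤ] TupleChain n α) from LinearMap.congr_fun h c
  clear c
  induction n with
  | zero =>
    refine tupleChain_hom_ext fun v => ?_
    have hv : Finsupp.single v (1 : ℤ) = tupleCone (v 0) (Finsupp.single (Fin.tail v) 1) := by
      rw [tupleCone_single, Fin.cons_self_tail]
    rw [LinearMap.comp_apply, hv, tupleBoundary_cone, map_sub, tupleBoundary_cone_zero, sub_self]
    rfl
  | succ n ih =>
    refine tupleChain_hom_ext fun v => ?_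
    have hv : Finsupp.single v (1 : ℤ) = tupleCone (v 0) (Finsupp.single (Fin.tail v) 1) := by
      rw [tupleCone_single, Fin.cons_self_tail]
    have := LinearMap.congr_fun ih (Finsupp.single (Fin.tail v) 1)
    rw [LinearMap.comp_apply] at this
    rw [LinearMap.comp_apply, hv, tupleBoundary_cone, map_sub, tupleBoundary_cone, this]
    simp

lemma tupleMap_boundary {n : ℕ} (f : α → β) (c : TupleChain (n + 1) α) :
    tupleMap f (tupleBoundary n c) = tupleBoundary n (tupleMap f c) := by
  suffices h : tupleMap f ∘ₗ tupleBoundary n = tupleBoundary n ∘ₗ tupleMap f from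
    LinearMap.congr_fun h c
  refine tupleChain_hom_ext fun v => ?_
  simp only [LinearMap.comp_apply, tupleMap_single, tupleBoundary_single, map_sum, map_smul]
  rfl

lemma tupleMap_cone {n : ℕ} (f : α → β) (b : α) (c : TupleChain n α) :
    tupleMap f (tupleCone b c) = tupleCone (f b) (tupleMap f c) := by
  suffices h : tupleMap f ∘ₗ tupleCone b = tupleCone (f b) ∘ₗ tupleMap f from
    LinearMap.congr_fun h c
  refine tupleChain_hom_ext fun v => ?_
  simp only [LinearMap.comp_apply, tupleMap_single, tupleCone_single]
  congr 1
  exact Fin.comp_cons _ _ _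

end OrderedChains

section AffineSimplices

/-- The standard topological simplex with `n + 1` vertices. -/
abbrev TopSimplex (n : ℕ) : Type := stdSimplex ℝ (Fin (n + 1))

variable {k l n : ℕ}

/-- The affine map of standard simplices with prescribed values at the vertices. -/
noncomputable def affineSimplex (v : Fin (n + 1) → TopSimplex k) :
    C(TopSimplex n, TopSimplex k) where
  toFun w := ⟨∑ i, w.1 i • (v i).1,
    (convex_stdSimplex ℝ (Fin (k + 1))).sum_mem (fun i _ => w.2.1 i) w.2.2 fun i _ => (v i).2⟩
  continuous_toFun := by
    refine Continuous.subtype_mk (continuous_finsetSum _ fun i _ => ?_) _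
    exact ((continuous_apply i).comp continuous_subtype_val).smul continuous_const

lemma affineSimplex_val (v : Fin (n + 1) → TopSimplex k) (w : TopSimplex n) :
    (affineSimplex v w).1 = ∑ i, w.1 i • (v i).1 := rfl

lemma affineSimplex_apply (v : Fin (n + 1) → TopSimplex k) (w : TopSimplex n)
    (j : Fin (k + 1)) : affineSimplex v w j = ∑ i, w i * v i j := by
  change (∑ i, w.1 i • (v i).1) j = _
  rw [Finset.sum_apply]
  rfl

lemma affineSimplex_comp (u : Fin (k + 1) → TopSimplex l) (v : Fin (n + 1) → TopSimplex k) :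
    (affineSimplex u).comp (affineSimplex v) = affineSimplex (affineSimplex u ∘ v) := by
  ext w j
  simp only [ContinuousMap.comp_apply, affineSimplex_apply, Function.comp_apply, Finset.sum_mul,
    Finset.mul_sum]
  rw [Finset.sum_comm]
  simp only [mul_assoc]

lemma affineSimplex_vertex (v : Fin (n + 1) → TopSimplex k) (i : Fin (n + 1)) :
    affineSimplex v (stdSimplex.vertex i) = v i := by
  ext j
  rw [affineSimplex_apply, Finset.sum_eq_single i]
  · simp
  · intro j _ hj
    simp [hj]
  · simp

/-- The tuple of the vertices of the standard simplex. -/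
noncomputable def simplexVertices (n : ℕ) : Fin (n + 1) → TopSimplex n :=
  fun i => stdSimplex.vertex i

lemma affineSimplex_comp_vertices (v : Fin (n + 1) → TopSimplex k) :
    affineSimplex v ∘ simplexVertices n = v :=
  funext fun i => affineSimplex_vertex v i

lemma affineSimplex_vertices : affineSimplex (simplexVertices n) = ContinuousMap.id _ := by
  ext w j
  rw [affineSimplex_apply, Finset.sum_eq_single j]
  · simp [simplexVertices]
  · intro i _ hi
    simp [simplexVertices, hi.symm]
  · simp

/-- The barycentre of a tuple of points. -/
noncomputable def tupleBarycenter (v : Fin (n + 1) → TopSimplex k) : TopSimplex k :=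
  affineSimplex v stdSimplex.barycenter

lemma affineSimplex_barycenter (u : Fin (k + 1) → TopSimplex l) (v : Fin (n + 1) → TopSimplex k) :
    affineSimplex u (tupleBarycenter v) = tupleBarycenter (affineSimplex u ∘ v) := by
  rw [tupleBarycenter, tupleBarycenter, ← affineSimplex_comp]
  rfl

/-- Barycentric subdivision of affine chains. -/
noncomputable def tupleSubdivision (k : ℕ) :
    (n : ℕ) → TupleChain n (TopSimplex k) →ₗ[ℤ] TupleChain n (TopSimplex k)
  | 0 => LinearMap.id
  | n + 1 => Finsupp.linearCombination ℤ fun v =>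
      tupleCone (tupleBarycenter v)
        (tupleSubdivision k n (tupleBoundary n (Finsupp.single v 1)))

/-- The chain homotopy between the identity and the barycentric subdivision. -/
noncomputable def tupleHomotopy (k : ℕ) :
    (n : ℕ) → TupleChain n (TopSimplex k) →ₗ[ℤ] TupleChain (n + 1) (TopSimplex k)
  | 0 => 0
  | n + 1 => Finsupp.linearCombination ℤ fun v =>
      tupleCone (tupleBarycenter v)
        (Finsupp.single v 1 - tupleHomotopy k n (tupleBoundary n (Finsupp.single v 1)))

lemma tupleSubdivision_succ_single (v : Fin (n + 1) → TopSimplex k) :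
    tupleSubdivision k (n + 1) (Finsupp.single v 1) = tupleCone (tupleBarycenter v)
        (tupleSubdivision k n (tupleBoundary n (Finsupp.single v 1))) := by
  simp [tupleSubdivision]

lemma tupleHomotopy_succ_single (v : Fin (n + 1) → TopSimplex k) :
    tupleHomotopy k (n + 1) (Finsupp.single v 1) = tupleCone (tupleBarycenter v)
        (Finsupp.single v 1 - tupleHomotopy k n (tupleBoundary n (Finsupp.single v 1))) := by
  simp [tupleHomotopy]

lemma tupleBoundary_subdivision (c : TupleChain (n + 1) (TopSimplex k)) :
    tupleBoundary n (tupleSubdivision k (n + 1) c) = tupleSubdivision k n (tupleBoundary n c) := by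
  suffices h : tupleBoundary n ∘ₗ tupleSubdivision k (n + 1) =
      tupleSubdivision k n ∘ₗ tupleBoundary n from LinearMap.congr_fun h c
  clear c
  induction n with
  | zero =>
    refine tupleChain_hom_ext fun v => ?_
    rw [LinearMap.comp_apply, tupleSubdivision_succ_single, tupleBoundary_cone_zero]
    rfl
  | succ n ih =>
    refine tupleChain_hom_ext fun v => ?_
    have := LinearMap.congr_fun ih (tupleBoundary (n + 1) (Finsupp.single v 1))
    simp only [LinearMap.comp_apply, tupleBoundary_boundary, map_zero] at this
    rw [LinearMap.comp_apply, tupleSubdivision_succ_single, tupleBoundary_cone, this, map_zero,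
      sub_zero]
    rfl

lemma tupleBoundary_homotopy (c : TupleChain (n + 1) (TopSimplex k)) :
    tupleBoundary (n + 1) (tupleHomotopy k (n + 1) c) + tupleHomotopy k n (tupleBoundary n c) =
      c - tupleSubdivision k (n + 1) c := by
  suffices h : tupleBoundary (n + 1) ∘ₗ tupleHomotopy k (n + 1) +
      tupleHomotopy k n ∘ₗ tupleBoundary n = LinearMap.id - tupleSubdivision k (n + 1) from
    LinearMap.congr_fun h c
  clear c
  induction n with
  | zero =>
    refine tupleChain_hom_ext fun v => ?_
    simp only [LinearMap.add_apply, LinearMap.comp_apply, LinearMap.sub_apply, LinearMap.id_apply]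
    rw [tupleHomotopy_succ_single, tupleBoundary_cone, tupleSubdivision_succ_single]
    simp [tupleHomotopy, tupleSubdivision]
  | succ n ih =>
    refine tupleChain_hom_ext fun v => ?_
    have := LinearMap.congr_fun ih (tupleBoundary (n + 1) (Finsupp.single v 1))
    simp only [LinearMap.add_apply, LinearMap.comp_apply, LinearMap.sub_apply, LinearMap.id_apply,
      tupleBoundary_boundary, map_zero, add_zero] at this
    simp only [LinearMap.add_apply, LinearMap.comp_apply, LinearMap.sub_apply, LinearMap.id_apply]
    rw [tupleHomotopy_succ_single, tupleBoundary_cone, tupleSubdivision_succ_single, map_sub, this,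
      sub_sub_cancel]
    abel

lemma tupleMap_subdivision (u : Fin (k + 1) → TopSimplex l) (c : TupleChain n (TopSimplex k)) :
    tupleMap (affineSimplex u) (tupleSubdivision k n c) =
      tupleSubdivision l n (tupleMap (affineSimplex u) c) := by
  suffices h : tupleMap (affineSimplex u) ∘ₗ tupleSubdivision k n =
      tupleSubdivision l n ∘ₗ tupleMap (affineSimplex u) from LinearMap.congr_fun h c
  clear c
  induction n with
  | zero => rfl
  | succ n ih =>
    refine tupleChain_hom_ext fun v => ?_
    have := LinearMap.congr_fun ih (tupleBoundary n (Finsupp.single v 1))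
    simp only [LinearMap.comp_apply] at this
    simp only [LinearMap.comp_apply, tupleMap_single, tupleSubdivision_succ_single, tupleMap_cone,
      this, tupleMap_boundary, affineSimplex_barycenter]

lemma tupleMap_homotopy (u : Fin (k + 1) → TopSimplex l) (c : TupleChain n (TopSimplex k)) :
    tupleMap (affineSimplex u) (tupleHomotopy k n c) =
      tupleHomotopy l n (tupleMap (affineSimplex u) c) := by
  suffices h : tupleMap (affineSimplex u) ∘ₗ tupleHomotopy k n =
      tupleHomotopy l n ∘ₗ tupleMap (affineSimplex u) from LinearMap.congr_fun h c
  clear c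
  induction n with
  | zero => ext; simp [tupleHomotopy]
  | succ n ih =>
    refine tupleChain_hom_ext fun v => ?_
    have := LinearMap.congr_fun ih (tupleBoundary n (Finsupp.single v 1))
    simp only [LinearMap.comp_apply] at this
    simp only [LinearMap.comp_apply, tupleMap_single, tupleHomotopy_succ_single, tupleMap_cone,
      map_sub, this, tupleMap_boundary, affineSimplex_barycenter]

end AffineSimplices

section Mesh

variable {k n : ℕ}

lemma dist_affineSimplex_le (v : Fin (n + 1) → TopSimplex k) (w : TopSimplex n)
    (p : TopSimplex k) {ρ : ℝ} (h : ∀ i, dist p (v i) ≤ ρ) : dist p (affineSimplex v w) ≤ ρ := by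
  have hc : Convex ℝ (Metric.closedBall p.1 ρ) := convex_closedBall _ _
  have := hc.sum_mem (t := Finset.univ) (w := w.1) (z := fun i => (v i).1)
    (fun i _ => w.2.1 i) w.2.2 (fun i _ => by
      rw [Metric.mem_closedBall, dist_comm]; exact h i)
  rw [Metric.mem_closedBall, dist_comm] at this
  exact this

lemma dist_tupleBarycenter_le (v : Fin (n + 1) → TopSimplex k) {δ : ℝ}
    (h : ∀ i j, dist (v i) (v j) ≤ δ) (i : Fin (n + 1)) :
    dist (tupleBarycenter v) (v i) ≤ n / (n + 1) * δ := by
  have hn : (0 : ℝ) < n + 1 := by positivity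
  have hb : ∀ j : Fin (n + 1), (stdSimplex.barycenter : TopSimplex n).1 j = 1 / (n + 1) := by
    intro j
    simp
  have key : (tupleBarycenter v).1 - (v i).1 =
      ∑ j ∈ Finset.univ.erase i, (1 / ((n : ℝ) + 1)) • ((v j).1 - (v i).1) := by
    rw [tupleBarycenter, affineSimplex_val]
    simp only [hb]
    have h1 : ∑ j : Fin (n + 1), (1 / ((n : ℝ) + 1)) • ((v j).1 - (v i).1) =
        ∑ j ∈ Finset.univ.erase i, (1 / ((n : ℝ) + 1)) • ((v j).1 - (v i).1) := by
      rw [← Finset.add_sum_erase _ _ (Finset.mem_univ i)]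
      simp
    rw [← h1]
    simp only [smul_sub, Finset.sum_sub_distrib]
    congr 1
    rw [Finset.sum_const, Finset.card_univ, Fintype.card_fin, ← Nat.cast_smul_eq_nsmul ℝ, smul_smul]
    push_cast
    rw [mul_one_div_cancel hn.ne', one_smul]
  rw [Subtype.dist_eq, dist_eq_norm, key]
  refine (norm_sum_le _ _).trans ?_
  have : ∀ j ∈ Finset.univ.erase i,
      ‖(1 / ((n : ℝ) + 1)) • ((v j).1 - (v i).1)‖ ≤ 1 / (n + 1) * δ := by
    intro j _
    rw [norm_smul, Real.norm_of_nonneg (by positivity), ← dist_eq_norm, ← Subtype.dist_eq]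
    exact mul_le_mul_of_nonneg_left (h j i) (by positivity)
  refine (Finset.sum_le_sum this).trans ?_
  rw [Finset.sum_const, Finset.card_erase_of_mem (Finset.mem_univ i), Finset.card_univ,
    Fintype.card_fin, nsmul_eq_mul]
  push_cast
  apply le_of_eq
  field_simp

/-- The tuples of mesh at most `δ` that lie in every ball containing the tuple `v`. -/
def fineTuples {n' : ℕ} (v : Fin n' → TopSimplex k) (n : ℕ) (δ : ℝ) :
    Set (Fin n → TopSimplex k) :=
  {w | (∀ j p ρ, (∀ i, dist p (v i) ≤ ρ) → dist p (w j) ≤ ρ) ∧ ∀ i j, dist (w i) (w j) ≤ δ}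

lemma tupleCone_mem_supported {b : TopSimplex k} {c : TupleChain n (TopSimplex k)}
    {s : Set (Fin n → TopSimplex k)} {t : Set (Fin (n + 1) → TopSimplex k)}
    (hc : c ∈ Finsupp.supported ℤ ℤ s)
    (h : ∀ v ∈ s, (Fin.cons b v : Fin (n + 1) → TopSimplex k) ∈ t) :
    tupleCone b c ∈ Finsupp.supported ℤ ℤ t := by
  rw [Finsupp.mem_supported] at *
  classical
  intro w hw
  have := Finsupp.mapDomain_support (f := fun v => (Fin.cons b v : Fin (n + 1) → TopSimplex k)) hw
  obtain ⟨v, hv, rfl⟩ := Finset.mem_image.1 this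
  exact h v (hc hv)

/-- One barycentric subdivision shrinks the mesh of a simplex with at most `N + 1` vertices by the
factor `N / (N + 1)`. -/
lemma tupleSubdivision_single_mem {N : ℕ} (v : Fin n → TopSimplex k) {δ : ℝ} (hδ : 0 ≤ δ)
    (hn : n ≤ N + 1) (h : ∀ i j, dist (v i) (v j) ≤ δ) :
    tupleSubdivision k n (Finsupp.single v 1) ∈
      Finsupp.supported ℤ ℤ (fineTuples v n (N / (N + 1) * δ)) := by
  induction n with
  | zero =>
    exact Finsupp.single_mem_supported _ _ ⟨fun j => j.elim0, fun j => j.elim0⟩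
  | succ n ih =>
    rw [tupleSubdivision_succ_single, tupleBoundary_single, map_sum, map_sum]
    refine Submodule.sum_mem _ fun i _ => ?_
    rw [map_smul, map_smul]
    refine Submodule.smul_mem _ _ ?_
    have h' := ih (fun j => v (i.succAbove j)) (by omega) (fun _ _ => h _ _)
    refine tupleCone_mem_supported h' fun w hw => ?_
    have hfac : (n : ℝ) / (n + 1) ≤ N / (N + 1) := by
      have : (n : ℝ) ≤ N := by exact_mod_cast (by omega : n ≤ N)
      rw [div_le_div_iff₀ (by positivity) (by positivity)]
      nlinarith
    have hb : ∀ i, dist (tupleBarycenter v) (v i) ≤ N / (N + 1) * δ := fun i =>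
      (dist_tupleBarycenter_le v h i).trans (mul_le_mul_of_nonneg_right hfac hδ)
    have hbw : ∀ j, dist (tupleBarycenter v) (w j) ≤ N / (N + 1) * δ := fun j =>
      hw.1 j _ _ fun _ => hb _
    constructor
    · intro j p ρ hp
      refine Fin.cases ?_ (fun j => ?_) j
      · exact dist_affineSimplex_le v _ p hp
      · exact hw.1 j p ρ fun i => hp _
    · intro a b
      refine Fin.cases ?_ (fun a => ?_) a <;> refine Fin.cases ?_ (fun b => ?_) b
      · simp only [Fin.cons_zero, dist_self]; positivity
      · exact hbw b
      · rw [dist_comm]; exact hbw a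
      · exact hw.2 a b

lemma tupleSubdivision_mem_supported {δ : ℝ} (hδ : 0 ≤ δ) {c : TupleChain (n + 1) (TopSimplex k)}
    (hc : c ∈ Finsupp.supported ℤ ℤ {v | ∀ i j, dist (v i) (v j) ≤ δ}) :
    tupleSubdivision k (n + 1) c ∈
      Finsupp.supported ℤ ℤ {v | ∀ i j, dist (v i) (v j) ≤ n / (n + 1) * δ} := by
  rw [Finsupp.mem_supported] at hc
  rw [← Finsupp.sum_single c, Finsupp.sum, map_sum]
  refine Submodule.sum_mem _ fun v hv => ?_
  have h1 : Finsupp.single v (c v) = c v • Finsupp.single v (1 : ℤ) := by simp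
  rw [h1, map_smul]
  refine Submodule.smul_mem _ _ ?_
  exact Finsupp.supported_mono (fun w hw => hw.2)
    (tupleSubdivision_single_mem (N := n) v hδ le_rfl (hc hv))

/-- The mesh of the iterated subdivisions of a simplex tends to zero. -/
lemma exists_tupleSubdivision_iterate_mem (n : ℕ) {ε : ℝ} (hε : 0 < ε) :
    ∃ r : ℕ, ∀ s, r ≤ s →
      ((tupleSubdivision n (n + 1))^[s]) (Finsupp.single (simplexVertices n) 1) ∈
      Finsupp.supported ℤ ℤ {v | ∀ i j, dist (v i) (v j) ≤ ε} := by
  set D := Metric.diam (Set.univ : Set (TopSimplex n)) with hD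
  have h0 : ∀ s, ((tupleSubdivision n (n + 1))^[s]) (Finsupp.single (simplexVertices n) 1) ∈
      Finsupp.supported ℤ ℤ
        {v | ∀ i j, dist (v i) (v j) ≤ ((n : ℝ) / (n + 1)) ^ s * D} := by
    intro s
    induction s with
    | zero =>
      refine Finsupp.single_mem_supported _ _ fun i j => ?_
      simpa using Metric.dist_le_diam_of_mem (isCompact_univ (X := TopSimplex n)).isBounded
        (Set.mem_univ _) (Set.mem_univ _)
    | succ s ih =>
      rw [Function.iterate_succ_apply']
      have := tupleSubdivision_mem_supported (mul_nonneg (by positivity) Metric.diam_nonneg) ih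
      rw [pow_succ', mul_assoc]
      exact this
  have hlt : (n : ℝ) / (n + 1) < 1 := by
    rw [div_lt_one (by positivity)]; linarith
  have ht : Filter.Tendsto (fun s : ℕ => ((n : ℝ) / (n + 1)) ^ s * D) Filter.atTop
      (nhds (0 * D)) :=
    (tendsto_pow_atTop_nhds_zero_of_lt_one (by positivity) hlt).mul_const D
  rw [zero_mul] at ht
  obtain ⟨r, hr⟩ := Filter.eventually_atTop.1 (ht.eventually (ge_mem_nhds hε))
  exact ⟨r, fun s hs => Finsupp.supported_mono (fun v hv i j => (hv i j).trans (hr s hs)) (h0 s)⟩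

end Mesh

/-! ### Small singular chains -/

section Singular

variable {X : Type*} [TopologicalSpace X] {k n : ℕ}

/-- The singular chains of `X`. -/
abbrev SingChain (n : ℕ) (X : Type*) [TopologicalSpace X] : Type _ := C(TopSimplex n, X) →₀ ℤ

/-- The `i`-th face of a singular simplex. -/
noncomputable def singFace (i : Fin (n + 2)) (σ : C(TopSimplex (n + 1), X)) : C(TopSimplex n, X) :=
  σ.comp ⟨stdSimplex.map i.succAbove, stdSimplex.continuous_map _⟩

/-- The singular boundary. -/
noncomputable def singBoundary (n : ℕ) : SingChain (n + 1) X →ₗ[ℤ] SingChain n X :=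
  Finsupp.linearCombination ℤ fun σ =>
    ∑ i : Fin (n + 2), (-1 : ℤ) ^ (i : ℕ) • Finsupp.single (singFace i σ) (1 : ℤ)

lemma singBoundary_single (σ : C(TopSimplex (n + 1), X)) :
    singBoundary n (Finsupp.single σ 1) =
      ∑ i : Fin (n + 2), (-1 : ℤ) ^ (i : ℕ) • Finsupp.single (singFace i σ) (1 : ℤ) := by
  simp [singBoundary]

lemma stdSimplex_map_succAbove (i : Fin (n + 2)) :
    (⟨stdSimplex.map i.succAbove, stdSimplex.continuous_map _⟩ :
      C(TopSimplex n, TopSimplex (n + 1))) =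
      affineSimplex fun j => simplexVertices (n + 1) (i.succAbove j) := by
  ext w j
  change stdSimplex.map i.succAbove w j = _
  rw [affineSimplex_apply, stdSimplex.map_coe, FunOnFinite.linearMap_apply_apply]
  rw [Finset.sum_filter]
  refine Finset.sum_congr rfl fun l _ => ?_
  by_cases h : i.succAbove l = j
  · subst h
    simp [simplexVertices]
  · simp [simplexVertices, h, Ne.symm h]

lemma singFace_eq (i : Fin (n + 2)) (σ : C(TopSimplex (n + 1), X)) :
    singFace i σ = σ.comp (affineSimplex fun j => simplexVertices (n + 1) (i.succAbove j)) := by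
  rw [singFace, stdSimplex_map_succAbove]

/-- The singular chain defined by an affine chain in the domain of a singular simplex. -/
noncomputable def pushTuple (σ : C(TopSimplex k, X)) :
    TupleChain (n + 1) (TopSimplex k) →ₗ[ℤ] SingChain n X :=
  Finsupp.lmapDomain ℤ ℤ fun v => σ.comp (affineSimplex v)

@[simp] lemma pushTuple_single (σ : C(TopSimplex k, X)) (v : Fin (n + 1) → TopSimplex k) (c : ℤ) :
    pushTuple σ (Finsupp.single v c) = Finsupp.single (σ.comp (affineSimplex v)) c := by
  simp [pushTuple]

lemma singBoundary_pushTuple (σ : C(TopSimplex k, X)) (c : TupleChain (n + 2) (TopSimplex k)) :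
    singBoundary n (pushTuple σ c) = pushTuple σ (tupleBoundary (n + 1) c) := by
  suffices h : singBoundary n ∘ₗ pushTuple σ = pushTuple σ ∘ₗ tupleBoundary (n + 1) from
    LinearMap.congr_fun h c
  refine tupleChain_hom_ext fun v => ?_
  simp only [LinearMap.comp_apply, pushTuple_single, singBoundary_single, tupleBoundary_single,
    map_sum, map_smul]
  refine Finset.sum_congr rfl fun i _ => ?_
  rw [singFace_eq, ContinuousMap.comp_assoc, affineSimplex_comp]
  congr 4
  ext j : 1
  exact affineSimplex_vertex _ _

lemma pushTuple_comp_affine {l : ℕ} (σ : C(TopSimplex k, X)) (u : Fin (l + 1) → TopSimplex k)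
    (c : TupleChain (n + 1) (TopSimplex l)) :
    pushTuple (σ.comp (affineSimplex u)) c = pushTuple σ (tupleMap (affineSimplex u) c) := by
  suffices h : pushTuple (σ.comp (affineSimplex u)) =
      pushTuple σ ∘ₗ tupleMap (n := n + 1) (affineSimplex u) from LinearMap.congr_fun h c
  refine tupleChain_hom_ext fun v => ?_
  simp only [LinearMap.comp_apply, pushTuple_single, tupleMap_single, ContinuousMap.comp_assoc,
    affineSimplex_comp]

/-- Barycentric subdivision of singular chains. -/
noncomputable def singSubdivision (n : ℕ) : SingChain n X →ₗ[ℤ] SingChain n X :=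
  Finsupp.linearCombination ℤ fun σ =>
    pushTuple σ (tupleSubdivision n (n + 1) (Finsupp.single (simplexVertices n) 1))

/-- The natural chain homotopy from the identity to the subdivision of singular chains. -/
noncomputable def singHomotopy (n : ℕ) : SingChain n X →ₗ[ℤ] SingChain (n + 1) X :=
  Finsupp.linearCombination ℤ fun σ =>
    pushTuple σ (tupleHomotopy n (n + 1) (Finsupp.single (simplexVertices n) 1))

lemma singChain_hom_ext {M : Type*} [AddCommGroup M] {f g : SingChain n X →ₗ[ℤ] M}
    (h : ∀ v, f (Finsupp.single v 1) = g (Finsupp.single v 1)) : f = g := by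
  refine Finsupp.lhom_ext' fun v => LinearMap.ext_ring ?_
  simpa using h v

lemma singSubdivision_pushTuple (σ : C(TopSimplex k, X)) (c : TupleChain (n + 1) (TopSimplex k)) :
    singSubdivision n (pushTuple σ c) = pushTuple σ (tupleSubdivision k (n + 1) c) := by
  suffices h : singSubdivision n ∘ₗ pushTuple σ = pushTuple σ ∘ₗ tupleSubdivision k (n + 1) from
    LinearMap.congr_fun h c
  refine tupleChain_hom_ext fun v => ?_
  simp only [LinearMap.comp_apply, pushTuple_single]
  rw [singSubdivision, Finsupp.linearCombination_single, one_smul, pushTuple_comp_affine,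
    tupleMap_subdivision, tupleMap_single, affineSimplex_comp_vertices]

lemma singHomotopy_pushTuple (σ : C(TopSimplex k, X)) (c : TupleChain (n + 1) (TopSimplex k)) :
    singHomotopy n (pushTuple σ c) = pushTuple σ (tupleHomotopy k (n + 1) c) := by
  suffices h : singHomotopy n ∘ₗ pushTuple σ = pushTuple σ ∘ₗ tupleHomotopy k (n + 1) from
    LinearMap.congr_fun h c
  refine tupleChain_hom_ext fun v => ?_
  simp only [LinearMap.comp_apply, pushTuple_single]
  rw [singHomotopy, Finsupp.linearCombination_single, one_smul, pushTuple_comp_affine,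
    tupleMap_homotopy, tupleMap_single, affineSimplex_comp_vertices]

lemma pushTuple_vertices (σ : C(TopSimplex n, X)) :
    pushTuple σ (Finsupp.single (simplexVertices n) 1) = Finsupp.single σ 1 := by
  rw [pushTuple_single, affineSimplex_vertices, ContinuousMap.comp_id]

lemma singBoundary_subdivision (c : SingChain (n + 1) X) :
    singBoundary n (singSubdivision (n + 1) c) = singSubdivision n (singBoundary n c) := by
  suffices h : singBoundary n ∘ₗ singSubdivision (n + 1) =
      singSubdivision (X := X) n ∘ₗ singBoundary n from LinearMap.congr_fun h c
  refine singChain_hom_ext fun σ => ?_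
  simp only [LinearMap.comp_apply]
  rw [← pushTuple_vertices, singSubdivision_pushTuple, singBoundary_pushTuple,
    singBoundary_pushTuple, singSubdivision_pushTuple, tupleBoundary_subdivision]

lemma singBoundary_homotopy (c : SingChain (n + 1) X) :
    singBoundary (n + 1) (singHomotopy (n + 1) c) + singHomotopy n (singBoundary n c) =
      c - singSubdivision (n + 1) c := by
  suffices h : singBoundary (n + 1) ∘ₗ singHomotopy (n + 1) + singHomotopy n ∘ₗ singBoundary n =
      LinearMap.id - singSubdivision (X := X) (n + 1) from LinearMap.congr_fun h c
  refine singChain_hom_ext fun σ => ?_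
  simp only [LinearMap.comp_apply, LinearMap.add_apply, LinearMap.sub_apply, LinearMap.id_apply]
  rw [← pushTuple_vertices, singSubdivision_pushTuple, singHomotopy_pushTuple,
    singBoundary_pushTuple, singBoundary_pushTuple, singHomotopy_pushTuple, ← map_add, ← map_sub,
    tupleBoundary_homotopy]

/-- The chains whose simplices each lie in `U` or in `V`. -/
noncomputable def smallChains (U V : Set X) (n : ℕ) : Submodule ℤ (SingChain n X) :=
  Finsupp.supported ℤ ℤ {σ | Set.range σ ⊆ U ∨ Set.range σ ⊆ V}

variable {U V : Set X}

lemma pushTuple_mem_smallChains {σ : C(TopSimplex k, X)}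
    {c : TupleChain (n + 1) (TopSimplex k)}
    (h : ∀ v ∈ c.support, Set.range (σ.comp (affineSimplex v)) ⊆ U ∨
      Set.range (σ.comp (affineSimplex v)) ⊆ V) :
    pushTuple σ c ∈ smallChains U V n := by
  classical
  rw [smallChains, Finsupp.mem_supported]
  intro w hw
  have := Finsupp.mapDomain_support (f := fun v => σ.comp (affineSimplex v)) hw
  obtain ⟨v, hv, rfl⟩ := Finset.mem_image.1 this
  exact h v hv

lemma linear_mem_of_mem_smallChains {n' : ℕ} {c : SingChain n X} (hc : c ∈ smallChains U V n)
    (f : SingChain n X →ₗ[ℤ] SingChain n' X)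
    (hf : ∀ σ : C(TopSimplex n, X), Set.range σ ⊆ U ∨ Set.range σ ⊆ V →
      f (Finsupp.single σ 1) ∈ smallChains U V n') : f c ∈ smallChains U V n' := by
  rw [smallChains, Finsupp.mem_supported] at hc
  rw [← Finsupp.sum_single c, Finsupp.sum, map_sum]
  refine Submodule.sum_mem _ fun v hv => ?_
  have h1 : Finsupp.single v (c v) = c v • Finsupp.single v (1 : ℤ) := by simp
  rw [h1, map_smul]
  exact Submodule.smul_mem _ _ (hf v (hc hv))

lemma range_comp_small {σ : C(TopSimplex k, X)} (f : C(TopSimplex n, TopSimplex k))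
    (h : Set.range σ ⊆ U ∨ Set.range σ ⊆ V) :
    Set.range (σ.comp f) ⊆ U ∨ Set.range (σ.comp f) ⊆ V := by
  have : Set.range (σ.comp f) ⊆ Set.range σ := by
    rw [ContinuousMap.coe_comp]; exact Set.range_comp_subset_range _ _
  exact h.imp this.trans this.trans

lemma singSubdivision_mem_smallChains {c : SingChain n X} (hc : c ∈ smallChains U V n) :
    singSubdivision n c ∈ smallChains U V n := by
  refine linear_mem_of_mem_smallChains hc _ fun σ hσ => ?_
  rw [← pushTuple_vertices, singSubdivision_pushTuple]
  exact pushTuple_mem_smallChains fun v _ => range_comp_small _ hσ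

lemma singHomotopy_mem_smallChains {c : SingChain n X} (hc : c ∈ smallChains U V n) :
    singHomotopy n c ∈ smallChains U V (n + 1) := by
  refine linear_mem_of_mem_smallChains hc _ fun σ hσ => ?_
  rw [← pushTuple_vertices, singHomotopy_pushTuple]
  exact pushTuple_mem_smallChains fun v _ => range_comp_small _ hσ

lemma singSubdivision_iterate_single (σ : C(TopSimplex n, X)) (s : ℕ) :
    ((singSubdivision n)^[s]) (Finsupp.single σ 1) =
      pushTuple σ (((tupleSubdivision n (n + 1))^[s])
        (Finsupp.single (simplexVertices n) 1)) := by
  induction s with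
  | zero => exact (pushTuple_vertices σ).symm
  | succ s ih =>
    rw [Function.iterate_succ_apply', Function.iterate_succ_apply', ih, singSubdivision_pushTuple]

/-- By Lebesgue's number lemma, a sufficiently fine subdivision of a chain is small. -/
lemma exists_singSubdivision_iterate_mem (hU : IsOpen U) (hV : IsOpen V) (hUV : U ∪ V = Set.univ)
    (c : SingChain n X) : ∃ r : ℕ, ((singSubdivision n)^[r]) c ∈ smallChains U V n := by
  have hσ : ∀ σ : C(TopSimplex n, X), ∃ r : ℕ, ∀ s, r ≤ s →
      ((singSubdivision n)^[s]) (Finsupp.single σ 1) ∈ smallChains U V n := by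
    intro σ
    obtain ⟨δ, hδ, hleb⟩ := lebesgue_number_lemma_of_metric (s := (Set.univ : Set (TopSimplex n)))
      (c := fun b : Bool => σ ⁻¹' (cond b U V)) isCompact_univ
      (fun b => (by cases b <;> assumption : IsOpen (cond b U V)).preimage σ.continuous)
      (fun x _ => by
        rcases (hUV ▸ Set.mem_univ (σ x) : σ x ∈ U ∪ V) with h | h
        · exact Set.mem_iUnion.2 ⟨true, h⟩
        · exact Set.mem_iUnion.2 ⟨false, h⟩)
    obtain ⟨r, hr⟩ := exists_tupleSubdivision_iterate_mem n (half_pos hδ)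
    refine ⟨r, fun s hs => ?_⟩
    rw [singSubdivision_iterate_single]
    refine pushTuple_mem_smallChains fun v hv => ?_
    have hv' := (Finsupp.mem_supported _ _).1 (hr s hs) hv
    obtain ⟨b, hb⟩ := hleb (v 0) (Set.mem_univ _)
    have : Set.range (σ.comp (affineSimplex v)) ⊆ cond b U V := by
      rintro _ ⟨w, rfl⟩
      apply hb
      rw [Metric.mem_ball, dist_comm]
      exact (dist_affineSimplex_le v w _ fun i => hv' 0 i).trans_lt (half_lt_self hδ)
    cases b
    · exact Or.inr this
    · exact Or.inl this
  choose r hr using hσ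
  refine ⟨c.support.sup r, ?_⟩
  have hlin : ∀ s : ℕ, ((singSubdivision (X := X) n)^[s] : SingChain n X → SingChain n X) =
      ((singSubdivision (X := X) n) ^ s : Module.End ℤ (SingChain n X)) := fun s =>
    (Module.End.coe_pow _ _).symm
  simp only [hlin] at hr ⊢
  rw [← Finsupp.sum_single c, Finsupp.sum, map_sum]
  refine Submodule.sum_mem _ fun v hv => ?_
  have h1 : Finsupp.single v (c v) = c v • Finsupp.single v (1 : ℤ) := by simp
  rw [h1, map_smul]
  refine Submodule.smul_mem _ _ (hr v _ ?_)
  have := Finset.le_sup (f := r) hv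
  rwa [← Finsupp.sum, Finsupp.sum_single]

/-- A chain with small boundary is small up to a boundary. -/
theorem exists_sub_singBoundary_mem_smallChains (hU : IsOpen U) (hV : IsOpen V)
    (hUV : U ∪ V = Set.univ) (z : SingChain (n + 1) X)
    (hz : singBoundary n z ∈ smallChains U V n) :
    ∃ w, z - singBoundary (n + 1) w ∈ smallChains U V (n + 1) := by
  obtain ⟨r, hr⟩ := exists_singSubdivision_iterate_mem hU hV hUV z
  induction r generalizing z with
  | zero => exact ⟨0, by simpa using hr⟩
  | succ r ih =>
    rw [Function.iterate_succ_apply] at hr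
    have hz' : singBoundary n (singSubdivision (n + 1) z) ∈ smallChains U V n := by
      rw [singBoundary_subdivision]; exact singSubdivision_mem_smallChains hz
    obtain ⟨w, hw⟩ := ih _ hz' hr
    refine ⟨w + singHomotopy (n + 1) z, ?_⟩
    have h2 := singHomotopy_mem_smallChains hz
    have h3 := singBoundary_homotopy z
    have : z - singBoundary (n + 1) (w + singHomotopy (n + 1) z) =
        (singSubdivision (n + 1) z - singBoundary (n + 1) w) +
          singHomotopy n (singBoundary n z) := by
      rw [map_add, eq_sub_of_add_eq h3]
      abel
    rw [this]
    exact Submodule.add_mem _ hw h2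

end Singular

/-! ### The Mayer–Vietoris sequence of singular homology -/

section MayerVietoris

open CategoryTheory Limits AlgebraicTopology

/-- The singular chain complex with integral coefficients. -/
noncomputable abbrev integralChains (X : TopCat.{0}) : ChainComplex (ModuleCat.{0} ℤ) ℕ :=
  (TopCat.toSSet.obj X).chainComplex (ModuleCat.of ℤ ℤ)

/-- The chain map induced by a continuous map. -/
noncomputable abbrev integralChainsMap {X Y : TopCat.{0}} (f : X ⟶ Y) :
    integralChains X ⟶ integralChains Y :=
  SSet.chainComplexMap (TopCat.toSSet.map f) (ModuleCat.of ℤ ℤ)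

/-- The chain of a singular simplex. -/
noncomputable abbrev integralSimplex (X : TopCat.{0}) {n : ℕ}
    (σ : (TopCat.toSSet.obj X).obj (Opposite.op (SimplexCategory.mk n))) :
    ModuleCat.of ℤ ℤ ⟶ (integralChains X).X n :=
  (TopCat.toSSet.obj X).ιChainComplex σ

/-- The `n`-chains of the singular chain complex, as formal sums of singular simplices. -/
noncomputable def integralChainsHom (X : TopCat.{0}) (n : ℕ) :
    (integralChains X).X n ⟶ ModuleCat.of ℤ (SingChain n X) :=
  Cofan.IsColimit.desc
    (SSet.isColimitChainComplexXCofan (TopCat.toSSet.obj X) (ModuleCat.of ℤ ℤ) n)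
    fun σ => ModuleCat.ofHom (Finsupp.lsingle (TopCat.toSSetObjEquiv X _ σ))

lemma integralSimplex_hom (X : TopCat.{0}) {n : ℕ}
    (σ : (TopCat.toSSet.obj X).obj (Opposite.op (SimplexCategory.mk n))) :
    integralSimplex X σ ≫ integralChainsHom X n =
      ModuleCat.ofHom (Finsupp.lsingle (R := ℤ) (M := ℤ) (TopCat.toSSetObjEquiv X _ σ)) :=
  Cofan.IsColimit.fac
      (SSet.isColimitChainComplexXCofan (TopCat.toSSet.obj X) (ModuleCat.of ℤ ℤ) n) _ σ

lemma integralSimplex_hom_assoc (X : TopCat.{0}) {n : ℕ}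
    (σ : (TopCat.toSSet.obj X).obj (Opposite.op (SimplexCategory.mk n))) {Z : ModuleCat.{0} ℤ}
    (h : ModuleCat.of ℤ (SingChain n X) ⟶ Z) :
    integralSimplex X σ ≫ integralChainsHom X n ≫ h =
      ModuleCat.ofHom (Finsupp.lsingle (R := ℤ) (M := ℤ) (TopCat.toSSetObjEquiv X _ σ)) ≫ h := by
  rw [← Category.assoc, integralSimplex_hom]

lemma integralSimplex_hom_one (X : TopCat.{0}) {n : ℕ}
    (σ : (TopCat.toSSet.obj X).obj (Opposite.op (SimplexCategory.mk n))) :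
    (integralChainsHom X n).hom ((integralSimplex X σ).hom (1 : ℤ)) =
      Finsupp.single (TopCat.toSSetObjEquiv X _ σ) (1 : ℤ) :=
  congrArg (fun φ => φ.hom (1 : ℤ)) (integralSimplex_hom X σ)

/-- The formal sum of singular simplices as an `n`-chain. -/
noncomputable def integralChainsInv (X : TopCat.{0}) (n : ℕ) :
    ModuleCat.of ℤ (SingChain n X) ⟶ (integralChains X).X n :=
  ModuleCat.ofHom (Finsupp.linearCombination ℤ fun σ =>
    (integralSimplex X ((TopCat.toSSetObjEquiv X _).symm σ)).hom (1 : ℤ))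

lemma integralChainsInv_single (X : TopCat.{0}) {n : ℕ} (σ : C(TopSimplex n, X)) :
    (integralChainsInv X n).hom (Finsupp.single σ (1 : ℤ)) =
      (integralSimplex X ((TopCat.toSSetObjEquiv X _).symm σ)).hom (1 : ℤ) := by
  have h : ∀ (M : ModuleCat.{0} ℤ) (g : C(TopSimplex n, X) → M),
      (ModuleCat.ofHom (Finsupp.linearCombination ℤ g)).hom (Finsupp.single σ (1 : ℤ)) = g σ :=
    fun M g => (Finsupp.linearCombination_single ℤ 1 σ).trans
      (@one_smul ℤ M _ M.isModule.toMulAction (g σ))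
  exact h _ _

/-- The `n`-chains of the singular chain complex are the formal sums of singular simplices. -/
noncomputable def integralChainsIso (X : TopCat.{0}) (n : ℕ) :
    (integralChains X).X n ≅ ModuleCat.of ℤ (SingChain n X) where
  hom := integralChainsHom X n
  inv := integralChainsInv X n
  hom_inv_id := by
    refine SSet.chainComplex_hom_ext fun σ => ?_
    refine (integralSimplex_hom_assoc X σ _).trans ?_
    refine ModuleCat.hom_ext (LinearMap.ext_ring ?_)
    refine (integralChainsInv_single X _).trans ?_
    rw [Equiv.symm_apply_apply]
    rfl
  inv_hom_id := by
    refine ModuleCat.hom_ext (singChain_hom_ext fun σ => ?_)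
    have h2 := integralSimplex_hom_one X
      ((TopCat.toSSetObjEquiv X (Opposite.op (SimplexCategory.mk n))).symm σ)
    rw [Equiv.apply_symm_apply] at h2
    exact (congrArg (integralChainsHom X n).hom (integralChainsInv_single X σ)).trans h2

variable {X Y : TopCat.{0}} {n : ℕ}

lemma integralChainsHom_d :
    (integralChains X).d (n + 1) n ≫ integralChainsHom X n =
      integralChainsHom X (n + 1) ≫ ModuleCat.ofHom (singBoundary n) := by
  refine SSet.chainComplex_hom_ext fun σ => ?_
  refine (SSet.ιChainComplex_d_assoc _ _ _ _).trans ?_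
  refine Eq.trans ?_ (integralSimplex_hom_assoc X σ _).symm
  rw [Preadditive.sum_comp]
  refine ModuleCat.hom_ext (LinearMap.ext_ring ?_)
  refine Eq.trans ?_ (singBoundary_single _).symm
  rw [ModuleCat.hom_sum, LinearMap.sum_apply]
  refine Finset.sum_congr rfl fun i _ => ?_
  rw [Preadditive.zsmul_comp, ModuleCat.hom_zsmul, LinearMap.smul_apply]
  congr 1
  exact integralSimplex_hom_one X _

lemma integralChainsHom_map (f : X ⟶ Y) :
    (integralChainsMap f).f n ≫ integralChainsHom Y n =
      integralChainsHom X n ≫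
        ModuleCat.ofHom (Finsupp.lmapDomain ℤ ℤ fun σ => f.hom.comp σ) := by
  refine SSet.chainComplex_hom_ext fun σ => ?_
  refine (SSet.ι_chainComplexMap_f_assoc _ _ (TopCat.toSSet.map f) _ σ _).trans ?_
  refine Eq.trans ?_ (integralSimplex_hom_assoc X σ _).symm
  refine (integralSimplex_hom Y _).trans ?_
  refine ModuleCat.hom_ext (LinearMap.ext_ring ?_)
  refine Eq.trans ?_ (Finsupp.mapDomain_single).symm
  rfl

lemma integralChainsHom_d_apply (x : (integralChains X).X (n + 1)) :
    (integralChainsHom X n).hom (((integralChains X).d (n + 1) n).hom x) =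
      singBoundary n ((integralChainsHom X (n + 1)).hom x) :=
  congrArg (fun φ => φ.hom x) (integralChainsHom_d (X := X) (n := n))

lemma integralChainsHom_map_apply (f : X ⟶ Y) (x : (integralChains X).X n) :
    (integralChainsHom Y n).hom (((integralChainsMap f).f n).hom x) =
      Finsupp.mapDomain (fun σ => f.hom.comp σ) ((integralChainsHom X n).hom x) :=
  congrArg (fun φ => φ.hom x) (integralChainsHom_map f (n := n))

lemma integralChainsHom_injective : Function.Injective (integralChainsHom X n).hom :=
  (integralChainsIso X n).toLinearEquiv.injective

lemma integralChainsHom_surjective : Function.Surjective (integralChainsHom X n).hom :=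
  (integralChainsIso X n).toLinearEquiv.surjective

/-- The inclusion of a subspace. -/
abbrev subspaceIncl (W : Set X) : TopCat.of W ⟶ X := TopCat.ofHom ⟨Subtype.val, by fun_prop⟩

/-- The inclusion of a subspace in a larger one. -/
abbrev subspaceMap {W W' : Set X} (h : W ⊆ W') : TopCat.of W ⟶ TopCat.of W' :=
  TopCat.ofHom ⟨Set.inclusion h, continuous_inclusion h⟩

lemma subspaceIncl_comp_injective (W : Set X) :
    Function.Injective fun σ : C(TopSimplex n, W) => (subspaceIncl W).hom.comp σ := by
  intro σ τ h
  ext x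
  exact congrArg (fun f : C(TopSimplex n, X) => f x) h

lemma exists_mapDomain_subspaceIncl_iff (W : Set X) (c : SingChain n X) :
    (∃ a : SingChain n W, Finsupp.mapDomain (fun σ => (subspaceIncl W).hom.comp σ) a = c) ↔
      c ∈ Finsupp.supported ℤ ℤ {σ : C(TopSimplex n, X) | Set.range σ ⊆ W} := by
  have h := Finsupp.lmapDomain_supported ℤ ℤ
    (fun σ : C(TopSimplex n, W) => (subspaceIncl W).hom.comp σ) Set.univ
  have h2 : (fun σ : C(TopSimplex n, W) => (subspaceIncl W).hom.comp σ) '' Set.univ =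
      {σ : C(TopSimplex n, X) | Set.range σ ⊆ W} := by
    ext σ
    constructor
    · rintro ⟨τ, -, rfl⟩ _ ⟨x, rfl⟩
      exact (τ x).2
    · intro hσ
      exact ⟨⟨fun x => ⟨σ x, hσ ⟨x, rfl⟩⟩, by fun_prop⟩, trivial, by ext; rfl⟩
  rw [h2] at h
  rw [← h, Finsupp.supported_univ]
  simp only [Submodule.map_top, LinearMap.mem_range]
  rfl

variable (U V : Set X)

/-- The inclusions of the chains of `U ∩ V` in those of `U` and of `V`. -/
noncomputable def mvIncl : integralChains (TopCat.of ↥(U ∩ V)) ⟶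
    integralChains (TopCat.of U) ⊞ integralChains (TopCat.of V) :=
  biprod.lift (integralChainsMap (subspaceMap Set.inter_subset_left))
    (integralChainsMap (subspaceMap Set.inter_subset_right))

/-- The difference of the inclusions of the chains of `U` and of `V` in those of `X`. -/
noncomputable def mvDiff : integralChains (TopCat.of U) ⊞ integralChains (TopCat.of V) ⟶
    integralChains X :=
  biprod.desc (integralChainsMap (subspaceIncl U)) (-integralChainsMap (subspaceIncl V))

lemma integralChainsMap_comp {Z : TopCat.{0}} (f : X ⟶ Y) (g : Y ⟶ Z) :
    integralChainsMap f ≫ integralChainsMap g = integralChainsMap (f ≫ g) := by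
  simp [integralChainsMap]

lemma mvIncl_comp_mvDiff : mvIncl U V ≫ mvDiff U V = 0 := by
  rw [mvIncl, mvDiff, biprod.lift_desc, Preadditive.comp_neg, integralChainsMap_comp,
    integralChainsMap_comp]
  exact add_neg_cancel _

variable {U V}

/-- The first projection of the middle term of the Mayer–Vietoris sequence. -/
noncomputable abbrev mvFst (U V : Set X) : integralChains (TopCat.of U) ⊞
    integralChains (TopCat.of V) ⟶ integralChains (TopCat.of U) := biprod.fst

/-- The second projection of the middle term of the Mayer–Vietoris sequence. -/
noncomputable abbrev mvSnd (U V : Set X) : integralChains (TopCat.of U) ⊞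
    integralChains (TopCat.of V) ⟶ integralChains (TopCat.of V) := biprod.snd

lemma mvDiff_apply (x : (integralChains (TopCat.of U) ⊞ integralChains (TopCat.of V)).X n) :
    (integralChainsHom X n).hom (((mvDiff U V).f n).hom x) =
      Finsupp.mapDomain (fun σ => (subspaceIncl U).hom.comp σ) ((integralChainsHom _ n).hom
        (((mvFst U V).f n).hom x)) -
      Finsupp.mapDomain (fun σ => (subspaceIncl V).hom.comp σ) ((integralChainsHom _ n).hom
        (((mvSnd U V).f n).hom x)) := by
  have h : mvDiff U V = mvFst U V ≫ integralChainsMap (subspaceIncl U) -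
      mvSnd U V ≫ integralChainsMap (subspaceIncl V) := by
    rw [mvDiff]
    refine biprod.hom_ext' _ _ ?_ ?_ <;> simp
  rw [← integralChainsHom_map_apply, ← integralChainsHom_map_apply, ← map_sub, h]
  rfl

lemma biprod_ext_apply {K L : ChainComplex (ModuleCat.{0} ℤ) ℕ} {x y : (K ⊞ L).X n}
    (h1 : ((biprod.fst : K ⊞ L ⟶ K).f n).hom x = ((biprod.fst : K ⊞ L ⟶ K).f n).hom y)
    (h2 : ((biprod.snd : K ⊞ L ⟶ L).f n).hom x = ((biprod.snd : K ⊞ L ⟶ L).f n).hom y) :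
    x = y := by
  have h : ∀ z : (K ⊞ L).X n, ((biprod.inl : K ⟶ K ⊞ L).f n).hom
      (((biprod.fst : K ⊞ L ⟶ K).f n).hom z) + ((biprod.inr : L ⟶ K ⊞ L).f n).hom
      (((biprod.snd : K ⊞ L ⟶ L).f n).hom z) = z := fun z =>
    congrArg (fun φ : K ⊞ L ⟶ K ⊞ L => (φ.f n).hom z) (biprod.total (X := K) (Y := L))
  rw [← h x, ← h y, h1, h2]

lemma biprod_exists_apply {K L : ChainComplex (ModuleCat.{0} ℤ) ℕ} (a : K.X n) (b : L.X n) :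
    ∃ x : (K ⊞ L).X n, ((biprod.fst : K ⊞ L ⟶ K).f n).hom x = a ∧
      ((biprod.snd : K ⊞ L ⟶ L).f n).hom x = b := by
  have h1 : ((biprod.fst : K ⊞ L ⟶ K).f n).hom (((biprod.inl : K ⟶ K ⊞ L).f n).hom a) = a :=
    congrArg (fun φ : K ⟶ K => (φ.f n).hom a) (biprod.inl_fst (X := K) (Y := L))
  have h2 : ((biprod.snd : K ⊞ L ⟶ L).f n).hom (((biprod.inl : K ⟶ K ⊞ L).f n).hom a) = 0 :=
    congrArg (fun φ : K ⟶ L => (φ.f n).hom a) (biprod.inl_snd (X := K) (Y := L))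
  have h3 : ((biprod.fst : K ⊞ L ⟶ K).f n).hom (((biprod.inr : L ⟶ K ⊞ L).f n).hom b) = 0 :=
    congrArg (fun φ : L ⟶ K => (φ.f n).hom b) (biprod.inr_fst (X := K) (Y := L))
  have h4 : ((biprod.snd : K ⊞ L ⟶ L).f n).hom (((biprod.inr : L ⟶ K ⊞ L).f n).hom b) = b :=
    congrArg (fun φ : L ⟶ L => (φ.f n).hom b) (biprod.inr_snd (X := K) (Y := L))
  refine ⟨((biprod.inl : K ⟶ K ⊞ L).f n).hom a + ((biprod.inr : L ⟶ K ⊞ L).f n).hom b, ?_, ?_⟩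
  · rw [map_add, h1, h3, add_zero]
  · rw [map_add, h2, h4, zero_add]

lemma mvIncl_fst_apply (t : (integralChains (TopCat.of ↥(U ∩ V))).X n) :
    ((mvFst U V).f n).hom (((mvIncl U V).f n).hom t) =
      ((integralChainsMap (subspaceMap (Set.inter_subset_left (s := U) (t := V)))).f n).hom t :=
  congrArg (fun φ : integralChains (TopCat.of ↥(U ∩ V)) ⟶ integralChains (TopCat.of U) =>
    (φ.f n).hom t) (biprod.lift_fst _ _)

lemma mvIncl_snd_apply (t : (integralChains (TopCat.of ↥(U ∩ V))).X n) :
    ((mvSnd U V).f n).hom (((mvIncl U V).f n).hom t) =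
      ((integralChainsMap (subspaceMap (Set.inter_subset_right (s := U) (t := V)))).f n).hom t :=
  congrArg (fun φ : integralChains (TopCat.of ↥(U ∩ V)) ⟶ integralChains (TopCat.of V) =>
    (φ.f n).hom t) (biprod.lift_snd _ _)

lemma mapDomain_subspaceMap {W W' : Set X} (h : W ⊆ W') (a : SingChain n W) :
    Finsupp.mapDomain (fun σ => (subspaceIncl W').hom.comp σ)
      (Finsupp.mapDomain (fun σ => (subspaceMap h).hom.comp σ) a) =
    Finsupp.mapDomain (fun σ => (subspaceIncl W).hom.comp σ) a := by
  rw [← Finsupp.mapDomain_comp]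
  rfl

variable (U V)

lemma mv_exact_left (n : ℕ) (x : (integralChains (TopCat.of U) ⊞ integralChains (TopCat.of V)).X n)
    (hx : ((mvDiff U V).f n).hom x = 0) : ∃ t, ((mvIncl U V).f n).hom t = x := by
  set a := (integralChainsHom _ n).hom (((mvFst U V).f n).hom x)
    with ha
  set b := (integralChainsHom _ n).hom (((mvSnd U V).f n).hom x)
    with hb
  have hab : Finsupp.mapDomain (fun σ => (subspaceIncl U).hom.comp σ) a =
      Finsupp.mapDomain (fun σ => (subspaceIncl V).hom.comp σ) b := by
    rw [← sub_eq_zero, ha, hb, ← mvDiff_apply, hx, map_zero]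
  have h1 := (exists_mapDomain_subspaceIncl_iff (n := n) U _).1 ⟨a, rfl⟩
  have h2 := (exists_mapDomain_subspaceIncl_iff (n := n) V _).1 ⟨b, rfl⟩
  rw [← hab] at h2
  obtain ⟨t, ht⟩ := (exists_mapDomain_subspaceIncl_iff (n := n) (U ∩ V) _).2
    (show Finsupp.mapDomain (fun σ => (subspaceIncl U).hom.comp σ) a ∈ _ from by
      rw [Finsupp.mem_supported] at h1 h2 ⊢
      exact fun σ hσ => Set.subset_inter (h1 hσ) (h2 hσ))
  obtain ⟨t', rfl⟩ := integralChainsHom_surjective (X := TopCat.of ↥(U ∩ V)) t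
  refine ⟨t', biprod_ext_apply ?_ ?_⟩
  · apply integralChainsHom_injective
    rw [mvIncl_fst_apply, integralChainsHom_map_apply, ← ha]
    apply Finsupp.mapDomain_injective (subspaceIncl_comp_injective (n := n) U)
    rw [mapDomain_subspaceMap, ht]
  · apply integralChainsHom_injective
    rw [mvIncl_snd_apply, integralChainsHom_map_apply, ← hb]
    apply Finsupp.mapDomain_injective (subspaceIncl_comp_injective (n := n) V)
    rw [mapDomain_subspaceMap, ht, hab]

lemma mvIncl_injective (n : ℕ) : Function.Injective ((mvIncl U V).f n).hom := by
  intro s t h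
  apply integralChainsHom_injective
  have := congrArg (fun y => (integralChainsHom _ n).hom
    (((mvFst U V).f n).hom y)) h
  simp only [mvIncl_fst_apply] at this
  rw [integralChainsHom_map_apply, integralChainsHom_map_apply] at this
  have := congrArg (Finsupp.mapDomain (fun σ => (subspaceIncl U).hom.comp σ)) this
  rw [mapDomain_subspaceMap, mapDomain_subspaceMap] at this
  exact Finsupp.mapDomain_injective (subspaceIncl_comp_injective (n := n) (U ∩ V)) this

/-- The image of the Mayer–Vietoris difference map is the complex of small chains. -/
lemma exists_mvDiff_iff (z : (integralChains X).X n) :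
    (∃ x, ((mvDiff U V).f n).hom x = z) ↔ (integralChainsHom X n).hom z ∈ smallChains U V n := by
  have hsup : smallChains U V n = Finsupp.supported ℤ ℤ {σ : C(TopSimplex n, X) | Set.range σ ⊆ U} ⊔
      Finsupp.supported ℤ ℤ {σ : C(TopSimplex n, X) | Set.range σ ⊆ V} := by
    rw [← Finsupp.supported_union]; rfl
  rw [hsup, Submodule.mem_sup]
  constructor
  · rintro ⟨x, rfl⟩
    rw [mvDiff_apply]
    exact ⟨_, (exists_mapDomain_subspaceIncl_iff U _).1 ⟨_, rfl⟩, _,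
      Submodule.neg_mem _ ((exists_mapDomain_subspaceIncl_iff V _).1 ⟨_, rfl⟩),
      (sub_eq_add_neg _ _).symm⟩
  · rintro ⟨c, hc, d, hd, h⟩
    obtain ⟨a, rfl⟩ := (exists_mapDomain_subspaceIncl_iff U _).2 hc
    obtain ⟨b, rfl⟩ := (exists_mapDomain_subspaceIncl_iff V _).2 hd
    obtain ⟨a, rfl⟩ := integralChainsHom_surjective (X := TopCat.of U) a
    obtain ⟨b, rfl⟩ := integralChainsHom_surjective (X := TopCat.of V) b
    obtain ⟨x, hx1, hx2⟩ := biprod_exists_apply a (-b)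
    refine ⟨x, integralChainsHom_injective ?_⟩
    rw [mvDiff_apply, hx1, hx2, ← h, map_neg, sub_eq_add_neg]
    congr 1
    rw [← Finsupp.lmapDomain_apply ℤ ℤ, ← Finsupp.lmapDomain_apply ℤ ℤ, map_neg, neg_neg]

/-- The quotient of the singular chains by the small ones is acyclic. -/
lemma mv_cokernel_acyclic (hU : IsOpen U) (hV : IsOpen V) (hUV : U ∪ V = Set.univ) :
    (cokernel (mvDiff U V)).Acyclic := by
  have hπ : ∀ i, Function.Surjective ((cokernel.π (mvDiff U V)).f i).hom := fun i =>
    (ModuleCat.epi_iff_surjective _).1 inferInstance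
  have hcomp : ∀ i (x : (integralChains (TopCat.of U) ⊞ integralChains (TopCat.of V)).X i),
      ((cokernel.π (mvDiff U V)).f i).hom (((mvDiff U V).f i).hom x) = 0 := fun i x =>
    congrArg (fun φ : _ ⟶ cokernel (mvDiff U V) => (φ.f i).hom x) (cokernel.condition (mvDiff U V))
  have hex : ∀ i (z : (integralChains X).X i), ((cokernel.π (mvDiff U V)).f i).hom z = 0 →
      ∃ x, ((mvDiff U V).f i).hom x = z := fun i z hz => by
    have h := (ShortComplex.exact_cokernel (mvDiff U V)).map
      (HomologicalComplex.eval (ModuleCat.{0} ℤ) (ComplexShape.down ℕ) i)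
    exact (ShortComplex.moduleCat_exact_iff _).1 h z hz
  have hd : ∀ i j (z : (integralChains X).X i), ((cokernel.π (mvDiff U V)).f j).hom
      (((integralChains X).d i j).hom z) = ((cokernel (mvDiff U V)).d i j).hom
        (((cokernel.π (mvDiff U V)).f i).hom z) := fun i j z =>
    congrArg (fun φ => φ.hom z) ((cokernel.π (mvDiff U V)).comm i j).symm
  intro j
  rcases j with _ | j
  · rw [HomologicalComplex.exactAt_iff' _ 1 0 0 (by simp) (by simp),
      ShortComplex.moduleCat_exact_iff]
    intro q _
    refine ⟨0, ?_⟩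
    obtain ⟨z, rfl⟩ := hπ 0 q
    obtain ⟨x, rfl⟩ := (exists_mvDiff_iff U V z).2 (by
      rw [smallChains, Finsupp.mem_supported]
      intro σ _
      have hc : ∀ x : TopSimplex 0, x = default := fun x => Subsingleton.elim _ _
      rcases (hUV ▸ Set.mem_univ (σ default) : σ default ∈ U ∪ V) with h | h
      · left; rintro _ ⟨x, rfl⟩; rwa [hc x]
      · right; rintro _ ⟨x, rfl⟩; rwa [hc x])
    exact (map_zero _).trans (hcomp 0 x).symm
  · rw [HomologicalComplex.exactAt_iff' _ (j + 2) (j + 1) j (by simp) (by simp),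
      ShortComplex.moduleCat_exact_iff]
    intro q hq
    obtain ⟨z, rfl⟩ := hπ (j + 1) q
    have hq' : ((cokernel.π (mvDiff U V)).f j).hom (((integralChains X).d (j + 1) j).hom z) = 0 :=
      (hd _ _ z).trans hq
    have hz := (exists_mvDiff_iff U V _).1 (hex _ _ hq')
    rw [integralChainsHom_d_apply] at hz
    obtain ⟨w, hw⟩ := exists_sub_singBoundary_mem_smallChains hU hV hUV _ hz
    obtain ⟨w, rfl⟩ := integralChainsHom_surjective w
    rw [← integralChainsHom_d_apply, ← map_sub] at hw
    obtain ⟨x, hx⟩ := (exists_mvDiff_iff U V _).2 hw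
    refine ⟨((cokernel.π (mvDiff U V)).f _).hom w, ?_⟩
    refine (hd (j + 2) (j + 1) w).symm.trans ?_
    have := hcomp _ x
    rw [hx, map_sub, sub_eq_zero] at this
    exact this.symm

lemma mv_exact : (ShortComplex.mk _ _ (mvIncl_comp_mvDiff U V)).Exact := by
  refine HomologicalComplex.exact_of_degreewise_exact _ fun i => ?_
  rw [ShortComplex.moduleCat_exact_iff]
  exact fun x hx => mv_exact_left U V i x hx

instance : Mono (mvIncl U V) := by
  have : ∀ i, Mono ((mvIncl U V).f i) := fun i =>
    (ModuleCat.mono_iff_injective _).2 (mvIncl_injective U V i)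
  exact HomologicalComplex.mono_of_mono_f _ this

/-- The short exact sequence of chain complexes behind the Mayer–Vietoris sequence. -/
noncomputable abbrev mvShortComplex : ShortComplex (ChainComplex (ModuleCat.{0} ℤ) ℕ) :=
  ShortComplex.mk (mvIncl U V) (Abelian.factorThruImage (mvDiff U V))
    (by rw [← cancel_mono (Abelian.image.ι (mvDiff U V)), Category.assoc,
      Abelian.image.fac, mvIncl_comp_mvDiff, zero_comp])

lemma mvShortComplex_shortExact : (mvShortComplex U V).ShortExact where
  exact := by
    let φ : mvShortComplex U V ⟶ ShortComplex.mk _ _ (mvIncl_comp_mvDiff U V) :=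
      { τ₁ := 𝟙 _
        τ₂ := 𝟙 _
        τ₃ := Abelian.image.ι (mvDiff U V)
        comm₁₂ := by simp
        comm₂₃ := by simp }
    have : Epi φ.τ₁ := inferInstanceAs (Epi (𝟙 _))
    have : IsIso φ.τ₂ := inferInstanceAs (IsIso (𝟙 _))
    have : Mono φ.τ₃ := inferInstanceAs (Mono (Abelian.image.ι _))
    exact (ShortComplex.exact_iff_of_epi_of_isIso_of_mono φ).2 (mv_exact U V)
  mono_f := inferInstanceAs (Mono (mvIncl U V))
  epi_g := inferInstanceAs (Epi (Abelian.factorThruImage (mvDiff U V)))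

/-- The complex of small chains computes the homology. -/
lemma isIso_homologyMap_image (hU : IsOpen U) (hV : IsOpen V) (hUV : U ∪ V = Set.univ) (i : ℕ) :
    IsIso (HomologicalComplex.homologyMap (Abelian.image.ι (mvDiff U V)) i) := by
  have hS : (ShortComplex.mk (Abelian.image.ι (mvDiff U V)) (cokernel.π (mvDiff U V))
      (kernel.condition _)).ShortExact :=
    { exact := ShortComplex.exact_kernel _
      mono_f := inferInstanceAs (Mono (Abelian.image.ι _))
      epi_g := inferInstanceAs (Epi (cokernel.π _)) }
  have hQ := mv_cokernel_acyclic U V hU hV hUV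
  have h1 : Epi (HomologicalComplex.homologyMap (Abelian.image.ι (mvDiff U V)) i) :=
    (hS.homology_exact₂ i).epi_f ((hQ i).isZero_homology.eq_of_tgt _ _)
  have h2 : Mono (HomologicalComplex.homologyMap (Abelian.image.ι (mvDiff U V)) i) :=
    (hS.homology_exact₁ (i + 1) i (by simp)).mono_g ((hQ (i + 1)).isZero_homology.eq_of_src _ _)
  exact isIso_of_mono_of_epi _

end MayerVietoris

/-! ### Betti numbers -/

section Betti

open CategoryTheory Limits AlgebraicTopology

lemma bettiNumber_eq (X : Type) [TopologicalSpace X] (i : ℕ) :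
    bettiNumber X i = Module.rank ℤ ((integralChains (TopCat.of X)).homology i) := rfl

lemma rank_eq_of_isIso {R : Type} [Ring R] {M N : ModuleCat.{0} R} (f : M ⟶ N) (_ : IsIso f) :
    Module.rank R M = Module.rank R N :=
  (asIso f).toLinearEquiv.rank_eq

lemma rank_range_hom_of_mono {R : Type} [Ring R] {M N : ModuleCat.{0} R} (f : M ⟶ N)
    (h : Mono f) : Module.rank R (LinearMap.range f.hom) = Module.rank R M :=
  (LinearEquiv.ofInjective _ ((ModuleCat.mono_iff_injective _).1 h)).rank_eq.symm

lemma rank_eq_zero_of_isZero {M : ModuleCat.{0} ℤ} (h : IsZero M) : Module.rank ℤ M = 0 := by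
  have := ModuleCat.subsingleton_of_isZero h
  exact rank_subsingleton' ℤ M

lemma integralChainsMap_id (X : TopCat.{0}) :
    integralChainsMap (𝟙 X) = 𝟙 (integralChains X) := by
  simp [integralChainsMap]

/-- The map induced in homology by a homotopy equivalence is an isomorphism. -/
lemma isIso_homologyMap_of_homotopyEquiv {X Y : Type} [TopologicalSpace X] [TopologicalSpace Y]
    (e : X ≃ₕ Y) (i : ℕ) :
    IsIso (HomologicalComplex.homologyMap
      (integralChainsMap (TopCat.ofHom e.toFun : TopCat.of X ⟶ TopCat.of Y)) i) := by
  refine ⟨HomologicalComplex.homologyMap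
    (integralChainsMap (TopCat.ofHom e.invFun : TopCat.of Y ⟶ TopCat.of X)) i, ?_, ?_⟩
  · rw [← HomologicalComplex.homologyMap_comp, integralChainsMap_comp]
    obtain ⟨H⟩ := e.left_inv
    have h := TopCat.Homotopy.congr_homologyMap_singularChainComplexFunctor
      (C := ModuleCat.{0} ℤ) (X := TopCat.of X) (Y := TopCat.of X)
      (f := TopCat.ofHom e.toFun ≫ TopCat.ofHom e.invFun) (g := 𝟙 _) H (ModuleCat.of ℤ ℤ) i
    exact h.trans ((congrArg (fun φ => HomologicalComplex.homologyMap φ i)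
      (integralChainsMap_id (TopCat.of X))).trans (HomologicalComplex.homologyMap_id _ _))
  · rw [← HomologicalComplex.homologyMap_comp, integralChainsMap_comp]
    obtain ⟨H⟩ := e.right_inv
    have h := TopCat.Homotopy.congr_homologyMap_singularChainComplexFunctor
      (C := ModuleCat.{0} ℤ) (X := TopCat.of Y) (Y := TopCat.of Y)
      (f := TopCat.ofHom e.invFun ≫ TopCat.ofHom e.toFun) (g := 𝟙 _) H (ModuleCat.of ℤ ℤ) i
    exact h.trans ((congrArg (fun φ => HomologicalComplex.homologyMap φ i)
      (integralChainsMap_id (TopCat.of Y))).trans (HomologicalComplex.homologyMap_id _ _))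

lemma bettiNumber_congr {X Y : Type} [TopologicalSpace X] [TopologicalSpace Y]
    (e : X ≃ₕ Y) (i : ℕ) : bettiNumber X i = bettiNumber Y i := by
  exact rank_eq_of_isIso _ (isIso_homologyMap_of_homotopyEquiv e i)

lemma rank_sigma_int (ι : Type) : Module.rank ℤ (∐ fun _ : ι => ModuleCat.of ℤ ℤ : ModuleCat.{0} ℤ)
    = Cardinal.mk ι := by
  classical
  rw [(ModuleCat.coprodIsoDirectSum fun _ : ι => ModuleCat.of ℤ ℤ).toLinearEquiv.rank_eq]
  erw [rank_directSum]
  simp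

lemma bettiNumber_zero_of_pathConnected (X : Type) [TopologicalSpace X] [PathConnectedSpace X] :
    bettiNumber X 0 = 1 := by
  refine ((TopCat.singularHomology₀Iso (TopCat.of X)
    (ModuleCat.of ℤ ℤ)).toLinearEquiv.rank_eq).trans ?_
  rw [rank_sigma_int]
  have h := (pathConnectedSpace_iff_zerothHomotopy (X := X)).1 inferInstance
  have := h.1
  have := h.2
  exact Cardinal.eq_one_iff_unique.2 ⟨h.2, h.1⟩

lemma isZero_homology_of_discrete (X : Type) [TopologicalSpace X] [DiscreteTopology X] {i : ℕ}
    (hi : i ≠ 0) : IsZero ((integralChains (TopCat.of X)).homology i) :=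
  isZero_singularHomologyFunctor_of_totallyDisconnectedSpace (ModuleCat.{0} ℤ) i
    (ModuleCat.of ℤ ℤ) (TopCat.of X) hi

lemma bettiNumber_zero_of_discrete (X : Type) [TopologicalSpace X] [DiscreteTopology X] :
    bettiNumber X 0 = Cardinal.mk X := by
  refine ((singularHomologyFunctorZeroOfTotallyDisconnectedSpace (C := ModuleCat.{0} ℤ)
    (ModuleCat.of ℤ ℤ) (TopCat.of X)).toLinearEquiv.rank_eq).trans ?_
  rw [rank_sigma_int]

lemma bettiNumber_of_discrete (X : Type) [TopologicalSpace X] [DiscreteTopology X] {i : ℕ}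
    (hi : i ≠ 0) : bettiNumber X i = 0 :=
  rank_eq_zero_of_isZero (isZero_homology_of_discrete X hi)

lemma isZero_homology_of_contractible (X : Type) [TopologicalSpace X] [ContractibleSpace X] {i : ℕ}
    (hi : i ≠ 0) : IsZero ((integralChains (TopCat.of X)).homology i) := by
  obtain ⟨e⟩ := ContractibleSpace.hequiv_unit X
  have := isIso_homologyMap_of_homotopyEquiv e i
  exact (isZero_homology_of_discrete Unit hi).of_iso (asIso (HomologicalComplex.homologyMap
      (integralChainsMap (TopCat.ofHom e.toFun : TopCat.of X ⟶ TopCat.of Unit)) i))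

/-- The map to a point. -/
abbrev toPointMap (X : TopCat.{0}) : X ⟶ TopCat.of Unit :=
  TopCat.ofHom ⟨fun _ => (), continuous_const⟩

lemma mono_homologyMap_toPoint_of_contractible (X : Type) [TopologicalSpace X]
    [ContractibleSpace X] (i : ℕ) :
    Mono (HomologicalComplex.homologyMap (integralChainsMap (toPointMap (TopCat.of X))) i) := by
  obtain ⟨e⟩ := ContractibleSpace.hequiv_unit X
  have := isIso_homologyMap_of_homotopyEquiv e i
  exact inferInstanceAs (Mono (HomologicalComplex.homologyMap
      (integralChainsMap (TopCat.ofHom e.toFun : TopCat.of X ⟶ TopCat.of Unit)) i))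

/-- The zeroth homology of a path connected space is infinite cyclic. -/
lemma nonempty_homology_zero_equiv (X : Type) [TopologicalSpace X] [PathConnectedSpace X] :
    Nonempty ((integralChains (TopCat.of X)).homology 0 ≃ₗ[ℤ] ℤ) := by
  have : IsIso ((TopCat.of X).singularHomology₀ε (ModuleCat.of ℤ ℤ)) := inferInstance
  exact ⟨(asIso ((TopCat.of X).singularHomology₀ε (ModuleCat.of ℤ ℤ))).toLinearEquiv⟩

lemma mono_homologyMap_toPoint_of_pathConnected (X : Type) [TopologicalSpace X]
    [PathConnectedSpace X] :
    Mono (HomologicalComplex.homologyMap (integralChainsMap (toPointMap (TopCat.of X))) 0) := by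
  obtain ⟨x⟩ := (inferInstance : Nonempty X)
  set f := HomologicalComplex.homologyMap (integralChainsMap (toPointMap (TopCat.of X))) 0
  let s : TopCat.of Unit ⟶ TopCat.of X := TopCat.ofHom ⟨fun _ => x, continuous_const⟩
  have hs : HomologicalComplex.homologyMap (integralChainsMap s) 0 ≫ f = 𝟙 _ := by
    rw [← HomologicalComplex.homologyMap_comp, integralChainsMap_comp]
    have : s ≫ toPointMap (TopCat.of X) = 𝟙 _ := rfl
    rw [this, integralChainsMap_id]
    exact HomologicalComplex.homologyMap_id _ _
  have hsurj : Function.Surjective f.hom := fun y =>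
    ⟨(HomologicalComplex.homologyMap (integralChainsMap s) 0).hom y,
      congrArg (fun φ => φ.hom y) hs⟩
  obtain ⟨e₁⟩ := nonempty_homology_zero_equiv X
  obtain ⟨e₂⟩ := nonempty_homology_zero_equiv Unit
  have h := OrzechProperty.injective_of_surjective_endomorphism
    (e₂.toLinearMap ∘ₗ f.hom ∘ₗ e₁.symm.toLinearMap)
    (e₂.surjective.comp (hsurj.comp e₁.symm.surjective))
  rw [ModuleCat.mono_iff_injective]
  intro a b hab
  have := h (a₁ := e₁ a) (a₂ := e₁ b) (by simp [hab])
  exact e₁.injective this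

lemma rank_prod_of_isDomain (R : Type) [CommRing R] [IsDomain R] (M N : Type) [AddCommGroup M]
    [AddCommGroup N] [Module R M] [Module R N] :
    Module.rank R (M × N) = Module.rank R M + Module.rank R N := by
  have h := LinearMap.rank_range_add_rank_ker (LinearMap.fst R M N)
  rw [LinearMap.range_eq_top.2 LinearMap.fst_surjective, rank_top, LinearMap.ker_fst,
    ← (LinearEquiv.ofInjective _ LinearMap.inr_injective).rank_eq] at h
  exact h.symm

lemma rank_eq_add_of_iso_biprod {R : Type} [CommRing R] [IsDomain R] {M N P : ModuleCat.{0} R}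
    (e : P ≅ M ⊞ N) : Module.rank R P = Module.rank R M + Module.rank R N :=
  (e ≪≫ ModuleCat.biprodIsoProd M N).toLinearEquiv.rank_eq.trans (rank_prod_of_isDomain R M N)

instance (K L : ChainComplex (ModuleCat.{0} ℤ) ℕ) (i : ℕ) : PreservesBinaryBiproduct K L
    (HomologicalComplex.homologyFunctor (ModuleCat.{0} ℤ) (ComplexShape.down ℕ) i) :=
  preservesBinaryBiproduct_of_preservesBiproduct _ _ _

lemma rank_homology_biprod (K L : ChainComplex (ModuleCat.{0} ℤ) ℕ) (i : ℕ) :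
    Module.rank ℤ ((K ⊞ L).homology i) =
      Module.rank ℤ (K.homology i) + Module.rank ℤ (L.homology i) := by
  let F := HomologicalComplex.homologyFunctor (ModuleCat.{0} ℤ) (ComplexShape.down ℕ) i
  exact rank_eq_add_of_iso_biprod (F.mapBiprod K L)

/-- Ranks in an exact sequence `0 → D → A → B → C → 0`. -/
lemma exists_rank_eq_of_exact {R : Type} [CommRing R] [IsDomain R] {D A B C : ModuleCat.{0} R}
    (d : D ⟶ A) (f : A ⟶ B) (g : B ⟶ C) (hd : Mono d) (hg : Epi g)
    (h₁ : LinearMap.range d.hom = LinearMap.ker f.hom)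
    (h₂ : LinearMap.range f.hom = LinearMap.ker g.hom) :
    ∃ r, Module.rank R A = Module.rank R D + r ∧ Module.rank R B = Module.rank R C + r := by
  refine ⟨Module.rank R (LinearMap.range f.hom), ?_, ?_⟩
  · rw [← LinearMap.rank_range_add_rank_ker f.hom, ← h₁, rank_range_hom_of_mono d hd, add_comm]
  · rw [← LinearMap.rank_range_add_rank_ker g.hom, ← h₂,
      LinearMap.range_eq_top.2 ((ModuleCat.epi_iff_surjective _).1 hg), rank_top]

variable {X : Type} [TopologicalSpace X] (U V : Set X)

lemma mono_homologyMap_mvIncl (i : ℕ)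
    [h : Mono (HomologicalComplex.homologyMap
      (integralChainsMap (toPointMap (TopCat.of ↥(U ∩ V)))) i)] :
    Mono (HomologicalComplex.homologyMap (mvIncl (X := TopCat.of X) U V) i) := by
  have : HomologicalComplex.homologyMap (mvIncl (X := TopCat.of X) U V) i ≫
      HomologicalComplex.homologyMap (mvFst (X := TopCat.of X) U V) i ≫
      HomologicalComplex.homologyMap (integralChainsMap (toPointMap (TopCat.of U))) i =
      HomologicalComplex.homologyMap
        (integralChainsMap (toPointMap (TopCat.of ↥(U ∩ V)))) i := by
    rw [← HomologicalComplex.homologyMap_comp, ← HomologicalComplex.homologyMap_comp, mvIncl,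
      mvFst, biprod.lift_fst_assoc, integralChainsMap_comp]
    rfl
  rw [← this] at h
  exact mono_of_mono _ (HomologicalComplex.homologyMap (mvFst (X := TopCat.of X) U V) i ≫
      HomologicalComplex.homologyMap (integralChainsMap (toPointMap (TopCat.of U))) i)

variable {U V}

/-- For an open cover by two sets with contractible intersection the Betti numbers add up. -/
theorem bettiNumber_of_contractible_inter (hU : IsOpen U) (hV : IsOpen V)
    (hUV : U ∪ V = Set.univ) [ContractibleSpace ↥(U ∩ V)] {i : ℕ} (hi : i ≠ 0) :
    bettiNumber X i = bettiNumber U i + bettiNumber V i := by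
  obtain ⟨i, rfl⟩ := Nat.exists_eq_succ_of_ne_zero hi
  have hS := mvShortComplex_shortExact (X := TopCat.of X) U V
  have h0 := mono_homologyMap_toPoint_of_contractible ↥(U ∩ V) i
  have hm := mono_homologyMap_mvIncl U V i
  have h1 : Mono
      (HomologicalComplex.homologyMap (mvShortComplex (X := TopCat.of X) U V).g (i + 1)) :=
    (hS.homology_exact₂ (i + 1)).mono_g
      ((isZero_homology_of_contractible ↥(U ∩ V) hi).eq_of_src _ _)
  have hδ : hS.δ (i + 1) i (by simp) = 0 :=
    (hS.homology_exact₁ (i + 1) i (by simp)).mono_g_iff.1 hm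
  have h2 : Epi
      (HomologicalComplex.homologyMap (mvShortComplex (X := TopCat.of X) U V).g (i + 1)) :=
    (hS.homology_exact₃ (i + 1) i (by simp)).epi_f hδ
  have h3 := isIso_of_mono_of_epi
    (HomologicalComplex.homologyMap (mvShortComplex (X := TopCat.of X) U V).g (i + 1))
  have h4 := isIso_homologyMap_image (X := TopCat.of X) U V hU hV hUV (i + 1)
  refine ((rank_eq_of_isIso _ h4).symm.trans (rank_eq_of_isIso _ h3).symm).trans ?_
  exact rank_homology_biprod _ _ _

lemma isZero_homology_biprod_of_contractible [ContractibleSpace U] [ContractibleSpace V] {i : ℕ}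
    (hi : i ≠ 0) : IsZero ((mvShortComplex (X := TopCat.of X) U V).X₂.homology i) := by
  let F := HomologicalComplex.homologyFunctor (ModuleCat.{0} ℤ) (ComplexShape.down ℕ) i
  refine IsZero.of_iso ?_
    (F.mapBiprod (integralChains (TopCat.of U)) (integralChains (TopCat.of V)))
  have h1 : IsZero (F.obj (integralChains (TopCat.of U))) := isZero_homology_of_contractible U hi
  have h2 : IsZero (F.obj (integralChains (TopCat.of V))) := isZero_homology_of_contractible V hi
  rw [IsZero.iff_id_eq_zero, ← biprod.total, h1.eq_of_src biprod.inl 0, h2.eq_of_src biprod.inr 0]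
  simp

/-- The suspension isomorphism in positive degrees. -/
theorem bettiNumber_succ_of_contractible (hU : IsOpen U) (hV : IsOpen V)
    (hUV : U ∪ V = Set.univ) [ContractibleSpace U] [ContractibleSpace V] {i : ℕ} (hi : i ≠ 0) :
    bettiNumber X (i + 1) = bettiNumber ↥(U ∩ V) i := by
  have hS := mvShortComplex_shortExact (X := TopCat.of X) U V
  have hr : (ComplexShape.down ℕ).Rel (i + 1) i := by simp
  have h1 : Mono (hS.δ (i + 1) i hr) :=
    (hS.homology_exact₃ (i + 1) i hr).mono_g
      ((isZero_homology_biprod_of_contractible (Nat.succ_ne_zero i)).eq_of_src _ _)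
  have h2 : Epi (hS.δ (i + 1) i hr) :=
    (hS.homology_exact₁ (i + 1) i hr).epi_f
      ((isZero_homology_biprod_of_contractible hi).eq_of_tgt _ _)
  have h3 := isIso_of_mono_of_epi (hS.δ (i + 1) i hr)
  have h4 := isIso_homologyMap_image (X := TopCat.of X) U V hU hV hUV (i + 1)
  exact (rank_eq_of_isIso _ h4).symm.trans (rank_eq_of_isIso _ h3)

/-- The suspension of a path connected space has vanishing first Betti number. -/
theorem bettiNumber_one_of_pathConnected_inter (hU : IsOpen U) (hV : IsOpen V)
    (hUV : U ∪ V = Set.univ) [ContractibleSpace U] [ContractibleSpace V]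
    [PathConnectedSpace ↥(U ∩ V)] : bettiNumber X 1 = 0 := by
  have hS := mvShortComplex_shortExact (X := TopCat.of X) U V
  have h0 := mono_homologyMap_toPoint_of_pathConnected ↥(U ∩ V)
  have hm := mono_homologyMap_mvIncl U V 0
  have hδ : hS.δ 1 0 (by simp) = 0 :=
    (hS.homology_exact₁ 1 0 (by simp)).mono_g_iff.1 hm
  have hr : (ComplexShape.down ℕ).Rel 1 0 := by simp
  have h1 : Mono (hS.δ 1 0 hr) :=
    (hS.homology_exact₃ 1 0 hr).mono_g
      ((isZero_homology_biprod_of_contractible one_ne_zero).eq_of_src _ _)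
  have h4 := isIso_homologyMap_image (X := TopCat.of X) U V hU hV hUV 1
  refine (rank_eq_of_isIso _ h4).symm.trans (rank_eq_zero_of_isZero ?_)
  rw [IsZero.iff_id_eq_zero, ← cancel_mono (hS.δ 1 0 hr), hδ]
  simp

/-- The first Betti number of a path connected suspension. -/
theorem bettiNumber_one_add_one (hU : IsOpen U) (hV : IsOpen V)
    (hUV : U ∪ V = Set.univ) [ContractibleSpace U] [ContractibleSpace V] [PathConnectedSpace X]
    {c : ℕ} (hc : bettiNumber ↥(U ∩ V) 0 = c + 1) : bettiNumber X 1 = c := by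
  have hS := mvShortComplex_shortExact (X := TopCat.of X) U V
  set S := mvShortComplex (X := TopCat.of X) U V with hSdef
  have hr : (ComplexShape.down ℕ).Rel 1 0 := by simp
  have h1 : Mono (hS.δ 1 0 hr) :=
    (hS.homology_exact₃ 1 0 hr).mono_g
      ((isZero_homology_biprod_of_contractible one_ne_zero).eq_of_src _ _)
  have h4 := isIso_homologyMap_image (X := TopCat.of X) U V hU hV hUV
  have h5 := h4 0
  have h6 := h4 1
  have hb1 : bettiNumber X 1 = Module.rank ℤ (S.X₃.homology 1) :=
    (rank_eq_of_isIso _ h6).symm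
  have hb0 : Module.rank ℤ (S.X₃.homology 0) = 1 :=
    (rank_eq_of_isIso _ h5).trans
      (bettiNumber_zero_of_pathConnected X)
  have hmid : Module.rank ℤ (S.X₂.homology 0) = 2 := by
    refine (rank_homology_biprod _ _ _).trans ?_
    have hu := bettiNumber_zero_of_pathConnected U
    have hv := bettiNumber_zero_of_pathConnected V
    rw [bettiNumber_eq] at hu hv
    erw [hu, hv]
    exact one_add_one_eq_two
  have hepi : Epi (HomologicalComplex.homologyMap S.g 0) :=
    haveI := hS.epi_g
    HomologicalComplex.epi_homologyMap_of_epi_of_not_rel S.g 0 (by simp)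
  have e1 := (ShortComplex.moduleCat_exact_iff_range_eq_ker _).1
    (hS.homology_exact₁ 1 0 (by simp))
  have e2 := (ShortComplex.moduleCat_exact_iff_range_eq_ker _).1 (hS.homology_exact₂ 0)
  obtain ⟨r, h7, h8⟩ := exists_rank_eq_of_exact _ _ _ h1 hepi e1 e2
  have hT : Module.rank ℤ (S.X₁.homology 0) = c + 1 := hc
  have r1 := hT.symm.trans h7
  have r2 := hmid.symm.trans h8
  rw [hb0, ← one_add_one_eq_two] at r2
  have hr1 : r = 1 := (Cardinal.add_one_inj).1 (by
    rw [add_comm, ← r2])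
  rw [hr1] at r1
  rw [hb1]
  exact ((Cardinal.add_one_inj).1 r1).symm

end Betti

/-! ### Spaces joined by an interval -/

section Bridge

open Set Topology

lemma homotopic_of_continuous {X Y : Type*} [TopologicalSpace X] [TopologicalSpace Y]
    {f g : C(X, Y)} (F : unitInterval → X → Y)
    (hF : Continuous fun p : unitInterval × X => F p.1 p.2)
    (h0 : ∀ x, F 0 x = f x) (h1 : ∀ x, F 1 x = g x) : f.Homotopic g :=
  ⟨⟨⟨fun p => F p.1 p.2, hF⟩, h0, h1⟩⟩

/-- A map with a left homotopy inverse `k`, where `k` has itself a left homotopy inverse, is a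
homotopy equivalence. -/
lemma nonempty_homotopyEquiv_of_left_inverses {X Y : Type*} [TopologicalSpace X]
    [TopologicalSpace Y] {f : C(X, Y)} {k : C(Y, X)} {f' : C(X, Y)}
    (h : (k.comp f).Homotopic (.id X)) (h' : (f'.comp k).Homotopic (.id Y)) :
    Nonempty (X ≃ₕ Y) := by
  refine ⟨⟨f, k, h, ?_⟩⟩
  have h1 : f.Homotopic f' :=
    (ContinuousMap.Homotopic.comp h'.symm (.refl f)).trans
      (ContinuousMap.Homotopic.comp (.refl f') h)
  exact (ContinuousMap.Homotopic.comp h1 (.refl k)).trans h'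

/-- Two pointed spaces `(X, x)` and `(B, b)` joined by an interval: the points `(x', s, b')` with
`s ∈ [0, 1]` such that `x'` may differ from `x` only for `s = 0`, and `b'` from `b` only for
`s = 1`. Being a subspace of a product it is easy to map into, and unlike the wedge it is
invariant under homotopy equivalence without any condition on the base points. -/
def bridgeSum (X : Type*) (x : X) (B : Type*) (b : B) : Set (X × ℝ × B) :=
  {z | z.2.1 ∈ Icc (0 : ℝ) 1 ∧ (z.2.1 = 0 ∨ z.1 = x) ∧ (z.2.1 = 1 ∨ z.2.2 = b)}

/-- The closed cover of a space joined by an interval that maps out of it are glued along. -/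
lemma continuous_ite_eq_zero {Y X Z : Type*} [TopologicalSpace Y] [TopologicalSpace X] [T1Space X]
    [TopologicalSpace Z] {u : Y → X} {s : Y → ℝ} {x : X} (hu : Continuous u) (hs : Continuous s)
    (hus : ∀ y, s y = 0 ∨ u y = x) {f g : Y → Z} (hf : ContinuousOn f {y | s y = 0})
    (hg : ContinuousOn g {y | u y = x}) (hfg : ∀ y, s y = 0 → u y = x → f y = g y)
    [∀ y, Decidable (s y = 0)] :
    Continuous fun y => if s y = 0 then f y else g y := by
  have h1 : IsClosed {y | s y = 0} := isClosed_eq hs continuous_const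
  have h2 : IsClosed {y | u y = x} := isClosed_singleton.preimage hu
  have h3 : {y | s y = 0} ∪ {y | u y = x} = univ := by
    ext y; simpa using hus y
  rw [← continuousOn_univ, ← h3]
  refine ContinuousOn.union_of_isClosed ?_ ?_ h1 h2
  · refine hf.congr fun y hy => ?_
    simp only [mem_ofPred_eq] at hy
    simp [hy]
  · refine hg.congr fun y hy => ?_
    simp only [mem_ofPred_eq] at hy
    by_cases h : s y = 0
    · simp [h, hfg y h hy]
    · simp [h]

variable {X X' B : Type*} [TopologicalSpace X] [TopologicalSpace X'] [TopologicalSpace B]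

/-- A map of the first space extends to the spaces joined by an interval. -/
def bridgeMap (f : C(X, X')) (x : X) (b : B) : C(bridgeSum X x B b, bridgeSum X' (f x) B b) where
  toFun z := ⟨(f z.1.1, z.1.2), z.2.1, z.2.2.1.imp id fun h => congrArg f h, z.2.2.2⟩
  continuous_toFun := by fun_prop

open Classical in
/-- Moving the end of the interval along a path. -/
noncomputable def bridgePath [T1Space X] {x x' : X} (γ : Path x x') (b : B) :
    C(bridgeSum X x B b, bridgeSum X x' B b) where
  toFun z := ⟨(if z.1.2.1 = 0 then z.1.1 else γ.extend (2 * z.1.2.1),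
      max 0 (2 * z.1.2.1 - 1), z.1.2.2), by
    obtain ⟨⟨x1, s, b1⟩, ⟨h0, h1⟩, h2, h3⟩ := z
    dsimp only at h0 h1 h2 h3 ⊢
    refine ⟨⟨le_max_left _ _, max_le zero_le_one (by linarith)⟩, ?_, h3.imp ?_ id⟩
    · rcases le_total (2 * s - 1) 0 with h | h
      · exact Or.inl (max_eq_left h)
      · refine Or.inr ?_
        rw [if_neg (by linarith), γ.extend_of_one_le (by linarith)]
    · rintro rfl
      norm_num⟩
  continuous_toFun := by
    refine Continuous.subtype_mk (Continuous.prodMk ?_ (by fun_prop)) _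
    refine continuous_ite_eq_zero (u := fun z : bridgeSum X x B b => z.1.1) (x := x)
      (s := fun z : bridgeSum X x B b => z.1.2.1) (by fun_prop) (by fun_prop) (fun z => z.2.2.1)
      (by fun_prop) (by fun_prop) fun y h1 h2 => ?_
    simp [h1, h2]

open Classical in
lemma bridgePath_symm_comp [T1Space X] {x x' : X} (γ : Path x x') (b : B) :
    ((bridgePath γ.symm b).comp (bridgePath γ b)).Homotopic (.id _) := by
  -- The path `γ` followed by its reverse is first contracted, then the interval is rescaled.
  have key : ∀ s : ℝ, s ∈ Icc (0 : ℝ) 1 → s ≠ 0 → ∀ x1 : X, (if max 0 (2 * s - 1) = 0 then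
      (if s = 0 then x1 else γ.extend (2 * s)) else γ.symm.extend (2 * max 0 (2 * s - 1))) =
      γ.extend (max 0 (min (2 * s) (3 - 4 * s))) := by
    intro s hs h x1
    rw [if_neg h]
    split_ifs with h1
    · have : 2 * s - 1 ≤ 0 := max_eq_left_iff.1 h1
      rw [min_eq_left (by linarith), max_eq_right (by linarith [hs.1])]
    · have h2 : 0 < 2 * s - 1 := by
        by_contra h2; exact h1 (max_eq_left (not_lt.1 h2))
      rw [max_eq_right h2.le, min_eq_right (by linarith)]
      rw [Path.extend_symm_apply]
      rcases le_total (3 - 4 * s) 0 with h3 | h3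
      · rw [max_eq_left h3, γ.extend_of_le_zero (by linarith), γ.extend_of_le_zero le_rfl]
      · rw [max_eq_right h3]; congr 1; ring
  have hcont : Continuous fun p : unitInterval × bridgeSum X x B b =>
      (if p.2.1.2.1 = 0 then p.2.1.1
        else γ.extend (max 0 (min (2 * p.2.1.2.1) (3 - 4 * p.2.1.2.1) - p.1))) := by
    refine continuous_ite_eq_zero (x := x)
      (u := fun z : unitInterval × bridgeSum X x B b => z.2.1.1)
      (s := fun z => z.2.1.2.1) (by fun_prop) (by fun_prop) (fun z => z.2.2.2.1)
      (by fun_prop) (by fun_prop) fun y h1 h2 => ?_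
    have := y.1.2.1
    rw [h1, max_eq_left (by norm_num; exact this), γ.extend_zero, h2]
  have step1 : ((bridgePath γ.symm b).comp (bridgePath γ b)).Homotopic
      ⟨fun z => ⟨(z.1.1, max 0 (4 * z.1.2.1 - 3), z.1.2.2), by
        obtain ⟨⟨x1, s, b1⟩, ⟨h0, h1⟩, h2, h3⟩ := z
        dsimp only at h0 h1 h2 h3 ⊢
        refine ⟨⟨le_max_left _ _, max_le zero_le_one (by linarith)⟩, h2.imp ?_ id, h3.imp ?_ id⟩
        · rintro rfl; norm_num
        · rintro rfl; norm_num⟩, by fun_prop⟩ := by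
    refine homotopic_of_continuous (fun v z => ⟨(if z.1.2.1 = 0 then z.1.1
        else γ.extend (max 0 (min (2 * z.1.2.1) (3 - 4 * z.1.2.1) - v)),
        max 0 (4 * z.1.2.1 - 3), z.1.2.2), ?_⟩) ?_ ?_ ?_
    · obtain ⟨⟨x1, s, b1⟩, ⟨h0, h1⟩, h2, h3⟩ := z
      dsimp only at h0 h1 h2 h3 ⊢
      refine ⟨⟨le_max_left _ _, max_le zero_le_one (by linarith)⟩, ?_, h3.imp ?_ id⟩
      · rcases le_total (4 * s - 3) 0 with h | h
        · exact Or.inl (max_eq_left h)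
        · refine Or.inr ?_
          have := v.2.1
          rw [if_neg (by linarith), max_eq_left, γ.extend_zero]
          linarith [min_le_right (2 * s) (3 - 4 * s)]
      · rintro rfl; norm_num
    · exact Continuous.subtype_mk (hcont.prodMk (by fun_prop)) _
    · intro z
      refine Subtype.ext (Prod.ext ?_ (Prod.ext ?_ rfl))
      · simp only [bridgePath, ContinuousMap.comp_apply, ContinuousMap.coe_mk]
        by_cases h : z.1.2.1 = 0
        · simp [h]
        · rw [key _ z.2.1 h z.1.1, if_neg h]; simp
      · simp only [bridgePath, ContinuousMap.comp_apply, ContinuousMap.coe_mk]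
        have := z.2.1.1
        rcases le_total (2 * z.1.2.1 - 1) 0 with h | h
        · rw [max_eq_left h, max_eq_left (by linarith), max_eq_left (by linarith)]
        · rw [max_eq_right h]; congr 1; ring
    · intro z
      refine Subtype.ext (Prod.ext ?_ rfl)
      have h := z.2.2.1
      simp only [ContinuousMap.coe_mk]
      split_ifs with h1
      · rfl
      · rw [max_eq_left, γ.extend_zero, h.resolve_left h1]
        have h3 := min_le_left (2 * z.1.2.1) (3 - 4 * z.1.2.1)
        have h4 := min_le_right (2 * z.1.2.1) (3 - 4 * z.1.2.1)
        rw [Set.Icc.coe_one]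
        linarith
  refine step1.trans (homotopic_of_continuous (fun v z => ⟨(z.1.1,
    (1 - v : ℝ) * max 0 (4 * z.1.2.1 - 3) + v * z.1.2.1, z.1.2.2), ?_⟩) (by fun_prop) ?_ ?_)
  · obtain ⟨⟨x1, s, b1⟩, ⟨h0, h1⟩, h2, h3⟩ := z
    dsimp only at h0 h1 h2 h3 ⊢
    have hm : max 0 (4 * s - 3) ∈ Icc (0 : ℝ) 1 :=
      ⟨le_max_left _ _, max_le zero_le_one (by linarith)⟩
    refine ⟨?_, h2.imp ?_ id, h3.imp ?_ id⟩
    · exact (convex_Icc (0 : ℝ) 1) hm ⟨h0, h1⟩ (sub_nonneg.2 v.2.2) v.2.1 (by ring)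
    · rintro rfl; norm_num
    · rintro rfl; norm_num
  · intro z; simp
  · intro z; simp

lemma nonempty_homotopyEquiv_bridgePath [T1Space X] {x x' : X} (γ : Path x x') (b : B) :
    ∃ e : bridgeSum X x B b ≃ₕ bridgeSum X x' B b, e.toFun = bridgePath γ b :=
  ⟨⟨bridgePath γ b, bridgePath γ.symm b, bridgePath_symm_comp γ b, by
    have := bridgePath_symm_comp γ.symm b
    rwa [Path.symm_symm] at this⟩, rfl⟩

/-- If `ψ ∘ f` is homotopic to the identity, then so is, after joining with an interval, the
composite of the induced maps with the change of base point along the track of the base point. -/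
lemma exists_bridgePath_comp_bridgeMap [T1Space X] {f : C(X, X')} {ψ : C(X', X)}
    (h : (ψ.comp f).Homotopic (.id X)) (x : X) (b : B) : ∃ γ : Path (ψ (f x)) x,
    ((bridgePath γ b).comp ((bridgeMap ψ (f x) b).comp (bridgeMap f x b))).Homotopic (.id _) := by
  obtain ⟨η⟩ := h
  refine ⟨η.evalAt x, ?_⟩
  have he : ∀ (r : ℝ), (η.evalAt x).extend r = η (projIcc 0 1 zero_le_one r, x) := fun r => rfl
  refine homotopic_of_continuous (fun v z => ⟨(η (projIcc 0 1 zero_le_one (v + 2 * z.1.2.1), z.1.1),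
    max 0 ((2 * z.1.2.1 - 1 + v) / (1 + v)), z.1.2.2), ?_⟩) ?_ ?_ ?_
  · obtain ⟨⟨x1, s, b1⟩, ⟨h0, h1⟩, h2, h3⟩ := z
    dsimp only at h0 h1 h2 h3 ⊢
    have hv := v.2.1
    have hv' : (0 : ℝ) < 1 + v := by linarith
    refine ⟨⟨le_max_left _ _, max_le zero_le_one ((div_le_one hv').2 (by linarith))⟩, ?_,
      h3.imp ?_ id⟩
    · rcases le_total (2 * s - 1 + v) 0 with h | h
      · exact Or.inl (max_eq_left (div_nonpos_of_nonpos_of_nonneg h hv'.le))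
      · rw [projIcc_of_right_le _ (by linarith)]
        by_cases hs : s = 0
        · refine Or.inl ?_
          have : (v : ℝ) = 1 := le_antisymm v.2.2 (by linarith)
          simp [hs, this]
        · refine Or.inr ?_
          have := η.apply_one x1
          simp only [ContinuousMap.id_apply] at this
          rw [← h2.resolve_left hs]
          exact this
    · rintro rfl
      have : (2 * 1 - 1 + v : ℝ) / (1 + v) = 1 := by
        rw [div_eq_one_iff_eq hv'.ne']; ring
      rw [this]; norm_num
  · refine Continuous.subtype_mk (Continuous.prodMk ?_ (Continuous.prodMk ?_ (by fun_prop))) _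
    · exact η.continuous.comp (Continuous.prodMk (continuous_projIcc.comp (by fun_prop))
        (by fun_prop))
    · refine continuous_const.max (Continuous.div (by fun_prop) (by fun_prop) fun p => ?_)
      have := p.1.2.1
      positivity
  · intro z
    refine Subtype.ext (Prod.ext ?_ (Prod.ext (by simp [bridgePath, bridgeMap]) rfl))
    simp only [bridgePath, bridgeMap, ContinuousMap.comp_apply, ContinuousMap.coe_mk]
    split_ifs with h1
    · simp [h1]
    · rw [z.2.2.1.resolve_left h1]
      refine Eq.trans ?_ (he _).symm
      simp
  · intro z
    have h1 : projIcc (0 : ℝ) 1 zero_le_one (((1 : unitInterval) : ℝ) + 2 * z.1.2.1) = 1 :=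
      projIcc_of_right_le _ (by have := z.2.1.1; simp; linarith)
    refine Subtype.ext (Prod.ext ?_ (Prod.ext ?_ rfl))
    · simp only [h1]; exact η.apply_one _
    · have h2 := z.2.1.1
      have : (2 * z.1.2.1 - 1 + ((1 : unitInterval) : ℝ)) / (1 + ((1 : unitInterval) : ℝ))
          = z.1.2.1 := by simp; ring
      simp only [this, ContinuousMap.id_apply]
      exact max_eq_right h2

/-- Homotopy equivalences may be inserted on the first side. -/
theorem nonempty_bridgeSum_homotopyEquiv [T1Space X] [T1Space X'] (e : X ≃ₕ X') (x : X) (b : B) :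
    Nonempty (bridgeSum X x B b ≃ₕ bridgeSum X' (e x) B b) := by
  obtain ⟨γ, hγ⟩ := exists_bridgePath_comp_bridgeMap e.left_inv x b
  obtain ⟨δ, hδ⟩ := exists_bridgePath_comp_bridgeMap e.right_inv (e x) b
  obtain ⟨c, hc⟩ := nonempty_homotopyEquiv_bridgePath γ b
  refine nonempty_homotopyEquiv_of_left_inverses (f := bridgeMap e.toFun x b)
    (k := (bridgePath γ b).comp (bridgeMap e.invFun (e x) b))
    (f' := ((bridgePath δ b).comp (bridgeMap e.toFun (e.invFun (e x)) b)).comp c.invFun) hγ ?_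
  rw [← hc]
  have h1 := ContinuousMap.Homotopic.comp
    (ContinuousMap.Homotopic.refl ((bridgePath δ b).comp (bridgeMap e.toFun (e.invFun (e x)) b)))
    (ContinuousMap.Homotopic.comp c.left_inv
      (ContinuousMap.Homotopic.refl (bridgeMap e.invFun (e x) b)))
  exact h1.trans hδ

/-- Exchanging the two sides. -/
def bridgeSwap (x : X) (b : B) : bridgeSum X x B b ≃ₜ bridgeSum B b X x where
  toFun z := ⟨(z.1.2.2, 1 - z.1.2.1, z.1.1),
    ⟨by linarith [z.2.1.2], by linarith [z.2.1.1]⟩, z.2.2.2.imp (fun h => by dsimp; linarith) id,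
    z.2.2.1.imp (fun h => by dsimp; linarith) id⟩
  invFun z := ⟨(z.1.2.2, 1 - z.1.2.1, z.1.1),
    ⟨by linarith [z.2.1.2], by linarith [z.2.1.1]⟩, z.2.2.2.imp (fun h => by dsimp; linarith) id,
    z.2.2.1.imp (fun h => by dsimp; linarith) id⟩
  left_inv z := by ext <;> simp
  right_inv z := by ext <;> simp
  continuous_toFun := by fun_prop
  continuous_invFun := by fun_prop

/-- A space in which any two points are related by a self homotopy equivalence, up to a path. -/
def IsHomotopyHomogeneous (X : Type*) [TopologicalSpace X] : Prop :=
  ∀ x y : X, ∃ e : X ≃ₕ X, Joined (e x) y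

lemma nonempty_bridgeSum_homotopyEquiv_of_homogeneous [T1Space X] [T1Space X'] (e : X ≃ₕ X')
    (hX : IsHomotopyHomogeneous X') (x : X) (x' : X') (b : B) :
    Nonempty (bridgeSum X x B b ≃ₕ bridgeSum X' x' B b) := by
  obtain ⟨e', ⟨γ⟩⟩ := hX (e x) x'
  obtain ⟨e1⟩ := nonempty_bridgeSum_homotopyEquiv (e.trans e') x b
  obtain ⟨e2, -⟩ := nonempty_homotopyEquiv_bridgePath γ b
  exact ⟨e1.trans e2⟩

/-- Homotopy invariance on both sides. -/
theorem nonempty_bridgeSum_homotopyEquiv_both {B' : Type*} [TopologicalSpace B'] [T1Space X]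
    [T1Space X'] [T1Space B] [T1Space B'] (e : X ≃ₕ X') (e' : B ≃ₕ B')
    (hX : IsHomotopyHomogeneous X') (hB : IsHomotopyHomogeneous B')
    (x : X) (x' : X') (b : B) (b' : B') :
    Nonempty (bridgeSum X x B b ≃ₕ bridgeSum X' x' B' b') := by
  obtain ⟨e1⟩ := nonempty_bridgeSum_homotopyEquiv_of_homogeneous e hX x x' b
  obtain ⟨e2⟩ := nonempty_bridgeSum_homotopyEquiv_of_homogeneous e' hB b b' x'
  exact ⟨(e1.trans (bridgeSwap x' b).toHomotopyEquiv).trans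
    (e2.trans (bridgeSwap x' b').toHomotopyEquiv.symm)⟩

/-- The wedge of two pointed spaces, as a subspace of their product. -/
def pairWedge (X : Type*) (x : X) (B : Type*) (b : B) : Set (X × B) := {z | z.1 = x ∨ z.2 = b}

/-- If a neighbourhood of the base point of `B` (here `{r < 1}`) contracts in `B`, then the
interval may be collapsed. -/
theorem nonempty_bridgeSum_homotopyEquiv_pairWedge (x : X) {b : B} (r : C(B, ℝ))
    (hr : ∀ y, r y ∈ Icc (0 : ℝ) 1) (hrb : r b = 0) (ρ : unitInterval → B → B)
    (hρ : Continuous fun p : unitInterval × B => ρ p.1 p.2) (hρ0 : ∀ y, ρ 0 y = y)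
    (hρb : ∀ u, ρ u b = b) (hρ1 : ∀ y, r y < 1 → ρ 1 y = b) :
    Nonempty (bridgeSum X x B b ≃ₕ pairWedge X x B b) := by
  have hne : ∀ y, r y ≠ 0 → y ≠ b := fun y h hy => h (hy ▸ hrb)
  have hb : ∀ z ∈ bridgeSum X x B b, z.2.2 ≠ b → z.2.1 = 1 ∧ z.1 = x := fun z hz h => by
    have h1 := hz.2.2.resolve_right h
    exact ⟨h1, hz.2.1.resolve_left (by rw [h1]; exact one_ne_zero)⟩
  have hc : ∀ c : ℝ, c ∈ Icc (0 : ℝ) 1 → c ≠ 1 → c < 1 := fun c h h' => lt_of_le_of_ne h.2 h'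
  refine ⟨⟨⟨fun z => ⟨(z.1.1, z.1.2.2), ?_⟩, ?_⟩,
    ⟨fun z => ⟨(z.1.1, r z.1.2, ρ 1 z.1.2), hr _, ?_, ?_⟩, ?_⟩, ?_, ?_⟩⟩
  · by_cases h : z.1.2.2 = b
    · exact Or.inr h
    · exact Or.inl (hb z.1 z.2 h).2
  · exact Continuous.subtype_mk (by fun_prop) _
  · rcases z.2 with h | h
    · exact Or.inr h
    · refine Or.inl ?_
      dsimp only
      rw [h, hrb]
  · by_cases h : r z.1.2 = 1
    · exact Or.inl h
    · exact Or.inr (hρ1 _ (hc _ (hr _) h))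
  · exact Continuous.subtype_mk (Continuous.prodMk (by fun_prop) (Continuous.prodMk (by fun_prop)
      (hρ.comp (continuous_const.prodMk (by fun_prop))))) _
  · -- The interval coordinate is raised while the points near `b` are kept in `b`.
    have step : ∀ z ∈ bridgeSum X x B b, ∀ u : unitInterval,
        (z.1, (1 - u : ℝ) * r z.2.2 + u * max (r z.2.2) z.2.1, ρ 1 z.2.2) ∈ bridgeSum X x B b := by
      intro z hz u
      refine ⟨(convex_Icc (0 : ℝ) 1) (hr _) ⟨le_max_of_le_left (hr _).1, max_le (hr _).2 hz.1.2⟩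
        (sub_nonneg.2 u.2.2) u.2.1 (by ring), ?_, ?_⟩
      · by_cases h : z.2.2 = b
        · dsimp only
          rw [h, hrb]
          refine hz.2.1.imp (fun h => by rw [h]; simp) id
        · exact Or.inr (hb z hz h).2
      · by_cases h : z.2.2 = b
        · refine Or.inr ?_
          dsimp only
          rw [h, hρb]
        · by_cases h' : r z.2.2 = 1
          · refine Or.inl ?_
            dsimp only
            rw [h', (hb z hz h).1]; simp
          · exact Or.inr (hρ1 _ (hc _ (hr _) h'))
    refine (homotopic_of_continuous (g := ⟨fun z => ⟨_, step z.1 z.2 1⟩, ?_⟩)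
      (fun u z => ⟨_, step z.1 z.2 u⟩) ?_ ?_ ?_).trans
      (ContinuousMap.Homotopic.symm (homotopic_of_continuous
      (fun u z => ⟨(z.1.1,
        max (r z.1.2.2) z.1.2.1, ρ u z.1.2.2), ?_⟩) ?_ ?_ ?_))
    · exact Continuous.subtype_mk (Continuous.prodMk (by fun_prop) (Continuous.prodMk (by fun_prop)
        (hρ.comp (continuous_const.prodMk (by fun_prop))))) _
    · exact Continuous.subtype_mk (Continuous.prodMk (by fun_prop) (Continuous.prodMk (by fun_prop)
        (hρ.comp (continuous_const.prodMk (by fun_prop))))) _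
    · intro z
      refine Subtype.ext (Prod.ext rfl (Prod.ext ?_ rfl))
      simp
    · intro z; rfl
    · refine ⟨⟨le_max_of_le_left (hr _).1, max_le (hr _).2 z.2.1.2⟩, ?_, ?_⟩
      · by_cases h : z.1.2.2 = b
        · dsimp only
          rw [h, hrb]
          exact z.2.2.1.imp (fun h => by rw [h]; simp) id
        · exact Or.inr (hb z.1 z.2 h).2
      · by_cases h : z.1.2.2 = b
        · refine Or.inr ?_
          dsimp only
          rw [h, hρb]
        · refine Or.inl ?_
          dsimp only
          rw [(hb z.1 z.2 h).1, max_eq_right (hr _).2]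
    · exact Continuous.subtype_mk (Continuous.prodMk (by fun_prop) (Continuous.prodMk (by fun_prop)
        (hρ.comp (continuous_fst.prodMk (by fun_prop))))) _
    · intro z
      refine Subtype.ext (Prod.ext rfl (Prod.ext ?_ (hρ0 _)))
      simp only [ContinuousMap.id_apply]
      by_cases h : z.1.2.2 = b
      · rw [h, hrb, max_eq_right z.2.1.1]
      · rw [(hb z.1 z.2 h).1, max_eq_right (hr _).2]
    · intro z
      refine Subtype.ext (Prod.ext rfl (Prod.ext ?_ rfl))
      simp
  · refine ContinuousMap.Homotopic.symm (homotopic_of_continuous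
      (fun u z => ⟨(z.1.1, ρ u z.1.2), ?_⟩)
      (Continuous.subtype_mk (Continuous.prodMk (by fun_prop)
        (hρ.comp (continuous_fst.prodMk (by fun_prop)))) _) ?_ ?_)
    · exact z.2.imp id fun h => by dsimp only; rw [h, hρb]
    · intro z; exact Subtype.ext (Prod.ext rfl (hρ0 _))
    · intro z; rfl

end Bridge

/-! ### Unions of two open sets -/

section Unions

open Set Topology

/-- If a homotopy moves `X` inside itself into a subset `Y` that it preserves, then the inclusion
of `Y` is a homotopy equivalence. -/
theorem nonempty_homotopyEquiv_of_push {Z : Type*} [TopologicalSpace Z] {Y X : Set Z} (hYX : Y ⊆ X)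
    (H : ℝ → Z → Z) (hH : ContinuousOn (fun p : ℝ × Z => H p.1 p.2) (Icc 0 1 ×ˢ X))
    (h0 : ∀ x ∈ X, H 0 x = x) (hX : ∀ u ∈ Icc (0 : ℝ) 1, ∀ x ∈ X, H u x ∈ X)
    (hY : ∀ u ∈ Icc (0 : ℝ) 1, ∀ x ∈ Y, H u x ∈ Y) (h1 : ∀ x ∈ X, H 1 x ∈ Y) :
    Nonempty (Y ≃ₕ X) := by
  have hc : Continuous fun p : unitInterval × X => H p.1 p.2 :=
    hH.comp_continuous (f := fun p : unitInterval × X => ((p.1 : ℝ), (p.2 : Z))) (by fun_prop)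
      fun p => ⟨p.1.2, p.2.2⟩
  have hcY : Continuous fun p : unitInterval × Y => H p.1 p.2 :=
    hH.comp_continuous (f := fun p : unitInterval × Y => ((p.1 : ℝ), (p.2 : Z))) (by fun_prop)
      fun p => ⟨p.1.2, hYX p.2.2⟩
  refine ⟨⟨⟨inclusion hYX, continuous_inclusion hYX⟩, ⟨fun x => ⟨H 1 x, h1 x x.2⟩,
    Continuous.subtype_mk ?_ _⟩, ?_, ?_⟩⟩
  · exact hH.comp_continuous (f := fun x : X => ((1 : ℝ), (x : Z))) (by fun_prop)
      fun p => ⟨⟨zero_le_one, le_rfl⟩, p.2⟩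
  · refine ContinuousMap.Homotopic.symm (homotopic_of_continuous
      (fun u x => ⟨H u x, hY u u.2 x x.2⟩) ?_ ?_ ?_)
    · exact Continuous.subtype_mk hcY _
    · exact fun x => Subtype.ext (h0 x (hYX x.2))
    · exact fun x => rfl
  · refine ContinuousMap.Homotopic.symm (homotopic_of_continuous
      (fun u x => ⟨H u x, hX u u.2 x x.2⟩) ?_ ?_ ?_)
    · exact Continuous.subtype_mk hc _
    · exact fun x => Subtype.ext (h0 x x.2)
    · exact fun x => rfl

/-- Truncation to the unit interval. -/
def clampUnit (x : ℝ) : ℝ := max 0 (min 1 x)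

@[fun_prop]
lemma continuous_clampUnit : Continuous clampUnit := by unfold clampUnit; fun_prop

lemma clampUnit_mem (x : ℝ) : clampUnit x ∈ Icc (0 : ℝ) 1 :=
  ⟨le_max_left _ _, max_le zero_le_one (min_le_left _ _)⟩

lemma clampUnit_of_le_zero {x : ℝ} (h : x ≤ 0) : clampUnit x = 0 :=
  max_eq_left ((min_le_right _ _).trans h)

lemma clampUnit_of_one_le {x : ℝ} (h : 1 ≤ x) : clampUnit x = 1 := by
  rw [clampUnit, min_eq_left h, max_eq_right zero_le_one]

variable {Z : Type*}

section Pinch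

variable [TopologicalSpace Z] {W : Type*} [TopologicalSpace W] {T X : Set Z} {K : ℝ → Z → Z}

lemma continuousAt_of_continuousOn_Icc (hT : IsOpen T)
    (hK : ContinuousOn (fun p : ℝ × Z => K p.1 p.2) (Icc 0 1 ×ˢ T)) {c : W → ℝ} {y : W → Z}
    (hc : Continuous c) (hy : Continuous y) (hc1 : ∀ w, c w ∈ Icc (0 : ℝ) 1) {w : W}
    (hw : y w ∈ T) : ContinuousAt (fun w => K (c w) (y w)) w := by
  have h1 := hK (c w, y w) ⟨hc1 w, hw⟩
  refine h1.tendsto.comp (f := fun w => (c w, y w)) (tendsto_nhdsWithin_iff.2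
    ⟨(hc.prodMk hy).continuousAt, ?_⟩)
  filter_upwards [(hT.preimage hy).mem_nhds hw] with w' hw'
  exact ⟨hc1 w', hw'⟩

/-- A homotopy of an open set `T`, cut off by a function that vanishes near the complement. -/
lemma continuous_cutoff [DecidablePred (· ∈ T)] (hT : IsOpen T)
    (hK : ContinuousOn (fun p : ℝ × Z => K p.1 p.2) (Icc 0 1 ×ˢ T)) (hK0 : ∀ z ∈ T, K 0 z = z)
    {c : W → ℝ} {y : W → Z} (hc : Continuous c) (hy : Continuous y)
    (hc1 : ∀ w, c w ∈ Icc (0 : ℝ) 1) (h : ∀ w, y w ∉ T → ∀ᶠ w' in 𝓝 w, c w' = 0) :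
    Continuous fun w => if y w ∈ T then K (c w) (y w) else y w := by
  rw [continuous_iff_continuousAt]
  intro w
  by_cases hw : y w ∈ T
  · refine (continuousAt_of_continuousOn_Icc hT hK hc hy hc1 hw).congr ?_
    filter_upwards [(hT.preimage hy).mem_nhds hw] with w' hw'
    rw [if_pos (show y w' ∈ T from hw')]
  · refine hy.continuousAt.congr ?_
    filter_upwards [h w hw] with w' hw'
    split_ifs with h'
    · rw [hw', hK0 _ h']
    · rfl

open Classical in
/-- The projection of a union `X ∪ B` of two sets with intersection `T` to `X`, where `T` is
contracted to a point `t` as the parameter moves from `0` to `1 / 3`. -/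
noncomputable def pinch (T X : Set Z) (K : ℝ → Z → Z) (t : Z) (c : ℝ) (y : Z) : Z :=
  if y ∈ T then K (clampUnit (3 * c)) y else if y ∈ X then y else t

lemma continuous_pinch (hT : IsOpen T) {t : Z}
    (hK : ContinuousOn (fun p : ℝ × Z => K p.1 p.2) (Icc 0 1 ×ˢ T)) (hK0 : ∀ z ∈ T, K 0 z = z)
    (hK1 : ∀ z ∈ T, K 1 z = t)
    {c : W → ℝ} {y : W → Z} (hc : Continuous c) (hy : Continuous y)
    (h : ∀ w, y w ∈ T ∨ (∀ᶠ w' in 𝓝 w, c w' = 0 ∧ y w' ∈ X) ∨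
      (∀ᶠ w' in 𝓝 w, c w' = 1 ∧ (y w' ∈ T ∨ y w' ∉ X))) :
    Continuous fun w => pinch T X K t (c w) (y w) := by
  rw [continuous_iff_continuousAt]
  intro w
  rcases h w with hw | hw | hw
  · refine (continuousAt_of_continuousOn_Icc hT hK (c := fun w => clampUnit (3 * c w))
      (by fun_prop) hy (fun w => clampUnit_mem _) hw).congr ?_
    filter_upwards [(hT.preimage hy).mem_nhds hw] with w' hw'
    rw [pinch, if_pos (show y w' ∈ T from hw')]
  · refine hy.continuousAt.congr ?_
    filter_upwards [hw] with w' hw'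
    unfold pinch
    split_ifs with h'
    · rw [hw'.1, mul_zero, clampUnit_of_le_zero le_rfl, hK0 _ h']
    · rfl
    · exact absurd hw'.2 (by assumption)
  · refine (continuousAt_const (y := t)).congr ?_
    filter_upwards [hw] with w' hw'
    unfold pinch
    split_ifs with h' h''
    · rw [hw'.1, clampUnit_of_one_le (by norm_num), hK1 _ h']
    · exact absurd h'' (hw'.2.resolve_left h')
    · rfl

end Pinch

variable [MetricSpace Z] {X B : Set Z}

/-- A partition function for an open cover by two sets. -/
lemma exists_partition (hX : IsOpen X) (hB : IsOpen B) : ∃ l : C(↥(X ∪ B), ℝ),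
    (∀ y, l y ∈ Icc (0 : ℝ) 1) ∧ (∀ y : ↥(X ∪ B), (y : Z) ∉ B → ∀ᶠ y' in 𝓝 y, l y' = 0) ∧
    (∀ y : ↥(X ∪ B), (y : Z) ∉ X → ∀ᶠ y' in 𝓝 y, l y' = 1) := by
  obtain ⟨f, hf0, hf1, -⟩ := exists_continuous_zero_one_of_isClosed
    (s := {y : ↥(X ∪ B) | (y : Z) ∉ B}) (t := {y : ↥(X ∪ B) | (y : Z) ∉ X})
    (hB.preimage continuous_subtype_val).isClosed_compl
    (hX.preimage continuous_subtype_val).isClosed_compl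
    (disjoint_left.2 fun y h1 h2 => y.2.elim h2 h1)
  refine ⟨⟨fun y => clampUnit (3 * f y - 1), by fun_prop⟩, fun y => clampUnit_mem _, ?_, ?_⟩
  · intro y hy
    have h : f y < 1 / 3 := by rw [hf0 hy]; norm_num
    filter_upwards [(isOpen_lt f.continuous continuous_const).mem_nhds h] with y' hy'
    exact clampUnit_of_le_zero (by linarith [show f y' < 1 / 3 from hy'])
  · intro y hy
    have h : 2 / 3 < f y := by rw [hf1 hy]; norm_num
    filter_upwards [(isOpen_lt continuous_const f.continuous).mem_nhds h] with y' hy'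
    exact clampUnit_of_one_le (by linarith [show 2 / 3 < f y' from hy'])

/-- Adding an open set that can be pushed into its intersection with `X`. -/
theorem nonempty_homotopyEquiv_union_of_push (hX : IsOpen X) (hB : IsOpen B) (H : ℝ → Z → Z)
    (hH : ContinuousOn (fun p : ℝ × Z => H p.1 p.2) (Icc 0 1 ×ˢ B))
    (h0 : ∀ x ∈ B, H 0 x = x) (hHB : ∀ u ∈ Icc (0 : ℝ) 1, ∀ x ∈ B, H u x ∈ B)
    (hHX : ∀ u ∈ Icc (0 : ℝ) 1, ∀ x ∈ X, x ∈ B → H u x ∈ X) (h1 : ∀ x ∈ B, H 1 x ∈ X) :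
    Nonempty (X ≃ₕ ↥(X ∪ B)) := by
  classical
  obtain ⟨l, hl, hl0, hl1⟩ := exists_partition hX hB
  let Φ : unitInterval → ↥(X ∪ B) → Z := fun u y => if (y : Z) ∈ B then H (u * l y) y else y
  have hul : ∀ (u : unitInterval) (y : ↥(X ∪ B)), (u * l y : ℝ) ∈ Icc (0 : ℝ) 1 := fun u y =>
    ⟨mul_nonneg u.2.1 (hl y).1, mul_le_one₀ u.2.2 (hl y).1 (hl y).2⟩
  have hΦ : Continuous fun p : unitInterval × ↥(X ∪ B) => Φ p.1 p.2 := by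
    refine continuous_cutoff hB hH h0 (c := fun p : unitInterval × ↥(X ∪ B) => (p.1 * l p.2 : ℝ))
      (y := fun p => p.2.1) (by fun_prop) (by fun_prop) (fun p => hul _ _) fun p hp => ?_
    filter_upwards [(continuous_snd.tendsto p).eventually (hl0 p.2 hp)] with p' hp'
    rw [hp', mul_zero]
  have hΦX : ∀ u (y : ↥(X ∪ B)), (y : Z) ∈ X → Φ u y ∈ X := by
    intro u y hy
    dsimp only [Φ]
    split_ifs with h
    · exact hHX _ (hul u y) y hy h
    · exact hy
  have hΦY : ∀ u (y : ↥(X ∪ B)), Φ u y ∈ X ∪ B := by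
    intro u y
    by_cases h : (y : Z) ∈ B
    · refine Or.inr ?_
      dsimp only [Φ]
      rw [if_pos h]
      exact hHB _ (hul u y) y h
    · exact Or.inl (hΦX u y (y.2.resolve_right h))
  have hΦ1 : ∀ y : ↥(X ∪ B), Φ 1 y ∈ X := by
    intro y
    by_cases h : (y : Z) ∈ X
    · exact hΦX 1 y h
    · have hB := y.2.resolve_left h
      have : l y = 1 := (hl1 y h).self_of_nhds
      simp only [Φ, if_pos hB, this, Icc.coe_one, mul_one]
      exact h1 y hB
  have hΦ0 : ∀ y : ↥(X ∪ B), Φ 0 y = y := by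
    intro y
    simp only [Φ, Icc.coe_zero, zero_mul]
    split_ifs with h
    · exact h0 y h
    · rfl
  refine ⟨⟨⟨inclusion subset_union_left, continuous_inclusion _⟩, ⟨fun x => ⟨Φ 1 x, hΦ1 x⟩,
    Continuous.subtype_mk (hΦ.comp (continuous_const.prodMk continuous_id)) _⟩, ?_, ?_⟩⟩
  · refine ContinuousMap.Homotopic.symm (homotopic_of_continuous
      (fun u x => ⟨Φ u (inclusion subset_union_left x), hΦX u _ x.2⟩) ?_ ?_ ?_)
    · exact Continuous.subtype_mk (hΦ.comp (f := fun p : unitInterval × X =>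
        (p.1, (inclusion subset_union_left p.2 : ↥(X ∪ B)))) (by fun_prop)) _
    · exact fun x => Subtype.ext (hΦ0 _)
    · exact fun x => rfl
  · refine ContinuousMap.Homotopic.symm (homotopic_of_continuous
      (fun u x => ⟨Φ u x, hΦY u _⟩) ?_ ?_ ?_)
    · exact Continuous.subtype_mk hΦ _
    · exact fun x => Subtype.ext (hΦ0 _)
    · exact fun x => rfl

/-- The union of two open sets whose intersection contracts to a point is, up to homotopy, their
disjoint union joined by an interval. -/
theorem nonempty_union_homotopyEquiv_bridgeSum (hX : IsOpen X) (hB : IsOpen B) {t : Z}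
    (ht : t ∈ X) (ht' : t ∈ B) (K : ℝ → Z → Z)
    (hK : ContinuousOn (fun p : ℝ × Z => K p.1 p.2) (Icc 0 1 ×ˢ (X ∩ B)))
    (hKT : ∀ u ∈ Icc (0 : ℝ) 1, ∀ z ∈ X ∩ B, K u z ∈ X ∩ B)
    (hK0 : ∀ z ∈ X ∩ B, K 0 z = z) (hK1 : ∀ z ∈ X ∩ B, K 1 z = t)
    (hKt : ∀ u ∈ Icc (0 : ℝ) 1, K u t = t) :
    Nonempty (↥(X ∪ B) ≃ₕ bridgeSum X ⟨t, ht⟩ B ⟨t, ht'⟩) := by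
  classical
  obtain ⟨l, hl, hl0, hl1⟩ := exists_partition hX hB
  set T := X ∩ B with hTdef
  have hTo : IsOpen T := hX.inter hB
  have htT : t ∈ T := ⟨ht, ht'⟩
  have hmX : ∀ c y, pinch T X K t c y ∈ X := by
    intro c y; unfold pinch; split_ifs with h1 h2
    exacts [(hKT _ (clampUnit_mem _) y h1).1, h2, ht]
  have hmB : ∀ c y, pinch T B K t c y ∈ B := by
    intro c y; unfold pinch; split_ifs with h1 h2
    exacts [(hKT _ (clampUnit_mem _) y h1).2, h2, ht']
  have hpt : ∀ A c, pinch T A K t c t = t := by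
    intro A c; unfold pinch; rw [if_pos htT, hKt _ (clampUnit_mem _)]
  have hp0 : ∀ A, ∀ y ∈ A, pinch T A K t 0 y = y := by
    intro A y hy; unfold pinch; split_ifs with h1
    · rw [mul_zero, clampUnit_of_le_zero le_rfl, hK0 y h1]
    · rfl
  have hp1 : ∀ y ∈ T, ∀ A c, 1 ≤ 3 * c → pinch T A K t c y = t := by
    intro y hy A c hc; unfold pinch; rw [if_pos hy, clampUnit_of_one_le hc, hK1 y hy]
  -- the point of the bridge sum with parameter `c` over `y`
  have hP : ∀ (c : ℝ) (y : ↥(X ∪ B)), ((y : Z) ∉ B → c = 0) → ((y : Z) ∉ X → c = 1) →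
      ((⟨pinch T X K t c y, hmX c y⟩, clampUnit (3 * c - 1), ⟨pinch T B K t (1 - c) y, hmB _ y⟩) :
        X × ℝ × B) ∈ bridgeSum X ⟨t, ht⟩ B ⟨t, ht'⟩ := by
    intro c y h0 h1
    refine ⟨clampUnit_mem _, ?_, ?_⟩
    · rcases le_total (3 * c - 1) 0 with h | h
      · exact Or.inl (clampUnit_of_le_zero h)
      · refine Or.inr (Subtype.ext ?_)
        by_cases hy : (y : Z) ∈ X
        · refine hp1 y ⟨hy, ?_⟩ X c (by linarith)
          by_contra hB'
          rw [h0 hB'] at h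
          norm_num at h
        · simp only [pinch]
          rw [if_neg (fun h => hy h.1), if_neg hy]
    · rcases le_total 1 (3 * c - 1) with h | h
      · exact Or.inl (clampUnit_of_one_le h)
      · refine Or.inr (Subtype.ext ?_)
        by_cases hy : (y : Z) ∈ B
        · refine hp1 y ⟨?_, hy⟩ B (1 - c) (by linarith)
          by_contra hX'
          rw [h1 hX'] at h
          norm_num at h
        · simp only [pinch]
          rw [if_neg (fun h => hy h.2), if_neg hy]
  have hPcont : ∀ {W : Type _} [TopologicalSpace W] (c : W → ℝ) (y : W → ↥(X ∪ B))
      (hc : Continuous c)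
      (hy : Continuous y)
      (h0 : ∀ w, (y w : Z) ∉ B → ∀ᶠ w' in 𝓝 w, c w' = 0 ∧ (y w' : Z) ∈ X)
      (h1 : ∀ w, (y w : Z) ∉ X → ∀ᶠ w' in 𝓝 w, c w' = 1 ∧ (y w' : Z) ∈ B),
      Continuous (fun w => ((⟨pinch T X K t (c w) (y w), hmX (c w) (y w)⟩,
        clampUnit (3 * c w - 1), ⟨pinch T B K t (1 - c w) (y w), hmB _ (y w)⟩) : X × ℝ × B)) := by
    intro W _ c y hc hy h0 h1
    refine Continuous.prodMk (Continuous.subtype_mk ?_ _) (Continuous.prodMk (by fun_prop)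
      (Continuous.subtype_mk ?_ _))
    · refine continuous_pinch hTo hK hK0 hK1 hc (continuous_subtype_val.comp hy) fun w => ?_
      by_cases hwX : (y w : Z) ∈ X
      · by_cases hwB : (y w : Z) ∈ B
        · exact Or.inl ⟨hwX, hwB⟩
        · exact Or.inr (Or.inl (h0 w hwB))
      · refine Or.inr (Or.inr ?_)
        filter_upwards [h1 w hwX] with w' hw'
        exact ⟨hw'.1, (em ((y w' : Z) ∈ X)).imp (fun h => ⟨h, hw'.2⟩) id⟩
    · refine continuous_pinch hTo hK hK0 hK1 (by fun_prop) (continuous_subtype_val.comp hy)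
        fun w => ?_
      by_cases hwX : (y w : Z) ∈ X
      · by_cases hwB : (y w : Z) ∈ B
        · exact Or.inl ⟨hwX, hwB⟩
        · refine Or.inr (Or.inr ?_)
          filter_upwards [h0 w hwB] with w' hw'
          exact ⟨by rw [hw'.1, sub_zero], (em ((y w' : Z) ∈ B)).imp (fun h => ⟨hw'.2, h⟩) id⟩
      · refine Or.inr (Or.inl ?_)
        filter_upwards [h1 w hwX] with w' hw'
        exact ⟨by rw [hw'.1, sub_self], hw'.2⟩
  have hl0' : ∀ y : ↥(X ∪ B), (y : Z) ∉ B → ∀ᶠ y' in 𝓝 y, l y' = 0 ∧ (y' : Z) ∈ X := fun y hy => by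
    filter_upwards [hl0 y hy, (hX.preimage continuous_subtype_val).mem_nhds (y.2.resolve_right hy)]
      with y' h1 h2 using ⟨h1, h2⟩
  have hl1' : ∀ y : ↥(X ∪ B), (y : Z) ∉ X → ∀ᶠ y' in 𝓝 y, l y' = 1 ∧ (y' : Z) ∈ B := fun y hy => by
    filter_upwards [hl1 y hy, (hB.preimage continuous_subtype_val).mem_nhds (y.2.resolve_left hy)]
      with y' h1 h2 using ⟨h1, h2⟩
  let D := bridgeSum X ⟨t, ht⟩ B ⟨t, ht'⟩
  let p : C(↥(X ∪ B), D) := ⟨fun y => ⟨_, hP (l y) y (fun h => (hl0 y h).self_of_nhds)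
    (fun h => (hl1 y h).self_of_nhds)⟩,
    Continuous.subtype_mk (hPcont l id l.continuous continuous_id hl0' hl1') _⟩
  let q : C(D, ↥(X ∪ B)) := ⟨fun z => if z.1.2.1 = 0 then ⟨z.1.1, Or.inl z.1.1.2⟩
      else ⟨z.1.2.2, Or.inr z.1.2.2.2⟩, by
    refine continuous_ite_eq_zero (u := fun z : D => z.1.1) (x := ⟨t, ht⟩)
      (s := fun z : D => z.1.2.1) (by fun_prop) (by fun_prop) (fun z => z.2.2.1)
      (by fun_prop) (by fun_prop) fun z h1 h2 => ?_
    have h3 := z.2.2.2.resolve_left (by rw [h1]; exact zero_ne_one)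
    exact Subtype.ext (by simp [h2, h3])⟩
  have hq0 : ∀ z : D, z.1.2.1 = 0 → (q z : Z) = z.1.1 := fun z h => by
    simp only [q, ContinuousMap.coe_mk, if_pos h]
  have hq1 : ∀ z : D, z.1.2.1 ≠ 0 → (q z : Z) = z.1.2.2 := fun z h => by
    simp only [q, ContinuousMap.coe_mk, if_neg h]
  have hqX : ∀ z : D, (q z : Z) ∉ B → z.1.2.1 = 0 ∧ z.1.1 ≠ ⟨t, ht⟩ := by
    intro z h
    have h0 : z.1.2.1 = 0 := by
      by_contra h0
      simp only [q, ContinuousMap.coe_mk, if_neg h0] at h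
      exact h z.1.2.2.2
    refine ⟨h0, fun h1 => h ?_⟩
    simp only [q, ContinuousMap.coe_mk, if_pos h0, h1]
    exact ht'
  have hqB : ∀ z : D, (q z : Z) ∉ X → z.1.2.1 = 1 ∧ z.1.2.2 ≠ ⟨t, ht'⟩ := by
    intro z h
    have h0 : z.1.2.1 ≠ 0 := by
      intro h0
      simp only [q, ContinuousMap.coe_mk, if_pos h0] at h
      exact h z.1.1.2
    have h1 : z.1.2.2 ≠ ⟨t, ht'⟩ := by
      intro h1
      simp only [q, ContinuousMap.coe_mk, if_neg h0, h1] at h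
      exact h ht
    exact ⟨z.2.2.2.resolve_right h1, h1⟩
  have hqp : ∀ y : ↥(X ∪ B), (q (p y) : Z) = if clampUnit (3 * l y - 1) = 0 then
      pinch T X K t (l y) y else pinch T B K t (1 - l y) y := fun y => by
    simp only [p, q, ContinuousMap.coe_mk]
    split_ifs <;> rfl
  refine ⟨⟨p, q, ?_, ?_⟩⟩
  · -- `q ∘ p` follows `K` up to a time depending on the value of `l`
    have hk : ∀ (u : unitInterval) (x : ℝ), (1 - u : ℝ) * clampUnit (min (3 * x) (3 - 3 * x)) ∈
        Icc (0 : ℝ) 1 := fun u x => ⟨mul_nonneg (sub_nonneg.2 u.2.2) (clampUnit_mem _).1,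
        mul_le_one₀ (by linarith [u.2.1]) (clampUnit_mem _).1 (clampUnit_mem _).2⟩
    refine homotopic_of_continuous (fun u y => ⟨if (y : Z) ∈ T then
      K ((1 - u : ℝ) * clampUnit (min (3 * l y) (3 - 3 * l y))) y else y, ?_⟩)
      (Continuous.subtype_mk ?_ _) ?_ ?_
    · split_ifs with h
      · exact Or.inl (hKT _ (hk _ _) y h).1
      · exact y.2
    · refine continuous_cutoff hTo hK hK0 (c := fun w : unitInterval × ↥(X ∪ B) =>
        (1 - w.1 : ℝ) * clampUnit (min (3 * l w.2) (3 - 3 * l w.2))) (y := fun w => w.2.1)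
        (by fun_prop) (by fun_prop) (fun w => hk _ _) fun w hw => ?_
      by_cases hwB : (w.2 : Z) ∈ B
      · have hwX : (w.2 : Z) ∉ X := fun h => hw ⟨h, hwB⟩
        filter_upwards [(continuous_snd.tendsto w).eventually (hl1 w.2 hwX)] with w' hw'
        rw [hw', clampUnit_of_le_zero (by norm_num), mul_zero]
      · filter_upwards [(continuous_snd.tendsto w).eventually (hl0 w.2 hwB)] with w' hw'
        rw [hw', clampUnit_of_le_zero (by norm_num), mul_zero]
    · intro y
      refine Subtype.ext ?_
      simp only [ContinuousMap.comp_apply, Icc.coe_zero, sub_zero, one_mul, hqp]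
      by_cases hy : (y : Z) ∈ T
      · rw [if_pos hy]
        by_cases h : clampUnit (3 * l y - 1) = 0
        · have h3 : 3 * l y ≤ 1 := by
            by_contra h3
            have : 0 < clampUnit (3 * l y - 1) :=
              lt_max_of_lt_right (lt_min one_pos (by linarith))
            exact this.ne' h
          rw [if_pos h]
          simp only [pinch, if_pos hy]
          congr 2
          exact min_eq_left (by linarith)
        · have h3 : 1 < 3 * l y := by
            by_contra h3
            exact h (clampUnit_of_le_zero (by linarith))
          rw [if_neg h]
          simp only [pinch, if_pos hy]
          congr 1
          rcases le_total (3 * l y) (3 - 3 * l y) with h4 | h4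
          · rw [min_eq_left h4, clampUnit_of_one_le (by linarith),
              clampUnit_of_one_le (by linarith)]
          · rw [min_eq_right h4]; congr 1; ring
      · rw [if_neg hy]
        by_cases hyX : (y : Z) ∈ X
        · have hyB : (y : Z) ∉ B := fun h => hy ⟨hyX, h⟩
          rw [(hl0 y hyB).self_of_nhds, if_pos (clampUnit_of_le_zero (by norm_num))]
          exact (hp0 X y hyX).symm
        · have hyB := y.2.resolve_left hyX
          rw [(hl1 y hyX).self_of_nhds, if_neg (by rw [clampUnit_of_one_le (by norm_num)]; simp)]
          simp only [sub_self]
          exact (hp0 B y hyB).symm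
    · intro y
      refine Subtype.ext ?_
      simp only [Icc.coe_one, sub_self, zero_mul, ContinuousMap.id_apply]
      split_ifs with h
      · exact hK0 _ h
      · rfl
  · -- the parameter is moved linearly to the interval coordinate
    let c : unitInterval → D → ℝ := fun u z => (1 - u : ℝ) * l (q z) + u * z.1.2.1
    have hc0 : ∀ u z, (q z : Z) ∉ B → c u z = 0 := fun u z h => by
      simp only [c, (hl0 _ h).self_of_nhds, (hqX z h).1]; ring
    have hc1 : ∀ u z, (q z : Z) ∉ X → c u z = 1 := fun u z h => by
      simp only [c, (hl1 _ h).self_of_nhds, (hqB z h).1]; ring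
    have hlast : ∀ z : D, (⟨_, hP (c 1 z) (q z) (hc0 1 z) (hc1 1 z)⟩ : D).1 =
        (z.1.1, clampUnit (3 * z.1.2.1 - 1), z.1.2.2) := by
      intro z
      have hcz : c 1 z = z.1.2.1 := by simp [c]
      have hx : pinch T X K t (c 1 z) (q z) = z.1.1 ∧
          pinch T B K t (1 - c 1 z) (q z) = z.1.2.2 := by
        rw [hcz]
        by_cases h0 : z.1.2.1 = 0
        · have h2 := z.2.2.2.resolve_left (by rw [h0]; exact zero_ne_one)
          simp only [hq0 z h0, h0, h2, sub_zero]
          refine ⟨hp0 X _ z.1.1.2, ?_⟩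
          by_cases h : (z.1.1 : Z) ∈ B
          · exact hp1 _ ⟨z.1.1.2, h⟩ _ _ (by norm_num)
          · simp only [pinch]
            rw [if_neg (fun h' => h h'.2), if_neg h]
        · have h2 := z.2.2.1.resolve_left h0
          simp only [hq1 z h0, h2]
          by_cases h1 : z.1.2.1 = 1
          · simp only [h1, sub_self]
            refine ⟨?_, hp0 B _ z.1.2.2.2⟩
            by_cases h : (z.1.2.2 : Z) ∈ X
            · exact hp1 _ ⟨h, z.1.2.2.2⟩ _ _ (by norm_num)
            · simp only [pinch]
              rw [if_neg (fun h' => h h'.1), if_neg h]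
          · have h3 := z.2.2.2.resolve_left h1
            rw [h3]
            exact ⟨hpt _ _, hpt _ _⟩
      refine Prod.ext (Subtype.ext hx.1) (Prod.ext ?_ (Subtype.ext hx.2))
      dsimp only
      rw [hcz]
    have hmem : ∀ z : D, (z.1.1, clampUnit (3 * z.1.2.1 - 1), z.1.2.2) ∈ D := fun z => by
      rw [← hlast z]; exact hP (c 1 z) (q z) (hc0 1 z) (hc1 1 z)
    have step : (p.comp q).Homotopic ⟨fun z => ⟨(z.1.1, clampUnit (3 * z.1.2.1 - 1), z.1.2.2),
        hmem z⟩, Continuous.subtype_mk (by fun_prop) hmem⟩ := by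
      refine homotopic_of_continuous (fun u z => ⟨_, hP (c u z) (q z) (hc0 u z) (hc1 u z)⟩)
        (Continuous.subtype_mk (hPcont (fun w : unitInterval × D => c w.1 w.2) (fun w => q w.2)
          (by fun_prop) (by fun_prop) ?_ ?_) _) ?_ ?_
      · intro w hw
        have hq : Filter.Tendsto (fun w : unitInterval × D => q w.2) (𝓝 w) (𝓝 (q w.2)) :=
          (q.continuous.comp continuous_snd).tendsto w
        have hne : ∀ᶠ w' : unitInterval × D in 𝓝 w, w'.2.1.1 ≠ ⟨t, ht⟩ :=
          (isOpen_ne_fun (f := fun w : unitInterval × D => w.2.1.1) (by fun_prop)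
            continuous_const).mem_nhds (hqX w.2 hw).2
        filter_upwards [hq.eventually (hl0' _ hw), hne] with w' h1 h2
        refine ⟨?_, h1.2⟩
        simp only [c, h1.1, w'.2.2.2.1.resolve_right h2]; ring
      · intro w hw
        have hq : Filter.Tendsto (fun w : unitInterval × D => q w.2) (𝓝 w) (𝓝 (q w.2)) :=
          (q.continuous.comp continuous_snd).tendsto w
        have hne : ∀ᶠ w' : unitInterval × D in 𝓝 w, w'.2.1.2.2 ≠ ⟨t, ht'⟩ :=
          (isOpen_ne_fun (f := fun w : unitInterval × D => w.2.1.2.2) (by fun_prop)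
            continuous_const).mem_nhds (hqB w.2 hw).2
        filter_upwards [hq.eventually (hl1' _ hw), hne] with w' h1 h2
        refine ⟨?_, h1.2⟩
        simp only [c, h1.1, w'.2.2.2.2.resolve_right h2]; ring
      · intro z
        have : c 0 z = l (q z) := by simp [c]
        refine Subtype.ext ?_
        simp only [this]
        rfl
      · intro z
        exact Subtype.ext (hlast z)
    refine step.trans (homotopic_of_continuous (fun u z => ⟨(z.1.1,
      (1 - u : ℝ) * clampUnit (3 * z.1.2.1 - 1) + u * z.1.2.1, z.1.2.2), ?_, ?_, ?_⟩)
      (Continuous.subtype_mk (by fun_prop) _) ?_ ?_)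
    · exact (convex_Icc (0 : ℝ) 1) (clampUnit_mem _) z.2.1 (sub_nonneg.2 u.2.2) u.2.1 (by ring)
    · refine z.2.2.1.imp (fun h => ?_) id
      dsimp only
      rw [h, clampUnit_of_le_zero (by norm_num)]; ring
    · refine z.2.2.2.imp (fun h => ?_) id
      dsimp only
      rw [h, clampUnit_of_one_le (by norm_num)]; ring
    · intro z; simp
    · intro z; simp only [Icc.coe_one, sub_self, zero_mul, one_mul, zero_add]; rfl

end Unions

/-! ### Betti numbers of spheres -/

section SphereBetti

open Set Topology Module

/-- A product with a contractible space. -/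
lemma nonempty_prod_homotopyEquiv (X C : Type*) [TopologicalSpace X] [TopologicalSpace C]
    [ContractibleSpace C] : Nonempty ((X × C) ≃ₕ X) := by
  obtain ⟨e⟩ := ContractibleSpace.hequiv_unit C
  exact ⟨((ContinuousMap.HomotopyEquiv.refl X).prodCongr e).trans
    (Homeomorph.prodUnique X Unit).toHomotopyEquiv⟩

lemma nonempty_punctured_homotopyEquiv_sphere (E : Type*) [NormedAddCommGroup E] [NormedSpace ℝ E] :
    Nonempty (({0}ᶜ : Set E) ≃ₕ Metric.sphere (0 : E) 1) := by
  have : ContractibleSpace (Ioi (0 : ℝ)) := (convex_Ioi 0).contractibleSpace nonempty_Ioi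
  obtain ⟨e⟩ := nonempty_prod_homotopyEquiv (Metric.sphere (0 : E) 1) (Ioi (0 : ℝ))
  exact ⟨(homeomorphUnitSphereProd E).toHomotopyEquiv.trans e⟩

/-- Linear isomorphisms preserve the punctured space. -/
def puncturedHomeomorph {E F : Type*} [NormedAddCommGroup E] [NormedSpace ℝ E]
    [NormedAddCommGroup F] [NormedSpace ℝ F] (e : E ≃L[ℝ] F) :
    ({0}ᶜ : Set E) ≃ₜ ({0}ᶜ : Set F) :=
  e.toHomeomorph.subtype fun x => by simp

/-- A subset of a subspace, as a subset of the ambient space. -/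
def preimageValHomeomorph {Z : Type*} [TopologicalSpace Z] {U X : Set Z} (h : U ⊆ X) :
    ↥(Subtype.val ⁻¹' U : Set X) ≃ₜ U where
  toFun z := ⟨z.1.1, z.2⟩
  invFun z := ⟨⟨z.1, h z.2⟩, z.2⟩
  left_inv _ := rfl
  right_inv _ := rfl
  continuous_toFun := by fun_prop
  continuous_invFun := by fun_prop

section Suspension

lemma nonempty_homotopyEquiv_snd_ne_zero {F : Type} [NormedAddCommGroup F] :
    Nonempty ({z : ℝ × F | z.2 ≠ 0} ≃ₕ ({0}ᶜ : Set F)) := by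
  refine ⟨⟨⟨fun z => ⟨z.1.2, z.2⟩, by fun_prop⟩, ⟨fun y => ⟨(0, y), y.2⟩, by fun_prop⟩, ?_,
    .refl _⟩⟩
  refine homotopic_of_continuous (fun u z => ⟨(u * z.1.1, z.1.2), z.2⟩) (by fun_prop) ?_ ?_
  · intro z; refine Subtype.ext (Prod.ext ?_ rfl); simp
  · intro z; refine Subtype.ext (Prod.ext ?_ rfl); simp

variable {F : Type} [NormedAddCommGroup F] [NormedSpace ℝ F]

lemma contractibleSpace_compl_closed_ray :
    ContractibleSpace {z : ℝ × F | ¬(z.1 ≤ 0 ∧ z.2 = 0)} := by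
  refine StarConvex.contractibleSpace (x := (1, 0)) ?_ ⟨(1, 0), by simp⟩
  rintro ⟨s, y⟩ hz a b ha hb hab ⟨h1, h2⟩
  simp only [Prod.smul_mk, Prod.mk_add_mk, smul_eq_mul, mul_one, smul_zero, zero_add] at h1 h2
  rcases smul_eq_zero.1 h2 with h | h
  · subst h; linarith
  · have hs : 0 < s := by
      by_contra hs; exact hz ⟨not_lt.1 hs, h⟩
    have := mul_nonneg hb hs.le
    have ha0 : a = 0 := by linarith
    have hb1 : b = 1 := by linarith
    subst ha0 hb1
    linarith

lemma contractibleSpace_compl_closed_ray' :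
    ContractibleSpace {z : ℝ × F | ¬(0 ≤ z.1 ∧ z.2 = 0)} := by
  have := contractibleSpace_compl_closed_ray (F := F)
  refine (Homeomorph.contractibleSpace_iff (((Homeomorph.neg ℝ).prodCongr
    (Homeomorph.refl F)).subtype fun z => ?_)).2 this
  simp

/-- The open cover of the punctured space `ℝ × F` by the complements of two opposite rays. -/
lemma exists_cover_punctured : ∃ U V : Set ({0}ᶜ : Set (ℝ × F)), IsOpen U ∧ IsOpen V ∧
    U ∪ V = univ ∧ ContractibleSpace U ∧ ContractibleSpace V ∧
    Nonempty (↥(U ∩ V) ≃ₕ ({0}ᶜ : Set F)) := by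
  refine ⟨Subtype.val ⁻¹' {z | ¬(z.1 ≤ 0 ∧ z.2 = 0)}, Subtype.val ⁻¹' {z | ¬(0 ≤ z.1 ∧ z.2 = 0)},
    ?_, ?_, ?_, ?_, ?_, ?_⟩
  · refine IsOpen.preimage continuous_subtype_val ?_
    exact ((isClosed_le continuous_fst continuous_const).inter
      (isClosed_eq continuous_snd continuous_const)).isOpen_compl
  · refine IsOpen.preimage continuous_subtype_val ?_
    exact ((isClosed_le continuous_const continuous_fst).inter
      (isClosed_eq continuous_snd continuous_const)).isOpen_compl
  · ext ⟨z, hz⟩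
    simp only [mem_union, mem_preimage, mem_ofPred_eq, mem_univ, iff_true]
    by_contra! h
    exact hz (Prod.ext (le_antisymm h.1.1 h.2.1) h.1.2)
  · have := contractibleSpace_compl_closed_ray (F := F)
    have hsub : {z : ℝ × F | ¬(z.1 ≤ 0 ∧ z.2 = 0)} ⊆ {0}ᶜ := fun z hz h => hz (by rw [h]; simp)
    exact (preimageValHomeomorph hsub).contractibleSpace
  · have := contractibleSpace_compl_closed_ray' (F := F)
    have hsub : {z : ℝ × F | ¬(0 ≤ z.1 ∧ z.2 = 0)} ⊆ {0}ᶜ := fun z hz h => hz (by rw [h]; simp)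
    exact (preimageValHomeomorph hsub).contractibleSpace
  · obtain ⟨e⟩ := nonempty_homotopyEquiv_snd_ne_zero (F := F)
    have hsub : {z : ℝ × F | z.2 ≠ 0} ⊆ {0}ᶜ := fun z hz h => hz (by rw [h]; rfl)
    have heq : Subtype.val ⁻¹' {z : ℝ × F | ¬(z.1 ≤ 0 ∧ z.2 = 0)} ∩
        Subtype.val ⁻¹' {z | ¬(0 ≤ z.1 ∧ z.2 = 0)} =
        (Subtype.val ⁻¹' {z : ℝ × F | z.2 ≠ 0} : Set ({0}ᶜ : Set (ℝ × F))) := by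
      ext ⟨z, hz⟩
      simp only [mem_inter_iff, mem_preimage, mem_ofPred_eq]
      constructor
      · rintro ⟨h1, h2⟩ h
        rcases le_total z.1 0 with h3 | h3
        · exact h1 ⟨h3, h⟩
        · exact h2 ⟨h3, h⟩
      · exact fun h => ⟨fun h' => h h'.2, fun h' => h h'.2⟩
    exact ⟨(Homeomorph.setCongr heq).toHomotopyEquiv.trans
      ((preimageValHomeomorph hsub).toHomotopyEquiv.trans e)⟩

end Suspension

lemma pathConnectedSpace_punctured {E : Type*} [NormedAddCommGroup E] [NormedSpace ℝ E]
    (h : 1 < finrank ℝ E) : PathConnectedSpace ({0}ᶜ : Set E) :=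
  isPathConnected_iff_pathConnectedSpace.1 (isPathConnected_compl_singleton_of_one_lt_rank
    (lt_rank_of_lt_finrank h) 0)

lemma pathConnectedSpace_of_homotopyEquiv {X Y : Type*} [TopologicalSpace X] [TopologicalSpace Y]
    (e : X ≃ₕ Y) [PathConnectedSpace Y] : PathConnectedSpace X := by
  obtain ⟨H⟩ := e.left_inv
  have hj : ∀ x, Joined (e.invFun (e.toFun x)) x := fun x => ⟨H.evalAt x⟩
  refine ⟨⟨e.invFun (Classical.arbitrary Y)⟩, fun x y => ?_⟩
  have := (PathConnectedSpace.joined (e.toFun x) (e.toFun y)).map e.invFun.continuous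
  exact (hj x).symm.trans (this.trans (hj y))

lemma sphere_real : Metric.sphere (0 : ℝ) 1 = {1, -1} := by
  ext x
  simp [abs_eq]

lemma discreteTopology_sphere_real : DiscreteTopology (Metric.sphere (0 : ℝ) 1) := by
  have : Finite (Metric.sphere (0 : ℝ) 1) := by rw [sphere_real]; infer_instance
  infer_instance

lemma mk_sphere_real : Cardinal.mk (Metric.sphere (0 : ℝ) 1) = 2 := by
  rw [sphere_real, Cardinal.mk_insert (by norm_num), Cardinal.mk_singleton, one_add_one_eq_two]

/-- The Betti numbers of a punctured Euclidean space, by iterated suspension. -/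
theorem bettiNumber_punctured (m : ℕ) : ∀ (E : Type) [NormedAddCommGroup E] [NormedSpace ℝ E],
    finrank ℝ E = m + 2 → ∀ i ≠ 0, bettiNumber ({0}ᶜ : Set E) i = if i = m + 1 then 1 else 0 := by
  induction m with
  | zero =>
    intro E _ _ hE i hi
    have : FiniteDimensional ℝ E := FiniteDimensional.of_finrank_pos (by omega)
    obtain ⟨e⟩ := FiniteDimensional.nonempty_continuousLinearEquiv_of_finrank_eq (𝕜 := ℝ) (E := E)
      (F := ℝ × ℝ) (by simp [hE])
    rw [bettiNumber_congr (puncturedHomeomorph e).toHomotopyEquiv]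
    obtain ⟨U, V, hU, hV, hUV, cU, cV, ⟨f⟩⟩ := exists_cover_punctured (F := ℝ)
    obtain ⟨f'⟩ := nonempty_punctured_homotopyEquiv_sphere ℝ
    have := discreteTopology_sphere_real
    have := pathConnectedSpace_punctured (E := ℝ × ℝ) (by simp)
    match i, hi with
    | 1, _ =>
      have := bettiNumber_one_add_one hU hV hUV (c := 1) (by
        rw [bettiNumber_congr (f.trans f'), bettiNumber_zero_of_discrete, mk_sphere_real]
        norm_num)
      simpa using this
    | j + 2, _ =>
      rw [bettiNumber_succ_of_contractible hU hV hUV (Nat.succ_ne_zero j),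
        bettiNumber_congr (f.trans f'), bettiNumber_of_discrete _ (Nat.succ_ne_zero j), if_neg]
      omega
  | succ m ih =>
    intro E _ _ hE i hi
    have : FiniteDimensional ℝ E := FiniteDimensional.of_finrank_pos (by omega)
    obtain ⟨e⟩ := FiniteDimensional.nonempty_continuousLinearEquiv_of_finrank_eq (𝕜 := ℝ) (E := E)
      (F := ℝ × (Fin (m + 2) → ℝ)) (by simp [hE]; omega)
    rw [bettiNumber_congr (puncturedHomeomorph e).toHomotopyEquiv]
    obtain ⟨U, V, hU, hV, hUV, cU, cV, ⟨f⟩⟩ := exists_cover_punctured (F := Fin (m + 2) → ℝ)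
    match i, hi with
    | 1, _ =>
      have := pathConnectedSpace_punctured (E := Fin (m + 2) → ℝ) (by simp)
      have := pathConnectedSpace_of_homotopyEquiv f
      rw [bettiNumber_one_of_pathConnected_inter hU hV hUV, if_neg]
      omega
    | j + 2, _ =>
      rw [bettiNumber_succ_of_contractible hU hV hUV (Nat.succ_ne_zero j),
        bettiNumber_congr f, ih _ (by simp) _ (Nat.succ_ne_zero j)]
      simp

theorem bettiNumber_unitSphere {m i : ℕ} (hm : m ≠ 0) (hi : i ≠ 0) :
    bettiNumber (UnitSphere m) i = if i = m then 1 else 0 := by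
  obtain ⟨m, rfl⟩ := Nat.exists_eq_succ_of_ne_zero hm
  obtain ⟨e⟩ := nonempty_punctured_homotopyEquiv_sphere (EuclideanSpace ℝ (Fin (m + 1 + 1)))
  rw [← bettiNumber_congr e, bettiNumber_punctured m _ (by simp) i hi]

end SphereBetti

/-! ### Bouquets of spheres -/

section Bouquet

open Set Topology Module

lemma pathConnectedSpace_unitSphere {m : ℕ} (hm : m ≠ 0) : PathConnectedSpace (UnitSphere m) := by
  refine isPathConnected_iff_pathConnectedSpace.1 (isPathConnected_sphere
    (lt_rank_of_lt_finrank ?_) 0 zero_le_one)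
  simp; omega

lemma unitSphere_zero_apply (x : UnitSphere 0) : x.1 0 = 1 ∨ x.1 0 = -1 := by
  have h := norm_eq_of_mem_sphere x
  have h' : ‖x.1‖ = |x.1 0| := by
    rw [EuclideanSpace.norm_eq]
    exact (congrArg Real.sqrt (Fin.sum_univ_one _)).trans (by simp [Real.sqrt_sq_eq_abs])
  exact (abs_eq zero_le_one).1 (h'.symm.trans h)

/-- The antipode of the base point of `S⁰`. -/
noncomputable def UnitSphere.zeroAntipode : UnitSphere 0 :=
  ⟨-EuclideanSpace.single 0 1, by simp⟩

lemma unitSphere_zero_eq (x : UnitSphere 0) :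
    x = UnitSphere.base 0 ∨ x = UnitSphere.zeroAntipode := by
  refine (unitSphere_zero_apply x).imp (fun h => ?_) (fun h => ?_)
  · refine Subtype.ext (PiLp.ext fun i => ?_)
    rw [Fin.fin_one_eq_zero i, h]; simp [UnitSphere.base]
  · refine Subtype.ext (PiLp.ext fun i => ?_)
    rw [Fin.fin_one_eq_zero i, h]; simp [UnitSphere.zeroAntipode]

instance : Finite (UnitSphere 0) :=
  Finite.of_surjective (fun b : Bool => if b then UnitSphere.base 0 else UnitSphere.zeroAntipode)
    fun x => (unitSphere_zero_eq x).elim (fun h => ⟨true, by simp [h]⟩)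
      (fun h => ⟨false, by simp [h]⟩)

/-- The bouquet of `g` copies of `Sᵐ` as a subspace of the product: at most one coordinate
differs from the base point. -/
def bouquet (g m : ℕ) : Set (Fin g → UnitSphere m) :=
  {f | ∀ i j, f i ≠ UnitSphere.base m → f j ≠ UnitSphere.base m → i = j}

/-- The base point of the bouquet. -/
noncomputable def bouquetBase (g m : ℕ) : bouquet g m :=
  ⟨fun _ => UnitSphere.base m, fun _ _ h => absurd rfl h⟩

/-- The inclusion of a sphere in the bouquet. -/
noncomputable def bouquetIncl {g m : ℕ} (i : Fin g) (x : UnitSphere m) : bouquet g m :=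
  ⟨Function.update (fun _ => UnitSphere.base m) i x, fun j k hj hk => by
    by_cases h : j = i
    · by_cases h' : k = i
      · rw [h, h']
      · simp [h'] at hk
    · simp [h] at hj⟩

lemma continuous_bouquetIncl {g m : ℕ} (i : Fin g) :
    Continuous (bouquetIncl i : UnitSphere m → bouquet g m) := by
  unfold bouquetIncl
  exact Continuous.subtype_mk (Continuous.update (A := fun _ : Fin g => UnitSphere m)
    continuous_const i continuous_id) _

lemma bouquetIncl_base {g m : ℕ} (i : Fin g) :
    bouquetIncl i (UnitSphere.base m) = bouquetBase g m :=
  Subtype.ext (Function.update_eq_self i _)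

lemma bouquetIncl_eq {g m : ℕ} (f : bouquet g m) {i : Fin g} (h : f.1 i ≠ UnitSphere.base m) :
    f = bouquetIncl i (f.1 i) := by
  refine Subtype.ext (funext fun j => ?_)
  by_cases hj : j = i
  · subst hj; simp [bouquetIncl]
  · simp only [bouquetIncl, Function.update_of_ne hj]
    by_contra h'
    exact hj (f.2 j i h' h)

lemma eq_bouquetBase_or {g m : ℕ} (f : bouquet g m) :
    f = bouquetBase g m ∨ ∃ i, f.1 i ≠ UnitSphere.base m ∧ f = bouquetIncl i (f.1 i) := by
  by_cases h : ∃ i, f.1 i ≠ UnitSphere.base m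
  · obtain ⟨i, hi⟩ := h
    exact Or.inr ⟨i, hi, bouquetIncl_eq f hi⟩
  · push Not at h
    exact Or.inl (Subtype.ext (funext h))

lemma pathConnectedSpace_bouquet {g m : ℕ} (hm : m ≠ 0) : PathConnectedSpace (bouquet g m) := by
  have := pathConnectedSpace_unitSphere hm
  have key : ∀ f : bouquet g m, Joined (bouquetBase g m) f := by
    intro f
    rcases eq_bouquetBase_or f with h | ⟨i, -, h⟩
    · rw [h]
    · rw [h, ← bouquetIncl_base i]
      exact (PathConnectedSpace.joined _ _).map (continuous_bouquetIncl i)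
  exact ⟨⟨bouquetBase g m⟩, fun f f' => (key f).symm.trans (key f')⟩

lemma isHomotopyHomogeneous_of_pathConnectedSpace (X : Type*) [TopologicalSpace X]
    [PathConnectedSpace X] : IsHomotopyHomogeneous X :=
  fun _ _ => ⟨.refl X, PathConnectedSpace.joined _ _⟩

lemma isHomotopyHomogeneous_of_discreteTopology (X : Type*) [TopologicalSpace X]
    [DiscreteTopology X] : IsHomotopyHomogeneous X := by
  classical
  intro x y
  refine ⟨(Homeomorph.mk (Equiv.swap x y) continuous_of_discreteTopology
    continuous_of_discreteTopology).toHomotopyEquiv, ?_⟩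
  have : (Homeomorph.mk (Equiv.swap x y) continuous_of_discreteTopology
    continuous_of_discreteTopology).toHomotopyEquiv x = y := Equiv.swap_apply_left x y
  rw [this]

lemma isHomotopyHomogeneous_unitSphere (m : ℕ) : IsHomotopyHomogeneous (UnitSphere m) := by
  rcases eq_or_ne m 0 with rfl | hm
  · exact isHomotopyHomogeneous_of_discreteTopology _
  · have := pathConnectedSpace_unitSphere hm
    exact isHomotopyHomogeneous_of_pathConnectedSpace _

lemma isHomotopyHomogeneous_bouquet (g m : ℕ) : IsHomotopyHomogeneous (bouquet g m) := by
  rcases eq_or_ne m 0 with rfl | hm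
  · exact isHomotopyHomogeneous_of_discreteTopology _
  · have := pathConnectedSpace_bouquet (g := g) hm
    exact isHomotopyHomogeneous_of_pathConnectedSpace _

/-- Adding a sphere to the bouquet. -/
def pairWedgeBouquetHomeomorph (g m : ℕ) :
    pairWedge (bouquet g m) (bouquetBase g m) (UnitSphere m) (UnitSphere.base m) ≃ₜ
      bouquet (g + 1) m where
  toFun z := ⟨Fin.cons z.1.2 z.1.1.1, by
    obtain ⟨⟨f, x⟩, h⟩ := z
    rcases h with h | h
    · dsimp only at h
      subst h
      intro i j hi hj
      induction i using Fin.cases with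
      | zero =>
        induction j using Fin.cases with
        | zero => rfl
        | succ j => simp [bouquetBase] at hj
      | succ i => simp [bouquetBase] at hi
    · dsimp only at h
      subst h
      intro i j hi hj
      induction i using Fin.cases with
      | zero => simp at hi
      | succ i =>
        induction j using Fin.cases with
        | zero => simp at hj
        | succ j => simp at hi hj; rw [f.2 i j hi hj]⟩
  invFun f := ⟨(⟨fun i => f.1 i.succ, fun i j hi hj =>
    Fin.succ_injective _ (f.2 _ _ hi hj)⟩, f.1 0),
    by
      by_cases h : f.1 0 = UnitSphere.base m
      · exact Or.inr h
      · refine Or.inl (Subtype.ext (funext fun i => ?_))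
        by_contra h'
        exact Fin.succ_ne_zero i (f.2 _ _ h' h)⟩
  left_inv z := by ext <;> simp
  right_inv f := Subtype.ext (funext fun i => by
    induction i using Fin.cases <;> simp)
  continuous_toFun := Continuous.subtype_mk (Continuous.finCons (by fun_prop) (by fun_prop)) _
  continuous_invFun := Continuous.subtype_mk (Continuous.prodMk
    (Continuous.subtype_mk (continuous_pi fun i => (continuous_apply i.succ).comp
      continuous_subtype_val) _) ((continuous_apply 0).comp continuous_subtype_val)) _

/-- A neighbourhood of the base point of the sphere contracts to it in the sphere. The homotopy is
the radial projection to the sphere of `(1 - u χ) x + u χ b`, where `χ` is `1` near the base point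
`b` and `0` far away. -/
lemma exists_contraction_near_base (m : ℕ) : ∃ (r : C(UnitSphere m, ℝ))
    (ρ : unitInterval → UnitSphere m → UnitSphere m), (∀ y, r y ∈ Icc (0 : ℝ) 1) ∧
    r (UnitSphere.base m) = 0 ∧ (Continuous fun p : unitInterval × UnitSphere m => ρ p.1 p.2) ∧
    (∀ y, ρ 0 y = y) ∧ (∀ u, ρ u (UnitSphere.base m) = UnitSphere.base m) ∧
    (∀ y, r y < 1 → ρ 1 y = UnitSphere.base m) := by
  set b := UnitSphere.base m
  let χ : UnitSphere m → ℝ := fun x => clampUnit (2 - 2 * ‖x.1 - b.1‖)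
  have hχc : Continuous χ := by fun_prop
  let v : unitInterval → UnitSphere m → EuclideanSpace ℝ (Fin (m + 1)) := fun u x =>
    (1 - u * χ x : ℝ) • x.1 + (u * χ x : ℝ) • b.1
  have hvc : Continuous fun p : unitInterval × UnitSphere m => v p.1 p.2 := by fun_prop
  have hn : ∀ x : UnitSphere m, ‖x.1‖ = 1 := fun x => norm_eq_of_mem_sphere x
  have hv : ∀ u x, v u x ≠ 0 := by
    intro u x h
    have hχ := clampUnit_mem (2 - 2 * ‖x.1 - b.1‖)
    have h0 : 0 ≤ (u * χ x : ℝ) := mul_nonneg u.2.1 hχ.1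
    have h1 : (u * χ x : ℝ) ≤ 1 := mul_le_one₀ u.2.2 hχ.1 hχ.2
    have e1 : (1 - u * χ x : ℝ) • x.1 = -((u * χ x : ℝ) • b.1) := eq_neg_of_add_eq_zero_left h
    have e2 := congrArg norm e1
    rw [norm_neg, norm_smul, norm_smul, hn, hn, Real.norm_of_nonneg h0,
      Real.norm_of_nonneg (by linarith), mul_one, mul_one] at e2
    have e3 : (u * χ x : ℝ) = 1 / 2 := by linarith
    rw [e3] at e1
    have e4 : x.1 = -b.1 := by
      have e5 : (1 - 1 / 2 : ℝ) = 1 / 2 := by norm_num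
      rw [e5, ← smul_neg] at e1
      exact smul_right_injective _ (by norm_num : (1 / 2 : ℝ) ≠ 0) e1
    have e6 : ‖x.1 - b.1‖ = 2 := by
      rw [e4, ← neg_add', norm_neg, ← two_smul ℝ b.1, norm_smul, hn]; norm_num
    have e7 : χ x = 0 := by
      simp only [χ]
      rw [e6, clampUnit_of_le_zero (by norm_num)]
    rw [e7] at e3
    norm_num at e3
  have hmem : ∀ u x, (‖v u x‖⁻¹ • v u x) ∈
      Metric.sphere (0 : EuclideanSpace ℝ (Fin (m + 1))) 1 := by
    intro u x
    rw [mem_sphere_zero_iff_norm, norm_smul, norm_inv, norm_norm,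
      inv_mul_cancel₀ (norm_ne_zero_iff.2 (hv u x))]
  refine ⟨⟨fun x => clampUnit (2 * ‖x.1 - b.1‖), by fun_prop⟩, fun u x => ⟨_, hmem u x⟩,
    fun y => clampUnit_mem _, ?_, ?_, ?_, ?_, ?_⟩
  · simp [clampUnit_of_le_zero]
  · refine Continuous.subtype_mk (Continuous.smul (hvc.norm.inv₀ fun p => ?_) hvc) _
    exact norm_ne_zero_iff.2 (hv _ _)
  · intro x
    refine Subtype.ext ?_
    simp [v, hn]
  · intro u
    refine Subtype.ext ?_
    have : v u b = b.1 := by simp only [v]; rw [← add_smul]; simp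
    simp only [this, hn]; simp
  · intro x hx
    refine Subtype.ext ?_
    have h1 : 2 * ‖x.1 - b.1‖ < 1 := by
      by_contra h
      rw [ContinuousMap.coe_mk, clampUnit_of_one_le (not_lt.1 h)] at hx
      exact lt_irrefl _ hx
    have h2 : χ x = 1 := clampUnit_of_one_le (by linarith)
    have : v 1 x = b.1 := by simp [v, h2]
    simp only [this, hn]; simp

/-- Attaching a homotopy sphere along a contractible intersection adds a sphere to a bouquet. -/
theorem nonempty_union_homotopyEquiv_bouquet {Z : Type*} [MetricSpace Z] {X B : Set Z} {g m : ℕ}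
    (hX : IsOpen X) (hB : IsOpen B) {t : Z}
    (ht : t ∈ X) (ht' : t ∈ B) (K : ℝ → Z → Z)
    (hK : ContinuousOn (fun p : ℝ × Z => K p.1 p.2) (Icc 0 1 ×ˢ (X ∩ B)))
    (hKT : ∀ u ∈ Icc (0 : ℝ) 1, ∀ z ∈ X ∩ B, K u z ∈ X ∩ B)
    (hK0 : ∀ z ∈ X ∩ B, K 0 z = z) (hK1 : ∀ z ∈ X ∩ B, K 1 z = t)
    (hKt : ∀ u ∈ Icc (0 : ℝ) 1, K u t = t)
    (eX : Nonempty (X ≃ₕ bouquet g m)) (eB : Nonempty (B ≃ₕ UnitSphere m)) :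
    Nonempty (↥(X ∪ B) ≃ₕ bouquet (g + 1) m) := by
  obtain ⟨e1⟩ := nonempty_union_homotopyEquiv_bridgeSum hX hB ht ht' K hK hKT hK0 hK1 hKt
  obtain ⟨eX⟩ := eX
  obtain ⟨eB⟩ := eB
  obtain ⟨e2⟩ := nonempty_bridgeSum_homotopyEquiv_both eX eB (isHomotopyHomogeneous_bouquet g m)
    (isHomotopyHomogeneous_unitSphere m) ⟨t, ht⟩ (bouquetBase g m) ⟨t, ht'⟩ (UnitSphere.base m)
  obtain ⟨r, ρ, h1, h2, h3, h4, h5, h6⟩ := exists_contraction_near_base m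
  obtain ⟨e3⟩ := nonempty_bridgeSum_homotopyEquiv_pairWedge (bouquetBase g m) r h1 h2 ρ h3 h4 h5 h6
  exact ⟨((e1.trans e2).trans e3).trans (pairWedgeBouquetHomeomorph g m).toHomotopyEquiv⟩

/-- The quotient space and the subspace of the product are homeomorphic. -/
theorem nonempty_sphereBouquet_homeomorph (g m : ℕ) :
    Nonempty (SphereBouquet g m ≃ₜ bouquet g m) := by
  have hcomp : CompactSpace (SphereBouquet g m) :=
    inferInstanceAs (CompactSpace (Quot (WedgeRel (fun _ : Fin g => UnitSphere m)
      (fun _ => UnitSphere.base m))))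
  let f : Unit ⊕ (Σ _ : Fin g, UnitSphere m) → bouquet g m :=
    Sum.elim (fun _ => bouquetBase g m) fun z => bouquetIncl z.1 z.2
  have hf : Continuous f := continuous_sumElim.2 ⟨continuous_const,
    continuous_sigma fun i => continuous_bouquetIncl i⟩
  have hrel : ∀ a b, WedgeRel (fun _ : Fin g => UnitSphere m) (fun _ => UnitSphere.base m) a b →
      f a = f b := by
    rintro _ _ ⟨i⟩
    exact (bouquetIncl_base i).symm
  let F : SphereBouquet g m → bouquet g m := Quot.lift f hrel
  have hF : Continuous F := continuous_quot_lift hrel hf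
  have hbase : ∀ z : Unit ⊕ (Σ _ : Fin g, UnitSphere m), f z = bouquetBase g m →
      (Quot.mk _ z : SphereBouquet g m) = Quot.mk _ (Sum.inl ()) := by
    rintro (_ | ⟨i, x⟩) h
    · rfl
    · have : x = UnitSphere.base m := by
        have := congrArg (fun f : bouquet g m => f.1 i) h
        simpa [f, bouquetIncl, bouquetBase] using this
      subst this
      exact (Quot.sound (WedgeRel.glue i)).symm
  have hinj : Function.Injective F := by
    rintro ⟨a⟩ ⟨b⟩ (h : f a = f b)
    by_cases hb : f b = bouquetBase g m
    · exact (hbase a (h.trans hb)).trans (hbase b hb).symm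
    · have ha : f a ≠ bouquetBase g m := h ▸ hb
      rcases a with _ | ⟨i, x⟩
      · exact absurd rfl ha
      rcases b with _ | ⟨j, y⟩
      · exact absurd rfl hb
      have hx : x ≠ UnitSphere.base m := fun hx => ha (by
        subst hx; exact bouquetIncl_base i)
      have hij : i = j := by
        by_contra hij
        have := congrArg (fun f : bouquet g m => f.1 i) h
        simp [f, bouquetIncl, hij] at this
        exact hx this
      subst hij
      have := congrArg (fun f : bouquet g m => f.1 i) h
      simp only [f, bouquetIncl, Sum.elim_inr, Function.update_self] at this
      rw [this]
  have hsurj : Function.Surjective F := by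
    intro z
    rcases eq_bouquetBase_or z with h | ⟨i, -, h⟩
    · exact ⟨Quot.mk _ (Sum.inl ()), h.symm⟩
    · exact ⟨Quot.mk _ (Sum.inr ⟨i, z.1 i⟩), h.symm⟩
  exact ⟨Continuous.homeoOfEquivCompactToT2 (f := Equiv.ofBijective F ⟨hinj, hsurj⟩) hF⟩

end Bouquet

section BouquetBetti

open Set Topology

/-- Betti numbers in positive degree of two spaces joined by an interval. -/
theorem bettiNumber_bridgeSum {X B : Type} [TopologicalSpace X] [TopologicalSpace B] (x : X) (b : B)
    {i : ℕ} (hi : i ≠ 0) :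
    bettiNumber (bridgeSum X x B b) i = bettiNumber X i + bettiNumber B i := by
  let U : Set (bridgeSum X x B b) := {z | z.1.2.1 < 2 / 3}
  let V : Set (bridgeSum X x B b) := {z | 1 / 3 < z.1.2.1}
  have hU : IsOpen U := isOpen_lt (by fun_prop) (by fun_prop)
  have hV : IsOpen V := isOpen_lt (by fun_prop) (by fun_prop)
  have hUV : U ∪ V = univ := by
    ext z
    simp only [U, V, mem_union, mem_ofPred_eq, mem_univ, iff_true]
    rcases lt_or_ge z.1.2.1 (2 / 3) with h | h
    · exact Or.inl h
    · exact Or.inr (by linarith)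
  have hUb : ∀ z : U, z.1.1.2.2 = b := fun z => z.1.2.2.2.resolve_left (by
    have : z.1.1.2.1 < 2 / 3 := z.2
    linarith)
  have hVx : ∀ z : V, z.1.1.1 = x := fun z => z.1.2.2.1.resolve_left (by
    have : 1 / 3 < z.1.1.2.1 := z.2
    linarith)
  have eU : U ≃ₕ X := by
    refine ⟨⟨fun z => z.1.1.1, by fun_prop⟩, ⟨fun y => ⟨⟨(y, 0, b), by simp [bridgeSum]⟩,
      by simp [U]⟩, by fun_prop⟩, ?_, .refl _⟩
    refine homotopic_of_continuous (fun u z => ⟨⟨(z.1.1.1, u * z.1.1.2.1, b),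
      ⟨mul_nonneg u.2.1 z.1.2.1.1, mul_le_one₀ u.2.2 z.1.2.1.1 z.1.2.1.2⟩,
      z.1.2.2.1.imp (fun h => by dsimp only; rw [h, mul_zero]) id, Or.inr rfl⟩, ?_⟩) ?_ ?_ ?_
    · have h1 : z.1.1.2.1 < 2 / 3 := z.2
      have h2 := mul_le_of_le_one_left z.1.2.1.1 u.2.2
      exact lt_of_le_of_lt h2 h1
    · fun_prop
    · intro z
      refine Subtype.ext (Subtype.ext (Prod.ext rfl (Prod.ext ?_ rfl)))
      simp
    · intro z
      refine Subtype.ext (Subtype.ext (Prod.ext rfl (Prod.ext ?_ (hUb z).symm)))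
      simp
  have eV : V ≃ₕ B := by
    refine ⟨⟨fun z => z.1.1.2.2, by fun_prop⟩, ⟨fun y => ⟨⟨(x, 1, y), by simp [bridgeSum]⟩,
      by simp only [V, mem_ofPred_eq]; norm_num⟩, by fun_prop⟩, ?_, .refl _⟩
    have hm : ∀ (u : unitInterval) (z : V), (1 - u * (1 - z.1.1.2.1) : ℝ) ∈ Icc (z.1.1.2.1) 1 := by
      intro u z
      have h1 := mul_nonneg u.2.1 (sub_nonneg.2 z.1.2.1.2)
      have h2 := mul_le_of_le_one_left (sub_nonneg.2 z.1.2.1.2) u.2.2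
      exact ⟨by linarith, by linarith⟩
    refine homotopic_of_continuous (fun u z => ⟨⟨(x, 1 - u * (1 - z.1.1.2.1), z.1.1.2.2),
      ⟨z.1.2.1.1.trans (hm u z).1, (hm u z).2⟩, Or.inr rfl,
      z.1.2.2.2.imp (fun h => by dsimp only; rw [h]; ring) id⟩, ?_⟩) ?_ ?_ ?_
    · have h1 : 1 / 3 < z.1.1.2.1 := z.2
      exact lt_of_lt_of_le h1 (hm u z).1
    · fun_prop
    · intro z
      refine Subtype.ext (Subtype.ext (Prod.ext rfl (Prod.ext ?_ rfl)))
      simp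
    · intro z
      refine Subtype.ext (Subtype.ext (Prod.ext (hVx z).symm (Prod.ext ?_ rfl)))
      simp
  have hc : ContractibleSpace ↥(U ∩ V) := by
    have : ContractibleSpace (Ioo (1 / 3 : ℝ) (2 / 3)) :=
      (convex_Ioo _ _).contractibleSpace ⟨1 / 2, by norm_num⟩
    refine Homeomorph.contractibleSpace (Y := Ioo (1 / 3 : ℝ) (2 / 3))
      ⟨⟨fun z => ⟨z.1.1.2.1, z.2.2, z.2.1⟩, fun s => ⟨⟨(x, s, b),
        ⟨by linarith [s.2.1], by linarith [s.2.2]⟩, Or.inr rfl, Or.inr rfl⟩, s.2.2, s.2.1⟩, ?_, ?_⟩,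
        by fun_prop, by fun_prop⟩
    · intro z
      exact Subtype.ext (Subtype.ext (Prod.ext (hVx ⟨z.1, z.2.2⟩).symm
        (Prod.ext rfl (hUb ⟨z.1, z.2.1⟩).symm)))
    · intro s; rfl
  rw [bettiNumber_of_contractible_inter hU hV hUV hi, bettiNumber_congr eU, bettiNumber_congr eV]

theorem bettiNumber_bouquet {m i : ℕ} (hm : m ≠ 0) (hi : i ≠ 0) (g : ℕ) :
    bettiNumber (bouquet g m) i = if i = m then (g : Cardinal) else 0 := by
  induction g with
  | zero =>
    have h : Unique (bouquet 0 m) := ⟨⟨bouquetBase 0 m⟩, fun f =>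
      Subtype.ext (Subsingleton.elim _ _)⟩
    have : DiscreteTopology (bouquet 0 m) := inferInstance
    rw [bettiNumber_of_discrete _ hi]; simp
  | succ g ih =>
    obtain ⟨r, ρ, h1, h2, h3, h4, h5, h6⟩ := exists_contraction_near_base m
    obtain ⟨e3⟩ :=
      nonempty_bridgeSum_homotopyEquiv_pairWedge (bouquetBase g m) r h1 h2 ρ h3 h4 h5 h6
    rw [← bettiNumber_congr (pairWedgeBouquetHomeomorph g m).toHomotopyEquiv,
      ← bettiNumber_congr e3, bettiNumber_bridgeSum _ _ hi, ih, bettiNumber_unitSphere hm hi]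
    split_ifs <;> simp

end BouquetBetti

/-! ### Minimal cell structures -/

section CellStructure

open Set Topology Metric

/-- A finite discrete space with its points as cells. -/
@[reducible]
def discreteCWComplex (Y : Type) [TopologicalSpace Y] [Finite Y] :
    CWComplex (univ : Set Y) :=
  CWComplex.mkFinite univ
    (cell := fun n => match n with
      | 0 => Y
      | _ + 1 => PEmpty)
    (map := fun n => match n with
      | 0 => fun y => PartialEquiv.single 0 y
      | _ + 1 => PEmpty.elim)
    (eventually_isEmpty_cell := by
      filter_upwards [Filter.eventually_gt_atTop 0] with n hn
      obtain ⟨n, rfl⟩ := Nat.exists_eq_succ_of_ne_zero hn.ne'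
      exact inferInstanceAs (IsEmpty PEmpty))
    (finite_cell := fun n => match n with
      | 0 => inferInstanceAs (Finite Y)
      | _ + 1 => inferInstanceAs (Finite PEmpty))
    (source_eq := by
      rintro (_ | n) i
      · ext x
        simp [PartialEquiv.single, Subsingleton.elim x 0]
      · exact i.elim)
    (continuousOn := by
      rintro (_ | n) i
      · exact continuousOn_const
      · exact i.elim)
    (continuousOn_symm := by
      rintro (_ | n) i
      · exact continuousOn_const
      · exact i.elim)
    (pairwiseDisjoint' := by
      rintro ⟨_ | n, i⟩ - ⟨_ | n', j⟩ - h
      · refine disjoint_left.2 ?_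
        rintro _ ⟨_, -, rfl⟩ ⟨_, -, h'⟩
        exact h (by rw [show j = i from h'])
      · exact j.elim
      · exact i.elim
      · exact i.elim)
    (mapsTo_iff_image_subset := by
      rintro (_ | n) i
      · intro x hx
        have h := mem_sphere_zero_iff_norm.1 hx
        rw [Subsingleton.elim x 0, norm_zero] at h
        exact absurd h zero_ne_one
      · exact i.elim)
    (union' := by
      refine eq_univ_of_forall fun y => mem_iUnion.2 ⟨0, mem_iUnion.2 ⟨y, 0, by simp, rfl⟩⟩)

theorem isMinimalSpace_of_finite_discrete {X Y : Type} [TopologicalSpace X] [TopologicalSpace Y]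
    [DiscreteTopology Y] [Finite Y] (e : Nonempty (X ≃ₕ Y)) : IsMinimalSpace X := by
  refine ⟨Y, inferInstance, inferInstance, discreteCWComplex Y, e, ?_⟩
  rintro (_ | i)
  · exact ⟨inferInstanceAs (Finite Y), (bettiNumber_zero_of_discrete Y).symm⟩
  · refine ⟨inferInstanceAs (Finite PEmpty), ?_⟩
    rw [bettiNumber_of_discrete Y (Nat.succ_ne_zero i)]
    exact Cardinal.mk_eq_zero PEmpty

/-- The stereographic projection from the base point, with values in the model of the cells. -/
noncomputable def sphereChart (m : ℕ) : OpenPartialHomeomorph (UnitSphere m) (Fin m → ℝ) :=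
  haveI : Fact (Module.finrank ℝ (EuclideanSpace ℝ (Fin (m + 1))) = m + 1) := ⟨by simp⟩
  (stereographic' m (UnitSphere.base m)).transHomeomorph
    (EuclideanSpace.equiv (Fin m) ℝ).toHomeomorph

lemma sphereChart_source (m : ℕ) : (sphereChart m).source = {UnitSphere.base m}ᶜ := by
  simp [sphereChart]

lemma sphereChart_target (m : ℕ) : (sphereChart m).target = univ := by
  simp [sphereChart]

open Classical in
/-- The characteristic map of the top cell of the sphere: the open cube is expanded to the whole
space and its boundary is sent to the base point. -/
noncomputable def sphereCell (m : ℕ) (x : Fin m → ℝ) : UnitSphere m :=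
  if ‖x‖ < 1 then (sphereChart m).symm ((1 - ‖x‖)⁻¹ • x) else UnitSphere.base m

lemma sphereCell_ne_base {m : ℕ} {x : Fin m → ℝ} (hx : ‖x‖ < 1) :
    sphereCell m x ≠ UnitSphere.base m := by
  rw [sphereCell, if_pos hx]
  have := (sphereChart m).map_target (x := (1 - ‖x‖)⁻¹ • x) (by rw [sphereChart_target]; trivial)
  rwa [sphereChart_source] at this

lemma continuous_sphereCell (m : ℕ) : Continuous (sphereCell m) := by
  rw [continuous_iff_continuousAt]
  intro x
  have hsymm : Continuous (sphereChart m).symm := by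
    rw [← continuousOn_univ, ← sphereChart_target m]
    exact (sphereChart m).continuousOn_symm
  rcases lt_or_ge ‖x‖ 1 with hx | hx
  · have h1 : ContinuousAt (fun x : Fin m → ℝ => (sphereChart m).symm ((1 - ‖x‖)⁻¹ • x)) x := by
      have h2 : ContinuousAt (fun x : Fin m → ℝ => (1 - ‖x‖)⁻¹) x :=
        ContinuousAt.inv₀ (by fun_prop) (by linarith)
      exact hsymm.continuousAt.comp (h2.smul continuousAt_id)
    refine h1.congr ?_
    filter_upwards [(isOpen_lt continuous_norm continuous_const).mem_nhds hx] with y hy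
    rw [sphereCell, if_pos hy]
  · -- a neighbourhood of the base point contains the image of the complement of a ball
    have hb : sphereCell m x = UnitSphere.base m := if_neg (not_lt.2 hx)
    rw [ContinuousAt, hb]
    intro N hN
    obtain ⟨O, hON, hO, hbO⟩ := _root_.mem_nhds_iff.1 hN
    have hcomp : IsCompact (sphereChart m '' Oᶜ) := by
      refine hO.isClosed_compl.isCompact.image_of_continuousOn
        ((sphereChart m).continuousOn.mono ?_)
      rw [sphereChart_source]
      exact fun y hy hyb => hy (by rw [mem_singleton_iff.1 hyb]; exact hbO)
    obtain ⟨R, hR⟩ := hcomp.isBounded.exists_norm_le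
    have hev : ∀ᶠ y : Fin m → ℝ in 𝓝 x, R * (1 - ‖y‖) < ‖y‖ ∨ 1 ≤ ‖y‖ := by
      by_cases hR0 : 0 ≤ R
      · have h0 : R * (1 - ‖x‖) < ‖x‖ := by nlinarith
        filter_upwards [(isOpen_lt (f := fun y : Fin m → ℝ => R * (1 - ‖y‖)) (by fun_prop)
          continuous_norm).mem_nhds h0] with y hy using Or.inl hy
      · refine Filter.Eventually.of_forall fun y => ?_
        rcases lt_or_ge ‖y‖ 1 with h | h
        · exact Or.inl (by nlinarith [norm_nonneg y])
        · exact Or.inr h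
    change ∀ᶠ y in 𝓝 x, sphereCell m y ∈ N
    filter_upwards [hev] with y hy
    refine hON ?_
    rw [sphereCell]
    split_ifs with h
    · by_contra hyO
      have h1 := hR _ (mem_image_of_mem (sphereChart m) hyO)
      rw [(sphereChart m).right_inv (by rw [sphereChart_target]; trivial), norm_smul, norm_inv,
        Real.norm_of_nonneg (by linarith), inv_mul_le_iff₀ (by linarith)] at h1
      rcases hy with hy | hy <;> linarith
    · exact hbO

/-- The inverse of the characteristic map on the open cell. -/
noncomputable def sphereCellInv (m : ℕ) (s : UnitSphere m) : Fin m → ℝ :=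
  (1 + ‖sphereChart m s‖)⁻¹ • sphereChart m s

lemma norm_sphereCellInv_lt (m : ℕ) (s : UnitSphere m) : ‖sphereCellInv m s‖ < 1 := by
  have h : 0 < 1 + ‖sphereChart m s‖ := by positivity
  rw [sphereCellInv, norm_smul, norm_inv, Real.norm_of_nonneg h.le, inv_mul_lt_iff₀ h]
  linarith

lemma sphereCellInv_sphereCell {m : ℕ} {x : Fin m → ℝ} (hx : ‖x‖ < 1) :
    sphereCellInv m (sphereCell m x) = x := by
  have h1 : 0 < 1 - ‖x‖ := by linarith
  rw [sphereCellInv, sphereCell, if_pos hx,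
    (sphereChart m).right_inv (by rw [sphereChart_target]; trivial), norm_smul, norm_inv,
    Real.norm_of_nonneg h1.le, smul_smul]
  have : (1 + (1 - ‖x‖)⁻¹ * ‖x‖)⁻¹ * (1 - ‖x‖)⁻¹ = 1 := by
    field_simp
    ring
  rw [this, one_smul]

lemma sphereCell_sphereCellInv {m : ℕ} {s : UnitSphere m} (hs : s ≠ UnitSphere.base m) :
    sphereCell m (sphereCellInv m s) = s := by
  have h : 0 < 1 + ‖sphereChart m s‖ := by positivity
  rw [sphereCell, if_pos (norm_sphereCellInv_lt m s)]
  have : (1 - ‖sphereCellInv m s‖)⁻¹ • sphereCellInv m s = sphereChart m s := by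
    rw [sphereCellInv, norm_smul, norm_inv, Real.norm_of_nonneg h.le, smul_smul]
    have : (1 - (1 + ‖sphereChart m s‖)⁻¹ * ‖sphereChart m s‖)⁻¹ *
        (1 + ‖sphereChart m s‖)⁻¹ = 1 := by
      rw [← mul_inv, inv_eq_one]
      field_simp
      ring
    rw [this, one_smul]
  rw [this, (sphereChart m).left_inv (by rw [sphereChart_source]; exact hs)]

/-- The characteristic map of a top cell of the bouquet. -/
noncomputable def bouquetCell {g m : ℕ} (j : Fin g) : PartialEquiv (Fin m → ℝ) (bouquet g m) where
  toFun x := bouquetIncl j (sphereCell m x)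
  invFun f := sphereCellInv m (f.1 j)
  source := ball 0 1
  target := {f | f.1 j ≠ UnitSphere.base m}
  map_source' x hx := by
    simpa [bouquetIncl] using sphereCell_ne_base (mem_ball_zero_iff.1 hx)
  map_target' f _ := mem_ball_zero_iff.2 (norm_sphereCellInv_lt m _)
  left_inv' x hx := by
    simpa [bouquetIncl] using sphereCellInv_sphereCell (mem_ball_zero_iff.1 hx)
  right_inv' f hf := by
    rw [sphereCell_sphereCellInv hf, ← bouquetIncl_eq f hf]

lemma bouquetCell_of_sphere {g m : ℕ} (j : Fin g) {x : Fin m → ℝ} (hx : ‖x‖ = 1) :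
    bouquetCell (g := g) j x = bouquetBase g m := by
  change bouquetIncl j (sphereCell m x) = _
  rw [sphereCell, if_neg (by rw [hx]; exact lt_irrefl 1), bouquetIncl_base]

/-- The cell structure of the bouquet with one `0`-cell and `g` cells of dimension `k + 1`. -/
@[reducible]
noncomputable def bouquetCWComplex (g k : ℕ) : CWComplex (univ : Set (bouquet g (k + 1))) :=
  CWComplex.mkFinite univ
    (cell := fun n => match n with
      | 0 => Unit
      | n + 1 => {_j : Fin g // n = k})
    (map := fun n => match n with
      | 0 => fun _ => PartialEquiv.single 0 (bouquetBase g (k + 1))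
      | n + 1 => fun j => by
        have h := j.2
        subst h
        exact bouquetCell j.1)
    (eventually_isEmpty_cell := by
      filter_upwards [Filter.eventually_gt_atTop (k + 1)] with n hn
      obtain ⟨n, rfl⟩ := Nat.exists_eq_succ_of_ne_zero (by omega : n ≠ 0)
      exact ⟨fun j => by have := j.2; omega⟩)
    (finite_cell := fun n => match n with
      | 0 => inferInstanceAs (Finite Unit)
      | n + 1 => inferInstanceAs (Finite {_j : Fin g // n = k}))
    (source_eq := by
      rintro (_ | n) i
      · ext x
        simp [PartialEquiv.single, Subsingleton.elim x 0]
      · obtain ⟨j, rfl⟩ := i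
        rfl)
    (continuousOn := by
      rintro (_ | n) i
      · exact continuousOn_const
      · obtain ⟨j, rfl⟩ := i
        exact ((continuous_bouquetIncl j).comp (continuous_sphereCell _)).continuousOn)
    (continuousOn_symm := by
      rintro (_ | n) i
      · exact continuousOn_const
      · obtain ⟨j, rfl⟩ := i
        change ContinuousOn (fun f : bouquet g (n + 1) => sphereCellInv (n + 1) (f.1 j))
          {f | f.1 j ≠ UnitSphere.base (n + 1)}
        have h1 : ContinuousOn (sphereChart (n + 1)) {s | s ≠ UnitSphere.base (n + 1)} := by
          have := (sphereChart (n + 1)).continuousOn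
          rwa [sphereChart_source] at this
        have h2 : ContinuousOn (sphereCellInv (n + 1)) {s | s ≠ UnitSphere.base (n + 1)} := by
          refine ContinuousOn.smul (ContinuousOn.inv₀ (continuousOn_const.add h1.norm) ?_) h1
          intro s _
          have : 0 < 1 + ‖sphereChart (n + 1) s‖ := by positivity
          exact this.ne'
        exact h2.comp ((continuous_apply j).comp continuous_subtype_val).continuousOn
          fun f hf => hf)
    (pairwiseDisjoint' := by
      have key : ∀ {n : ℕ} (j : Fin g) (x : Fin n → ℝ), ‖x‖ < 1 →
          (bouquetIncl j (sphereCell n x)).1 j ≠ UnitSphere.base n := fun j x hx => by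
        simpa [bouquetIncl] using sphereCell_ne_base hx
      rintro ⟨_ | n, i⟩ - ⟨_ | n', j⟩ - h
      · exact absurd rfl h
      · obtain ⟨j, rfl⟩ := j
        refine disjoint_left.2 ?_
        rintro _ ⟨_, -, rfl⟩ ⟨x, hx, h'⟩
        exact key j x (mem_ball_zero_iff.1 hx) (congrArg (fun f => f.1 j) h')
      · obtain ⟨i, rfl⟩ := i
        refine disjoint_left.2 ?_
        rintro _ ⟨x, hx, rfl⟩ ⟨_, -, h'⟩
        exact key i x (mem_ball_zero_iff.1 hx) (congrArg (fun f => f.1 i) h').symm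
      · obtain ⟨i, rfl⟩ := i
        obtain ⟨j, rfl⟩ := j
        refine disjoint_left.2 ?_
        rintro _ ⟨x, hx, rfl⟩ ⟨y, hy, h'⟩
        have hij : i = j := by
          refine (bouquetIncl i (sphereCell _ x)).2 i j (key i x (mem_ball_zero_iff.1 hx)) ?_
          have h2 : bouquetIncl j (sphereCell _ y) = bouquetIncl i (sphereCell _ x) := h'
          rw [← h2]
          exact key j y (mem_ball_zero_iff.1 hy)
        subst hij
        exact h rfl)
    (mapsTo_iff_image_subset := by
      rintro (_ | n) i
      · intro x hx
        have h := mem_sphere_zero_iff_norm.1 hx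
        rw [Subsingleton.elim x 0, norm_zero] at h
        exact absurd h zero_ne_one
      · obtain ⟨j, rfl⟩ := i
        intro x hx
        refine mem_iUnion.2 ⟨0, mem_iUnion.2 ⟨Nat.succ_pos n, mem_iUnion.2 ⟨(), 0, by simp, ?_⟩⟩⟩
        exact (bouquetCell_of_sphere j (mem_sphere_zero_iff_norm.1 hx)).symm)
    (union' := by
      refine eq_univ_of_forall fun f => ?_
      rcases eq_bouquetBase_or f with h | ⟨j, hj, h⟩
      · exact mem_iUnion.2 ⟨0, mem_iUnion.2 ⟨(), 0, by simp, h.symm⟩⟩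
      · refine mem_iUnion.2 ⟨k + 1, mem_iUnion.2 ⟨⟨j, rfl⟩, sphereCellInv _ (f.1 j),
          ball_subset_closedBall (mem_ball_zero_iff.2 (norm_sphereCellInv_lt _ _)), ?_⟩⟩
        change bouquetIncl j (sphereCell _ (sphereCellInv _ (f.1 j))) = f
        rw [sphereCell_sphereCellInv hj, ← h])

/-- For `S⁰` the bouquet is a finite discrete space, whose only cells are its points; in positive
dimension the cell structure with one `0`-cell has as many cells as the Betti numbers require. -/
theorem isMinimalSpace_of_homotopyEquiv_bouquet {X : Type} [TopologicalSpace X] {g m : ℕ}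
    (e : Nonempty (X ≃ₕ bouquet g m)) : IsMinimalSpace X := by
  rcases m with _ | k
  · exact isMinimalSpace_of_finite_discrete e
  · have hT2 : T2Space (bouquet g (k + 1)) := inferInstance
    refine ⟨bouquet g (k + 1), inferInstance, hT2, bouquetCWComplex g k, e, ?_⟩
    rintro (_ | i)
    · have := pathConnectedSpace_bouquet (g := g) (Nat.succ_ne_zero k)
      refine ⟨inferInstanceAs (Finite Unit), ?_⟩
      rw [bettiNumber_zero_of_pathConnected]
      exact Cardinal.mk_unit
    · refine ⟨inferInstanceAs (Finite {_j : Fin g // i = k}), ?_⟩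
      rw [bettiNumber_bouquet (Nat.succ_ne_zero k) (Nat.succ_ne_zero i)]
      change Cardinal.mk {_j : Fin g // i = k} = _
      by_cases h : i = k
      · simp [h]
      · simp [h]

end CellStructure

/-! ### Families of moving points -/

section Moving

open Set Topology Filter

/-- Finitely many positive numbers have a positive lower bound. -/
lemma exists_pos_forall_le {ι : Type*} (s : Finset ι) (f : ι → ℝ) (h : ∀ i ∈ s, 0 < f i) :
    ∃ r > 0, ∀ i ∈ s, r ≤ f i := by
  have h1 : ∀ᶠ r : ℝ in 𝓝[>] 0, ∀ i ∈ s, r ≤ f i := by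
    rw [Finset.eventually_all]
    exact fun i hi => mem_nhdsWithin_of_mem_nhds (Iic_mem_nhds (h i hi))
  obtain ⟨r, h2, h3⟩ := (h1.and self_mem_nhdsWithin).exists
  exact ⟨r, h3, h2⟩

lemma exists_pos_le_norm_sub {E : Type*} [NormedAddCommGroup E] (s : Finset E) :
    ∃ r > 0, ∀ x ∈ s, ∀ y ∈ s, x ≠ y → r ≤ ‖x - y‖ := by
  classical
  obtain ⟨r, hr, h⟩ := exists_pos_forall_le s.offDiag (fun p => ‖p.1 - p.2‖) fun p hp =>
    norm_pos_iff.2 (sub_ne_zero.2 (Finset.mem_offDiag.1 hp).2.2)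
  exact ⟨r, hr, fun x hx y hy hxy => h (x, y) (Finset.mem_offDiag.2 ⟨hx, hy, hxy⟩)⟩

lemma exists_forall_lt {ι : Type*} (s : Finset ι) (f : ι → ℝ) : ∃ C > 0, ∀ i ∈ s, f i < C := by
  have h1 : ∀ᶠ r : ℝ in atTop, ∀ i ∈ s, f i < r := by
    rw [Finset.eventually_all]
    exact fun i _ => eventually_gt_atTop _
  obtain ⟨r, h2, h3⟩ := (h1.and (eventually_gt_atTop 0)).exists
  exact ⟨r, h3, h2⟩

section RadialShift

variable {E : Type*} [NormedAddCommGroup E] [NormedSpace ℝ E] {ι : Type*}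

/-- The map that scales by `k`, but around each centre `c i` scales the ball of radius `ρ` onto the
ball of radius `ρ'` around `k • c i`, pushing away points that would enter that ball. -/
noncomputable def radialShift (s : Finset ι) (c : ι → E) (k ρ ρ' : ℝ) (y : E) : E :=
  k • y + ∑ i ∈ s, (max k (ρ' / max ‖y - c i‖ ρ) - k) • (y - c i)

variable {s : Finset ι} {c : ι → E} {k ρ ρ' : ℝ} {y : E}

lemma radialShift_eq_self (hρ : 0 < ρ) : radialShift s c 1 ρ ρ y = y := by
  rw [radialShift, Finset.sum_eq_zero, one_smul, add_zero]
  intro i _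
  rw [max_eq_left, sub_self, zero_smul]
  exact (div_le_one (lt_max_of_lt_right hρ)).2 (le_max_right _ _)

lemma lt_of_max_ne {E : Type*} [NormedAddCommGroup E] {ι : Type*} {c : ι → E} {k ρ ρ' : ℝ} {y : E}
    (hk : 0 < k) (hρ : 0 < ρ) {i : ι}
    (h : max k (ρ' / max ‖y - c i‖ ρ) ≠ k) : k * ‖y - c i‖ < ρ' := by
  have h1 : k < ρ' / max ‖y - c i‖ ρ := by
    by_contra h1
    exact h (max_eq_left (not_lt.1 h1))
  rw [lt_div_iff₀ (lt_max_of_lt_right hρ)] at h1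
  exact lt_of_le_of_lt (mul_le_mul_of_nonneg_left (le_max_left _ _) hk.le) h1

/-- A point that only the centre `c i` can affect moves radially with respect to that centre. -/
lemma radialShift_sub_of_inactive {i : ι} (hi : i ∈ s)
    (h : ∀ j ∈ s, j ≠ i → max k (ρ' / max ‖y - c j‖ ρ) = k) :
    radialShift s c k ρ ρ' y - k • c i = max k (ρ' / max ‖y - c i‖ ρ) • (y - c i) := by
  rw [radialShift, Finset.sum_eq_single_of_mem i hi]
  · module
  · intro j hj hji
    rw [h j hj hji, sub_self, zero_smul]

/-- The balls of radius `ρ'` around the centres `k • c i` do not overlap, so that a point near one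
centre is not affected by the others. -/
lemma inactive_of_le {E : Type*} [NormedAddCommGroup E] {ι : Type*} {s : Finset ι} {c : ι → E}
    {k ρ ρ' : ℝ} {y : E} (hk : 0 < k) (hρ : 0 < ρ)
    (hsep : ∀ i ∈ s, ∀ j ∈ s, i ≠ j → 2 * ρ' ≤ k * ‖c i - c j‖) {i j : ι} (hi : i ∈ s) (hj : j ∈ s)
    (hji : j ≠ i)
    (h : k * ‖y - c i‖ ≤ ρ') : max k (ρ' / max ‖y - c j‖ ρ) = k := by
  by_contra hne
  have h1 := lt_of_max_ne hk hρ hne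
  have h2 := hsep j hj i hi hji
  have h3 : ‖c j - c i‖ ≤ ‖y - c i‖ + ‖y - c j‖ := by
    have := norm_sub_le (y - c i) (y - c j)
    rwa [sub_sub_sub_cancel_left] at this
  nlinarith [mul_le_mul_of_nonneg_left h3 hk.le]

/-- Inside the ball of radius `ρ` around `c i` the map is a homothety onto the ball of radius `ρ'`.
-/
lemma radialShift_sub_of_le (hk : 0 < k) (hρ : 0 < ρ) (hkρ : k * ρ ≤ ρ')
    (hsep : ∀ i ∈ s, ∀ j ∈ s, i ≠ j → 2 * ρ' ≤ k * ‖c i - c j‖) {i : ι} (hi : i ∈ s)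
    (h : ‖y - c i‖ ≤ ρ) :
    radialShift s c k ρ ρ' y - k • c i = (ρ' / ρ) • (y - c i) := by
  have h1 : k * ‖y - c i‖ ≤ ρ' := (mul_le_mul_of_nonneg_left h hk.le).trans hkρ
  rw [radialShift_sub_of_inactive hi fun j hj hji => inactive_of_le hk hρ hsep hi hj hji h1,
    max_eq_right h, max_eq_right ((le_div_iff₀ hρ).2 hkρ)]

/-- Points outside the ball of radius `ρ` around `c i` stay outside the ball of radius `ρ'`. -/
lemma le_norm_radialShift_sub (hk : 0 < k) (hρ : 0 < ρ) (hkρ : k * ρ ≤ ρ')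
    (hsep : ∀ i ∈ s, ∀ j ∈ s, i ≠ j → 2 * ρ' ≤ k * ‖c i - c j‖) {i : ι} (hi : i ∈ s)
    (h : ρ < ‖y - c i‖) :
    ρ' ≤ ‖radialShift s c k ρ ρ' y - k • c i‖ := by
  have hpos : 0 < ρ' := (mul_pos hk hρ).trans_le hkρ
  by_cases hact : ∀ j ∈ s, j ≠ i → max k (ρ' / max ‖y - c j‖ ρ) = k
  · rw [radialShift_sub_of_inactive hi hact, norm_smul, Real.norm_of_nonneg
      (hk.le.trans (le_max_left _ _)), max_eq_left h.le]
    have h0 : 0 < ‖y - c i‖ := hρ.trans h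
    calc ρ' = ρ' / ‖y - c i‖ * ‖y - c i‖ := by field_simp
      _ ≤ _ := mul_le_mul_of_nonneg_right (le_max_right _ _) h0.le
  · push Not at hact
    obtain ⟨j, hj, hji, hne⟩ := hact
    have h1 := lt_of_max_ne hk hρ hne
    have h2 := radialShift_sub_of_inactive (k := k) (ρ := ρ) (ρ' := ρ') (y := y) (c := c) hj
      fun l hl hlj => inactive_of_le hk hρ hsep hj hl hlj h1.le
    have h3 : ‖radialShift s c k ρ ρ' y - k • c j‖ ≤ ρ' := by
      have hm : 0 < max ‖y - c j‖ ρ := lt_max_of_lt_right hρ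
      rw [h2, norm_smul, Real.norm_of_nonneg (hk.le.trans (le_max_left _ _))]
      rw [max_mul_of_nonneg _ _ (norm_nonneg _)]
      refine max_le h1.le ?_
      rw [div_mul_eq_mul_div, div_le_iff₀ hm]
      exact mul_le_mul_of_nonneg_left (le_max_left _ _) hpos.le
    have h4 := hsep j hj i hi hji
    have h5 : k * ‖c j - c i‖ = ‖k • c j - k • c i‖ := by
      rw [← smul_sub, norm_smul, Real.norm_of_nonneg hk.le]
    have h6 : ‖k • c j - k • c i‖ ≤ ‖radialShift s c k ρ ρ' y - k • c i‖ +
        ‖radialShift s c k ρ ρ' y - k • c j‖ := by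
      have := norm_sub_le (radialShift s c k ρ ρ' y - k • c i) (radialShift s c k ρ ρ' y - k • c j)
      rwa [sub_sub_sub_cancel_left] at this
    linarith

end RadialShift

lemma continuousOn_radialShift {E : Type*} [NormedAddCommGroup E] [NormedSpace ℝ E] {ι : Type*}
    {W : Type*} [TopologicalSpace W] {D : Set W} (s : Finset ι) {c : ι → W → E} {k ρ ρ' : W → ℝ}
    {y : W → E} (hc : ∀ i ∈ s, ContinuousOn (c i) D) (hk : ContinuousOn k D)
    (hρ : ContinuousOn ρ D) (hρ' : ContinuousOn ρ' D) (hy : ContinuousOn y D)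
    (hpos : ∀ w ∈ D, 0 < ρ w) :
    ContinuousOn (fun w => radialShift s (fun i => c i w) (k w) (ρ w) (ρ' w) (y w)) D := by
  refine (hk.smul hy).add (continuousOn_finsetSum s fun i hi => ?_)
  have h1 : ContinuousOn (fun w => y w - c i w) D := hy.sub (hc i hi)
  refine ((hk.sup (hρ'.div (h1.norm.sup hρ) fun w hw => ?_)).sub hk).smul h1
  exact (lt_max_of_lt_right (hpos w hw)).ne'

variable {E : Type*} [NormedAddCommGroup E] [NormedSpace ℝ E]

/-- The pair `(a, b)` stands for the line of the points `(t, a + t • b)` of `ℝ × E`. This is the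
complement of a finite set of such lines in the slab over `I`. -/
def lineComplement (L : Finset (E × E)) (I : Set ℝ) : Set (ℝ × E) :=
  {z | z.1 ∈ I ∧ ∀ p ∈ L, z.2 ≠ p.1 + z.1 • p.2}

open scoped Classical in
/-- The points in which the lines meet the hyperplane at time `t`. -/
noncomputable def slicePoints (L : Finset (E × E)) (t : ℝ) : Finset E :=
  L.image fun p => p.1 + t • p.2

lemma mem_slicePoints {L : Finset (E × E)} {p : E × E} (hp : p ∈ L) (t : ℝ) :
    p.1 + t • p.2 ∈ slicePoints L t := by
  classical
  exact Finset.mem_image.2 ⟨p, hp, rfl⟩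

/-- The homotopy type does not change when the end of the slab approaches a time `t₀` from the left.
The slab is pushed back in time; the slices of the cones of slope `C` around the points of the slice
at time `t₀`, which contain all the lines, are scaled along. -/
theorem eventually_nhdsLT_homotopyEquiv (L : Finset (E × E)) {a t₀ : ℝ} (ha : a < t₀) :
    ∀ᶠ s in 𝓝[<] t₀, Nonempty (lineComplement L (Ioo a s) ≃ₕ lineComplement L (Ioo a t₀)) := by
  obtain ⟨C, hC, hCL⟩ := exists_forall_lt L fun p => ‖p.2‖
  obtain ⟨r, hr, hsep⟩ := exists_pos_le_norm_sub (slicePoints L t₀)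
  obtain ⟨s₁, hs₁, hs₁t, hs₁r⟩ : ∃ s₁, a < s₁ ∧ s₁ < t₀ ∧ 2 * (C * (t₀ - s₁)) ≤ r := by
    have hpos : 0 < min (t₀ - a) (r / C) := lt_min (by linarith) (by positivity)
    refine ⟨t₀ - min (t₀ - a) (r / C) / 2, ?_, by linarith, ?_⟩
    · linarith [min_le_left (t₀ - a) (r / C)]
    · have h1 := min_le_right (t₀ - a) (r / C)
      have h2 : C * min (t₀ - a) (r / C) ≤ r := by
        calc _ ≤ C * (r / C) := mul_le_mul_of_nonneg_left h1 hC.le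
          _ = r := by field_simp
      linarith
  filter_upwards [Ioo_mem_nhdsLT hs₁t] with s hs
  set θ := (t₀ - s) / (t₀ - s₁) with hθ
  have hd : 0 < t₀ - s₁ := by linarith
  have hθ0 : 0 < θ := div_pos (by linarith [hs.2]) hd
  have hθ1 : θ < 1 := (div_lt_one hd).2 (by linarith [hs.1])
  let τ : ℝ → ℝ → ℝ := fun u t => t - u * θ * max (t - s₁) 0
  have hτle : ∀ u ∈ Icc (0 : ℝ) 1, ∀ t, τ u t ≤ t := fun u hu t =>
    sub_le_self _ (mul_nonneg (mul_nonneg hu.1 hθ0.le) (le_max_right _ _))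
  have huθ : ∀ u ∈ Icc (0 : ℝ) 1, u * θ ≤ 1 := fun u hu => mul_le_one₀ hu.2 hθ0.le hθ1.le
  have hτge : ∀ u ∈ Icc (0 : ℝ) 1, ∀ t, min t s₁ ≤ τ u t := by
    intro u hu t
    rcases le_total t s₁ with h | h
    · simp only [τ]
      rw [max_eq_right (by linarith), min_eq_left h]; simp
    · simp only [τ]
      rw [max_eq_left (by linarith), min_eq_right h]
      nlinarith [huθ u hu]
  have hτa : ∀ u ∈ Icc (0 : ℝ) 1, ∀ t, a < t → a < τ u t := fun u hu t ht =>
    lt_of_lt_of_le (lt_min ht hs₁) (hτge u hu t)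
  let H : ℝ → ℝ × E → ℝ × E := fun u z =>
    (τ u z.1, radialShift (slicePoints L t₀) (fun q => q) 1 (C * (t₀ - z.1))
      (C * (t₀ - τ u z.1)) z.2)
  -- points off the lines remain off the lines
  have key : ∀ u ∈ Icc (0 : ℝ) 1, ∀ z : ℝ × E, z.1 < t₀ → (∀ p ∈ L, z.2 ≠ p.1 + z.1 • p.2) →
      ∀ p ∈ L, (H u z).2 ≠ p.1 + (H u z).1 • p.2 := by
    rintro u hu ⟨t, y⟩ ht hy p hp heq
    simp only [H] at ht heq
    by_cases hts : t ≤ s₁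
    · have hτt : τ u t = t := le_antisymm (hτle u hu t) (by simpa [hts] using hτge u hu t)
      rw [hτt, radialShift_eq_self (by nlinarith)] at heq
      exact hy p hp heq
    have ht0 : 0 < t₀ - t := by linarith
    have ht'0 : 0 < t₀ - τ u t := by linarith [hτle u hu t]
    have hτs : s₁ ≤ τ u t := by
      have := hτge u hu t
      rwa [min_eq_right (not_le.1 hts).le] at this
    have hρ : 0 < C * (t₀ - t) := by positivity
    have hkρ : 1 * (C * (t₀ - t)) ≤ C * (t₀ - τ u t) := by
      rw [one_mul]; exact mul_le_mul_of_nonneg_left (by linarith [hτle u hu t]) hC.le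
    have hsep' : ∀ i ∈ slicePoints L t₀, ∀ j ∈ slicePoints L t₀, i ≠ j →
        2 * (C * (t₀ - τ u t)) ≤ 1 * ‖i - j‖ := by
      intro i hi j hj hij
      have := hsep i hi j hj hij
      have h2 : C * (t₀ - τ u t) ≤ C * (t₀ - s₁) := mul_le_mul_of_nonneg_left (by linarith) hC.le
      linarith
    have hq := mem_slicePoints hp t₀
    set q := p.1 + t₀ • p.2
    have hq' : p.1 + τ u t • p.2 - (1 : ℝ) • q = -((t₀ - τ u t) • p.2) := by
      simp only [q]; module
    rcases le_or_gt ‖y - q‖ (C * (t₀ - t)) with h | h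
    · have h1 := radialShift_sub_of_le one_pos hρ hkρ hsep' hq h
      rw [heq, hq'] at h1
      have h2 : C * (t₀ - τ u t) / (C * (t₀ - t)) = (t₀ - τ u t) / (t₀ - t) := by field_simp
      rw [h2] at h1
      have h3 : (t₀ - t) • p.2 = -(y - q) := by
        have h4 := congrArg (fun x => ((t₀ - t) / (t₀ - τ u t)) • x) h1
        simp only [smul_smul, smul_neg] at h4
        rw [div_mul_div_cancel₀ ht'0.ne', div_self ht0.ne', one_smul,
          div_mul_cancel₀ _ ht'0.ne'] at h4
        rw [← h4, neg_neg]
      refine hy p hp ?_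
      have h5 : y = q - (t₀ - t) • p.2 := by rw [h3]; abel
      rw [h5]
      simp only [q]
      module
    · have h1 := le_norm_radialShift_sub one_pos hρ hkρ hsep' hq h
      rw [heq, hq', norm_neg, norm_smul, Real.norm_of_nonneg ht'0.le] at h1
      nlinarith [hCL p hp]
  refine nonempty_homotopyEquiv_of_push ?_ H ?_ ?_ ?_ ?_ ?_
  · exact fun z hz => ⟨⟨hz.1.1, hz.1.2.trans hs.2⟩, hz.2⟩
  · have hτc : Continuous fun w : ℝ × ℝ × E => τ w.1 w.2.1 := by fun_prop
    refine ContinuousOn.prodMk hτc.continuousOn (continuousOn_radialShift _ (fun i _ =>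
      continuousOn_const) continuousOn_const (by fun_prop) (by fun_prop) (by fun_prop) ?_)
    rintro ⟨u, t, y⟩ ⟨-, hz⟩
    have : t < t₀ := hz.1.2
    exact mul_pos hC (by linarith)
  · rintro ⟨t, y⟩ hz
    have ht : t < t₀ := hz.1.2
    have h0 : τ 0 t = t := by simp [τ]
    simp only [H, h0]
    rw [radialShift_eq_self (mul_pos hC (by linarith))]
  · exact fun u hu z hz => ⟨⟨hτa u hu _ hz.1.1, lt_of_le_of_lt (hτle u hu _) hz.1.2⟩,
      key u hu z hz.1.2 hz.2⟩
  · exact fun u hu z hz => ⟨⟨hτa u hu _ hz.1.1, lt_of_le_of_lt (hτle u hu _) hz.1.2⟩,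
      key u hu z (hz.1.2.trans hs.2) hz.2⟩
  · intro z hz
    have h1 : (1 : ℝ) ∈ Icc (0 : ℝ) 1 := ⟨zero_le_one, le_rfl⟩
    refine ⟨⟨hτa 1 h1 _ hz.1.1, ?_⟩, key 1 h1 z hz.1.2 hz.2⟩
    simp only [H, τ, one_mul]
    rcases le_total z.1 s₁ with h | h
    · rw [max_eq_right (by linarith)]
      linarith [hs.1]
    · rw [max_eq_left (by linarith)]
      have h2 : θ * (t₀ - s₁) = t₀ - s := div_mul_cancel₀ _ hd.ne'
      have h3 : z.1 < t₀ := hz.1.2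
      nlinarith

/-- The homotopy type does not change when the slab is cut off at a large time. At a large time `t`
the lines of slope `b` lie in the ball of radius `C` around `t • b`, and these balls are disjoint.
Time is pushed back by scaling the slices, while the balls are translated. -/
theorem eventually_atTop_homotopyEquiv (L : Finset (E × E)) {I : Set ℝ} {s₀ : ℝ}
    (hI : Ici s₀ ⊆ I) :
    ∀ᶠ s in atTop, Nonempty (lineComplement L (I ∩ Iio s) ≃ₕ lineComplement L I) := by
  classical
  obtain ⟨C, hC, hCL⟩ := exists_forall_lt L fun p => ‖p.1‖
  obtain ⟨r, hr, hsep⟩ := exists_pos_le_norm_sub (L.image fun p => p.2)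
  obtain ⟨s₁, hs₁, hs₁0, hs₁r⟩ : ∃ s₁, s₀ ≤ s₁ ∧ 0 < s₁ ∧ 2 * C ≤ s₁ * r := by
    refine ⟨max s₀ (2 * C / r), le_max_left _ _, lt_max_of_lt_right (by positivity), ?_⟩
    rw [← div_le_iff₀ hr]; exact le_max_right _ _
  filter_upwards [eventually_gt_atTop s₁] with s hs
  have hD : 0 < s - s₁ := by linarith
  let h : ℝ → ℝ := fun t => max (t - s₁) 0
  have hh : ∀ t, 0 ≤ h t := fun t => le_max_right _ _
  let τ : ℝ → ℝ → ℝ := fun u t => t - u * (h t * h t / (s - s₁ + h t))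
  have hDh : ∀ t, 0 < s - s₁ + h t := fun t => by linarith [hh t]
  have hq0 : ∀ t, 0 ≤ h t * h t / (s - s₁ + h t) := fun t =>
    div_nonneg (mul_nonneg (hh t) (hh t)) (hDh t).le
  have hqh : ∀ t, h t * h t / (s - s₁ + h t) ≤ h t := fun t => by
    rw [div_le_iff₀ (hDh t)]; nlinarith [hh t]
  have hτle : ∀ u ∈ Icc (0 : ℝ) 1, ∀ t, τ u t ≤ t := fun u hu t =>
    sub_le_self _ (mul_nonneg hu.1 (hq0 t))
  have hτeq : ∀ u t, t ≤ s₁ → τ u t = t := fun u t ht => by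
    have : h t = 0 := max_eq_right (by linarith)
    simp [τ, this]
  have hτge : ∀ u ∈ Icc (0 : ℝ) 1, ∀ t, s₁ ≤ t → s₁ ≤ τ u t := fun u hu t ht => by
    have h1 : h t = t - s₁ := max_eq_left (by linarith)
    have h2 := mul_le_of_le_one_left (hq0 t) hu.2
    have h3 := hqh t
    simp only [τ]
    linarith
  have hτI : ∀ u ∈ Icc (0 : ℝ) 1, ∀ t ∈ I, τ u t ∈ I := fun u hu t ht => by
    rcases le_total t s₁ with h1 | h1
    · rwa [hτeq u t h1]
    · exact hI (hs₁.trans (hτge u hu t h1))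
  have hτs : ∀ t, τ 1 t < s := fun t => by
    rcases le_total t s₁ with h1 | h1
    · rw [hτeq 1 t h1]; linarith
    · have h2 : h t = t - s₁ := max_eq_left (by linarith)
      have h3 : h t - (s - s₁) < h t * h t / (s - s₁ + h t) := by
        rw [lt_div_iff₀ (hDh t)]; nlinarith
      simp only [τ, one_mul]
      linarith
  let k : ℝ → ℝ → ℝ := fun u t => max (τ u t) s₁ / max t s₁
  have hmax : ∀ t, 0 < max t s₁ := fun t => lt_max_of_lt_right hs₁0
  let H : ℝ → ℝ × E → ℝ × E := fun u z =>
    (τ u z.1, radialShift (L.image fun p => p.2) (fun b => z.1 • b) (k u z.1) C C z.2)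
  have hHeq : ∀ u z, τ u z.1 = z.1 → H u z = z := by
    rintro u ⟨t, y⟩ hz
    have hk1 : k u t = 1 := by
      simp only [k]
      rw [show τ u t = t from hz, div_self (hmax t).ne']
    simp only [H, hk1]
    rw [radialShift_eq_self hC, show τ u t = t from hz]
  have key : ∀ u ∈ Icc (0 : ℝ) 1, ∀ z : ℝ × E, (∀ p ∈ L, z.2 ≠ p.1 + z.1 • p.2) →
      ∀ p ∈ L, (H u z).2 ≠ p.1 + (H u z).1 • p.2 := by
    rintro u hu ⟨t, y⟩ hy p hp heq
    rcases le_total t s₁ with hts | hts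
    · rw [hHeq u (t, y) (hτeq u t hts)] at heq
      exact hy p hp heq
    have ht0 : 0 < t := hs₁0.trans_le hts
    have hτ' := hτge u hu t hts
    have hkt : k u t = τ u t / t := by
      simp only [k]; rw [max_eq_left hts, max_eq_left hτ']
    have hk0 : 0 < k u t := by rw [hkt]; exact div_pos (hs₁0.trans_le hτ') ht0
    have hk1 : k u t ≤ 1 := by rw [hkt]; exact (div_le_one ht0).2 (hτle u hu t)
    have hkt' : k u t * t = τ u t := by rw [hkt]; field_simp
    have hkρ : k u t * C ≤ C := mul_le_of_le_one_left hC.le hk1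
    have hsep' : ∀ i ∈ L.image fun p => p.2, ∀ j ∈ L.image fun p => p.2, i ≠ j →
        2 * C ≤ k u t * ‖t • i - t • j‖ := by
      intro i hi j hj hij
      rw [← smul_sub, norm_smul, Real.norm_of_nonneg ht0.le, ← mul_assoc, hkt']
      exact hs₁r.trans (mul_le_mul hτ' (hsep i hi j hj hij) hr.le (hs₁0.le.trans hτ'))
    have hb : p.2 ∈ L.image fun p => p.2 := Finset.mem_image_of_mem _ hp
    have hb' : p.1 + τ u t • p.2 - k u t • (t • p.2) = p.1 := by
      rw [smul_smul, hkt']; abel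
    simp only [H] at heq
    rcases le_or_gt ‖y - t • p.2‖ C with h1 | h1
    · have h2 := radialShift_sub_of_le (c := fun b => t • b) hk0 hC hkρ hsep' hb h1
      rw [heq, hb', div_self hC.ne', one_smul] at h2
      refine hy p hp ?_
      simp only
      rw [h2]; abel
    · have h2 := le_norm_radialShift_sub (c := fun b => t • b) hk0 hC hkρ hsep' hb h1
      rw [heq, hb'] at h2
      linarith [hCL p hp]
  refine nonempty_homotopyEquiv_of_push ?_ H ?_ ?_ ?_ ?_ ?_
  · exact fun z hz => ⟨hz.1.1, hz.2⟩
  · have hτc : Continuous fun w : ℝ × ℝ × E => τ w.1 w.2.1 := by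
      have hhc : Continuous h := by fun_prop
      refine Continuous.sub (by fun_prop) (Continuous.mul (by fun_prop) (Continuous.div
        (by fun_prop) (by fun_prop) fun w => (hDh _).ne'))
    refine ContinuousOn.prodMk hτc.continuousOn (continuousOn_radialShift _ (fun i _ =>
      by fun_prop) ?_ continuousOn_const continuousOn_const (by fun_prop) fun _ _ => hC)
    exact (Continuous.div (hτc.max continuous_const) (by fun_prop)
      fun w => (hmax _).ne').continuousOn
  · exact fun z _ => hHeq 0 z (by simp [τ])
  · exact fun u hu z hz => ⟨hτI u hu _ hz.1, key u hu z hz.2⟩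
  · exact fun u hu z hz => ⟨⟨hτI u hu _ hz.1.1, lt_of_le_of_lt (hτle u hu _) hz.1.2⟩,
      key u hu z hz.2⟩
  · have h1 : (1 : ℝ) ∈ Icc (0 : ℝ) 1 := ⟨zero_le_one, le_rfl⟩
    exact fun z hz => ⟨⟨hτI 1 h1 _ hz.1, hτs _⟩, key 1 h1 z hz.2⟩

end Moving

/-! ### Filling in neighbourhoods of lines through a common point -/

section Cluster

open Set Topology Filter Module

/-- A push in a coordinate chart. -/
theorem nonempty_homotopyEquiv_union_image_of_push {W Z : Type*} [TopologicalSpace W]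
    [MetricSpace Z] (e : OpenPartialHomeomorph W Z) {X : Set Z} {B : Set W} (hX : IsOpen X)
    (hB : IsOpen B) (hBe : B ⊆ e.source) (k : ℝ → W → W)
    (hk : ContinuousOn (fun p : ℝ × W => k p.1 p.2) (Icc 0 1 ×ˢ B))
    (h0 : ∀ w ∈ B, k 0 w = w) (hkB : ∀ u ∈ Icc (0 : ℝ) 1, ∀ w ∈ B, k u w ∈ B)
    (hkX : ∀ u ∈ Icc (0 : ℝ) 1, ∀ w ∈ B, e w ∈ X → e (k u w) ∈ X)
    (h1 : ∀ w ∈ B, e (k 1 w) ∈ X) : Nonempty (X ≃ₕ ↥(X ∪ e '' B)) := by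
  refine nonempty_homotopyEquiv_union_of_push hX (e.isOpen_image_of_subset_source hB hBe)
    (fun u z => e (k u (e.symm z))) ?_ ?_ ?_ ?_ ?_
  · have hs : MapsTo (fun p : ℝ × Z => (p.1, e.symm p.2)) (Icc 0 1 ×ˢ (e '' B)) (Icc 0 1 ×ˢ B) := by
      rintro ⟨u, _⟩ ⟨hu, w, hw, rfl⟩
      exact ⟨hu, by simpa [e.left_inv (hBe hw)] using hw⟩
    have hc : ContinuousOn (fun p : ℝ × Z => (p.1, e.symm p.2)) (Icc 0 1 ×ˢ (e '' B)) := by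
      refine continuousOn_fst.prodMk (e.continuousOn_symm.comp continuousOn_snd ?_)
      rintro ⟨u, _⟩ ⟨hu, w, hw, rfl⟩
      exact e.map_source (hBe hw)
    refine e.continuousOn.comp (hk.comp hc hs) fun p hp => hBe ?_
    exact hkB p.1 hp.1 _ (hs hp).2
  · rintro _ ⟨w, hw, rfl⟩
    simp only [e.left_inv (hBe hw), h0 w hw]
  · rintro u hu _ ⟨w, hw, rfl⟩
    exact ⟨_, hkB u hu w hw, by simp only [e.left_inv (hBe hw)]⟩
  · rintro u hu _ hx ⟨w, hw, rfl⟩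
    simp only [e.left_inv (hBe hw)]
    exact hkX u hu w hw hx
  · rintro _ ⟨w, hw, rfl⟩
    simp only [e.left_inv (hBe hw)]
    exact h1 w hw

/-- Attaching a homotopy sphere given in a coordinate chart. -/
theorem nonempty_union_image_homotopyEquiv_bouquet {W Z : Type*} [TopologicalSpace W]
    [MetricSpace Z] (e : OpenPartialHomeomorph W Z) {X : Set Z} {B : Set W} {g m : ℕ}
    (hX : IsOpen X) (hB : IsOpen B) (hBe : B ⊆ e.source) {t : W} (ht : e t ∈ X) (ht' : t ∈ B)
    (k : ℝ → W → W)
    (hk : ContinuousOn (fun p : ℝ × W => k p.1 p.2) (Icc 0 1 ×ˢ B))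
    (hkB : ∀ u ∈ Icc (0 : ℝ) 1, ∀ w ∈ B, e w ∈ X → k u w ∈ B ∧ e (k u w) ∈ X)
    (hk0 : ∀ w ∈ B, k 0 w = w) (hk1 : ∀ w ∈ B, k 1 w = t)
    (hkt : ∀ u ∈ Icc (0 : ℝ) 1, k u t = t)
    (eX : Nonempty (X ≃ₕ bouquet g m)) (eB : Nonempty (B ≃ₕ UnitSphere m)) :
    Nonempty (↥(X ∪ e '' B) ≃ₕ bouquet (g + 1) m) := by
  have hB' : Nonempty (↥(e '' B) ≃ₕ UnitSphere m) := by
    obtain ⟨eB⟩ := eB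
    exact ⟨(e.homeomorphOfImageSubsetSource hBe rfl).symm.toHomotopyEquiv.trans eB⟩
  refine nonempty_union_homotopyEquiv_bouquet hX (e.isOpen_image_of_subset_source hB hBe)
    ht ⟨t, ht', rfl⟩ (fun u z => e (k u (e.symm z))) ?_ ?_ ?_ ?_ ?_ eX hB'
  · have hs : MapsTo (fun p : ℝ × Z => (p.1, e.symm p.2)) (Icc 0 1 ×ˢ (X ∩ e '' B))
        (Icc 0 1 ×ˢ B) := by
      rintro ⟨u, _⟩ ⟨hu, -, w, hw, rfl⟩
      exact ⟨hu, by simpa [e.left_inv (hBe hw)] using hw⟩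
    have hc : ContinuousOn (fun p : ℝ × Z => (p.1, e.symm p.2)) (Icc 0 1 ×ˢ (X ∩ e '' B)) := by
      refine continuousOn_fst.prodMk (e.continuousOn_symm.comp continuousOn_snd ?_)
      rintro ⟨u, _⟩ ⟨hu, -, w, hw, rfl⟩
      exact e.map_source (hBe hw)
    refine e.continuousOn.comp (hk.comp hc hs) ?_
    rintro ⟨u, _⟩ ⟨hu, hx, w, hw, rfl⟩
    refine hBe ?_
    simp only [e.left_inv (hBe hw)]
    exact (hkB u hu w hw hx).1
  · rintro u hu _ ⟨hx, w, hw, rfl⟩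
    simp only [e.left_inv (hBe hw)]
    have := hkB u hu w hw hx
    exact ⟨this.2, _, this.1, rfl⟩
  · rintro _ ⟨-, w, hw, rfl⟩
    simp only [e.left_inv (hBe hw), hk0 w hw]
  · rintro _ ⟨-, w, hw, rfl⟩
    simp only [e.left_inv (hBe hw), hk1 w hw]
  · intro u hu
    simp only [e.left_inv (hBe ht'), hkt u hu]

section PuncturedConvex

variable {E : Type*} [NormedAddCommGroup E] [NormedSpace ℝ E]

/-- A convex set is shrunk radially to a ball around the missing point. -/
lemma nonempty_punctured_ball_homotopyEquiv {C : Set E} (hC : Convex ℝ C) {v : E} {r : ℝ}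
    (hr : 0 < r) (hrC : Metric.ball v r ⊆ C) :
    Nonempty (↥(Metric.ball v r \ {v}) ≃ₕ ↥(C \ {v})) := by
  let l : ℝ → E → ℝ := fun u y => (1 - u) + u * (r / (‖y - v‖ + r))
  have hpos : ∀ y : E, 0 < ‖y - v‖ + r := fun y => by positivity
  have hl : ∀ u ∈ Icc (0 : ℝ) 1, ∀ y, 0 < l u y ∧ l u y ≤ 1 := by
    intro u hu y
    have h1 : 0 < r / (‖y - v‖ + r) := div_pos hr (hpos y)
    have h2 : r / (‖y - v‖ + r) ≤ 1 := (div_le_one (hpos y)).2 (by simp)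
    simp only [l]
    constructor
    · rcases hu.1.eq_or_lt with h | h
      · rw [← h]; simp
      · nlinarith [hu.2, mul_pos h h1]
    · nlinarith [hu.1]
  have hne : ∀ u ∈ Icc (0 : ℝ) 1, ∀ y, y ≠ v → v + l u y • (y - v) ≠ v := by
    intro u hu y hy h
    have := (smul_eq_zero.1 (add_eq_left.1 h)).resolve_left (hl u hu y).1.ne'
    exact hy (sub_eq_zero.1 this)
  have hmem : ∀ {C : Set E}, Convex ℝ C → v ∈ C → ∀ u ∈ Icc (0 : ℝ) 1, ∀ y ∈ C \ {v},
      v + l u y • (y - v) ∈ C \ {v} := fun hC hv u hu y hy =>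
    ⟨hC.add_smul_sub_mem hv hy.1 ⟨(hl u hu y).1.le, (hl u hu y).2⟩, hne u hu y hy.2⟩
  refine nonempty_homotopyEquiv_of_push (sdiff_subset_sdiff_left hrC)
    (fun u y => v + l u y • (y - v)) ?_ ?_ (hmem hC (hrC (Metric.mem_ball_self hr)))
    (hmem (convex_ball v r) (Metric.mem_ball_self hr)) ?_
  · refine Continuous.continuousOn ?_
    refine continuous_const.add (Continuous.smul (Continuous.add (by fun_prop)
      (Continuous.mul (by fun_prop) (Continuous.div (by fun_prop) (by fun_prop) fun p =>
        (hpos _).ne'))) (by fun_prop))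
  · intro y _; simp [l]
  · intro y hy
    have h1 : (1 : ℝ) ∈ Icc (0 : ℝ) 1 := ⟨zero_le_one, le_rfl⟩
    refine ⟨?_, hne 1 h1 y hy.2⟩
    rw [mem_ball_iff_norm, add_sub_cancel_left, norm_smul, Real.norm_of_nonneg (hl 1 h1 y).1.le]
    simp only [l, sub_self, one_mul, zero_add]
    rw [div_mul_eq_mul_div, div_lt_iff₀ (hpos y)]
    nlinarith

/-- An open convex set of dimension `m + 1` without one point is a homotopy sphere. -/
theorem nonempty_convex_diff_singleton_homotopyEquiv [FiniteDimensional ℝ E] {m : ℕ}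
    (hm : finrank ℝ E = m + 1) {C : Set E} (hC : Convex ℝ C) (hCo : IsOpen C) {v : E}
    (hv : v ∈ C) : Nonempty (↥(C \ {v}) ≃ₕ UnitSphere m) := by
  obtain ⟨r, hr, hrC⟩ := Metric.isOpen_iff.1 hCo v hv
  obtain ⟨e1⟩ := nonempty_punctured_ball_homotopyEquiv hC hr hrC
  obtain ⟨e2⟩ := nonempty_punctured_ball_homotopyEquiv (convex_univ (𝕜 := ℝ)) hr
    (subset_univ (Metric.ball v r))
  let e3 : ↥((univ : Set E) \ {v}) ≃ₜ ({0}ᶜ : Set E) :=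
    (Homeomorph.addRight (-v)).subtype fun x => by simp [sub_eq_zero, ← sub_eq_add_neg]
  have e4 : E ≃L[ℝ] EuclideanSpace ℝ (Fin (m + 1)) :=
    ContinuousLinearEquiv.ofFinrankEq (by simp [hm])
  obtain ⟨e5⟩ := nonempty_punctured_homotopyEquiv_sphere (EuclideanSpace ℝ (Fin (m + 1)))
  exact ⟨((e1.symm.trans e2).trans (e3.trans (puncturedHomeomorph e4)).toHomotopyEquiv).trans e5⟩

lemma nonempty_prod_set_homotopyEquiv {E : Type*} [TopologicalSpace E] {J : Set ℝ} (hJ : Convex ℝ J)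
    (hJn : J.Nonempty) {Y : Set E} {T : Type*} [TopologicalSpace T] (h : Nonempty (Y ≃ₕ T)) :
    Nonempty (↥(J ×ˢ Y) ≃ₕ T) := by
  have : ContractibleSpace J := hJ.contractibleSpace hJn
  obtain ⟨e1⟩ := h
  obtain ⟨e2⟩ := nonempty_prod_homotopyEquiv Y J
  exact ⟨(((Homeomorph.Set.prod J Y).trans (Homeomorph.prodComm _ _)).toHomotopyEquiv.trans
    e2).trans e1⟩

/-- Points of a punctured neighbourhood of a convex body can be pushed radially off the body. The
push is measured by the gauge of the body and moves points only inside a slightly larger body. -/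
lemma exists_push_off_convex {N A : Set E} (hN : Convex ℝ N) (hNc : IsCompact N) {v : E}
    (hv : N ∈ 𝓝 v) (hA : IsOpen A) (hNA : N ⊆ A) : ∃ k : ℝ → E → E,
      ContinuousOn (fun p : ℝ × E => k p.1 p.2) (Icc 0 1 ×ˢ {v}ᶜ) ∧ (∀ w ≠ v, k 0 w = w) ∧
      (∀ u ∈ Icc (0 : ℝ) 1, ∀ w ∈ A, w ≠ v → k u w ∈ A ∧ k u w ≠ v) ∧
      (∀ u ∈ Icc (0 : ℝ) 1, ∀ w ∉ N, k u w ∉ N) ∧ ∀ w ≠ v, k 1 w ∉ N := by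
  obtain ⟨η, hη, hηA⟩ := hNc.exists_thickening_subset_open hA hNA
  obtain ⟨C, hC0, hCN⟩ : ∃ C > 0, ∀ w ∈ N, ‖w - v‖ ≤ C := by
    obtain ⟨C, hC⟩ := hNc.isBounded.subset_closedBall v
    exact ⟨max C 1, lt_max_of_lt_right one_pos, fun w hw =>
      (mem_closedBall_iff_norm.1 (hC hw)).trans (le_max_left _ _)⟩
  let N0 : Set E := (fun x => v + x) ⁻¹' N
  have hN0c : Convex ℝ N0 := hN.translate_preimage_right v
  have hN0 : N0 ∈ 𝓝 (0 : E) := (by fun_prop : Continuous fun x : E =>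
    v + x).continuousAt.preimage_mem_nhds (by simpa using hv)
  have hN0cl : IsClosed N0 := hNc.isClosed.preimage (by fun_prop)
  have hN0b : Bornology.IsVonNBounded ℝ N0 := by
    refine (NormedSpace.isVonNBounded_iff ℝ).2
      ((Metric.isBounded_closedBall (x := (0 : E)) (r := C)).subset ?_)
    intro x hx
    simpa using hCN _ hx
  have hle : ∀ x, gauge N0 x ≤ 1 ↔ v + x ∈ N := fun x => by
    rw [gauge_le_one_iff_mem_closure hN0c hN0, hN0cl.closure_eq]; rfl
  have hpos : ∀ w, w ≠ v → 0 < gauge N0 (w - v) := fun w hw =>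
    (gauge_pos (absorbent_nhds_zero hN0) hN0b).2 (sub_ne_zero.2 hw)
  have hcont := continuous_gauge hN0c hN0
  set δ := η / (2 * C) with hδ
  have hδ0 : 0 < δ := by positivity
  have hA' : ∀ x, gauge N0 x ≤ 1 + δ → v + x ∈ A := by
    intro x hx
    have h1 : gauge N0 ((1 + δ)⁻¹ • x) ≤ 1 := by
      rw [gauge_smul_of_nonneg (by positivity), smul_eq_mul]
      rw [inv_mul_le_iff₀ (by positivity)]; linarith
    have h2 := (hle _).1 h1
    refine hηA (Metric.mem_thickening_iff.2 ⟨_, h2, ?_⟩)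
    have h3 := hCN _ h2
    rw [add_sub_cancel_left] at h3
    have h4 : x = (1 + δ) • (1 + δ)⁻¹ • x := by
      rw [smul_smul, mul_inv_cancel₀ (by positivity), one_smul]
    rw [dist_eq_norm, add_sub_add_left_eq_sub]
    set y := (1 + δ)⁻¹ • x
    rw [h4, show (1 + δ) • y - y = δ • y by module, norm_smul, Real.norm_of_nonneg hδ0.le]
    have : δ * C = η / 2 := by rw [hδ]; field_simp
    nlinarith
  let l : ℝ → E → ℝ := fun u w => max 1 (1 + u * ((1 + δ) / gauge N0 (w - v) - 1))
  have hl1 : ∀ u w, 1 ≤ l u w := fun u w => le_max_left _ _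
  have hne : ∀ u w, w ≠ v → v + l u w • (w - v) ≠ v := by
    intro u w hw h
    have := (smul_eq_zero.1 (add_eq_left.1 h)).resolve_left (by linarith [hl1 u w])
    exact hw (sub_eq_zero.1 this)
  have hg : ∀ u w, gauge N0 (l u w • (w - v)) = l u w * gauge N0 (w - v) := fun u w => by
    rw [gauge_smul_of_nonneg (by linarith [hl1 u w]), smul_eq_mul]
  refine ⟨fun u w => v + l u w • (w - v), ?_, ?_, ?_, ?_, ?_⟩
  · have h1 : ContinuousOn (fun p : ℝ × E => gauge N0 (p.2 - v)) (Icc 0 1 ×ˢ {v}ᶜ) :=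
      (hcont.comp (by fun_prop)).continuousOn
    have h2 : ContinuousOn (fun p : ℝ × E => (1 + δ) / gauge N0 (p.2 - v)) (Icc 0 1 ×ˢ {v}ᶜ) :=
      continuousOn_const.div h1 fun p hp => (hpos _ hp.2).ne'
    refine continuousOn_const.add (ContinuousOn.smul (continuousOn_const.sup
      (continuousOn_const.add (continuousOn_fst.mul (h2.sub continuousOn_const)))) (by fun_prop))
  · intro w _; simp [l]
  · intro u hu w hw hwv
    refine ⟨?_, hne u w hwv⟩
    dsimp only
    rcases le_or_gt (1 + u * ((1 + δ) / gauge N0 (w - v) - 1)) 1 with h | h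
    · have : l u w = 1 := max_eq_left h
      rw [this, one_smul, add_sub_cancel]; exact hw
    · have h2 : l u w = _ := max_eq_right h.le
      have hp := hpos w hwv
      refine hA' _ ?_
      rw [hg, h2]
      have h3 : (1 + u * ((1 + δ) / gauge N0 (w - v) - 1)) * gauge N0 (w - v) =
          gauge N0 (w - v) + u * (1 + δ - gauge N0 (w - v)) := by field_simp
      rw [h3]
      by_cases h4 : gauge N0 (w - v) ≤ 1 + δ
      · nlinarith [hu.2]
      · exfalso
        have h6 : (1 + δ) / gauge N0 (w - v) < 1 := (div_lt_one hp).2 (not_le.1 h4)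
        nlinarith [hu.1]
  · intro u hu w hw h
    by_cases hwv : w = v
    · exact hw (hwv ▸ mem_of_mem_nhds hv)
    have h1 := (hle _).2 h
    rw [hg] at h1
    have h2 : ¬ gauge N0 (w - v) ≤ 1 := fun h => hw (by simpa using (hle _).1 h)
    nlinarith [hl1 u w, hpos w hwv]
  · intro w hwv h
    have h1 := (hle _).2 h
    have hp := hpos w hwv
    have h2 : (1 + δ) / gauge N0 (w - v) ≤ l 1 w := by
      refine le_trans (by linarith) (le_max_right _ _)
    rw [hg] at h1
    rw [div_le_iff₀ hp] at h2
    linarith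

end PuncturedConvex

section Fill

variable {F : Type} [NormedAddCommGroup F] [NormedSpace ℝ F]

/-- A coordinate box, parametrized by the pairs `(τ, w)` with `τ ∈ J` and `‖w‖ < R'`, is filled in
up to the lines `w = v`, `v ∈ V`. The lines are crossed one at a time in the order of the first
coordinate of `v`: those in `S` have been crossed. Every line but the last adds a sphere, and after
the last there is nothing left to attach. -/
theorem fill_box {Z : Type*} [MetricSpace Z] [FiniteDimensional ℝ F] {m : ℕ} (hm : finrank ℝ F = m)
    (e : OpenPartialHomeomorph (ℝ × (ℝ × F)) Z) {J : Set ℝ} (hJ : Convex ℝ J) (hJo : IsOpen J)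
    (hJn : J.Nonempty) (he : J ×ˢ univ ⊆ e.source) {R R' : ℝ} (hR : 0 < R) (hRR' : R < R')
    (V : Finset (ℝ × F)) : V.Nonempty → (∀ v ∈ V, v.1 < R ∧ ‖v.2‖ < R) →
      Set.InjOn Prod.fst (V : Set (ℝ × F)) → ∀ (S : Finset (ℝ × F)) (γ α : ℝ) (X : Set Z) (g : ℕ),
      (∀ s ∈ S, s.1 ≤ γ) → -R' ≤ γ → γ < α → (∀ v ∈ V, α < v.1) → IsOpen X →
      (∀ τ ∈ J, ∀ w : ℝ × F, |w.1| < R' → ‖w.2‖ < R' →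
        (e (τ, w) ∈ X ↔ w ∉ S ∧ (R < ‖w.2‖ ∨ w.1 < α ∨ R < w.1))) →
      Nonempty (X ≃ₕ bouquet g m) →
      Nonempty (↥(X ∪ e '' {p | p.1 ∈ J ∧ |p.2.1| < R' ∧ ‖p.2.2‖ < R' ∧ p.2 ∉ S ∧ p.2 ∉ V}) ≃ₕ
        bouquet (g + (V.card - 1)) m) := by
  classical
  have hfin : finrank ℝ (ℝ × F) = m + 1 := by rw [finrank_prod, finrank_self, hm, add_comm]
  have hR' : 0 < R' := hR.trans hRR'
  have hconv : ∀ a b : ℝ, Convex ℝ (Ioo a b ×ˢ Metric.ball (0 : F) R') := fun a b =>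
    (convex_Ioo a b).prod (convex_ball _ _)
  have hopen : ∀ a b : ℝ, IsOpen (Ioo a b ×ˢ Metric.ball (0 : F) R') := fun a b =>
    isOpen_Ioo.prod Metric.isOpen_ball
  refine Finset.induction_on_min_value (fun v : ℝ × F => v.1) V (fun h => absurd h (by simp)) ?_
  intro v V hvV hmin ih _ hVR hinj S γ α X g hS hγ hγα hα hX hXe eX
  have hv := hVR v (Finset.mem_insert_self _ _)
  have hvα := hα v (Finset.mem_insert_self _ _)
  rcases V.eq_empty_or_nonempty with rfl | hne
  · -- the last line is surrounded by a box, off which the points are pushed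
    have : ProperSpace F := FiniteDimensional.proper ℝ F
    have hNA : Icc α R ×ˢ Metric.closedBall (0 : F) R ⊆ Ioo γ R' ×ˢ Metric.ball (0 : F) R' :=
      prod_mono (fun x hx => ⟨hγα.trans_le hx.1, hx.2.trans_lt hRR'⟩)
        (Metric.closedBall_subset_ball hRR')
    obtain ⟨k, hk, hk0, hkA, hkN, hk1⟩ := exists_push_off_convex
      ((convex_Icc α R).prod (convex_closedBall (0 : F) R))
      (isCompact_Icc.prod (isCompact_closedBall 0 R)) (v := v)
      (prod_mem_nhds (Icc_mem_nhds hvα hv.1)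
        (mem_of_superset (Metric.isOpen_ball.mem_nhds (by simpa using hv.2))
          Metric.ball_subset_closedBall)) (hopen γ R') hNA
    have hiff : ∀ p : ℝ × (ℝ × F), p ∈ J ×ˢ (Ioo γ R' ×ˢ Metric.ball (0 : F) R' \ {v}) →
        (e p ∈ X ↔ p.2 ∉ Icc α R ×ˢ Metric.closedBall (0 : F) R) := by
      rintro ⟨τ, x, z⟩ ⟨hτ, ⟨⟨hx1, hx2⟩, hz⟩, -⟩
      dsimp only at hx1 hx2 hz hτ
      rw [mem_ball_zero_iff] at hz
      rw [hXe τ hτ (x, z) (abs_lt.2 ⟨by linarith, hx2⟩) hz]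
      have hxS : (x, z) ∉ S := fun h => by linarith [hS _ h]
      simp only [hxS, not_false_eq_true, true_and, mem_prod, mem_Icc, mem_closedBall_zero_iff,
        not_and_or, not_le]
      tauto
    have key := nonempty_homotopyEquiv_union_image_of_push e hX
      (B := J ×ˢ (Ioo γ R' ×ˢ Metric.ball (0 : F) R' \ {v}))
      (hJo.prod ((hopen γ R').sdiff isClosed_singleton))
      ((prod_mono subset_rfl (subset_univ _)).trans he) (fun u p => (p.1, k u p.2)) ?_
      (fun p hp => by rw [hk0 _ hp.2.2]) (fun u hu p hp => ⟨hp.1, hkA u hu _ hp.2.1 hp.2.2⟩)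
      (fun u hu p hp hpX => (hiff (p.1, k u p.2) ⟨hp.1, hkA u hu _ hp.2.1 hp.2.2⟩).2
        (hkN u hu _ ((hiff p hp).1 hpX)))
      (fun p hp => (hiff (p.1, k 1 p.2)
        ⟨hp.1, hkA 1 ⟨zero_le_one, le_rfl⟩ _ hp.2.1 hp.2.2⟩).2
        (hk1 _ hp.2.2))
    · have hset : X ∪ e '' (J ×ˢ (Ioo γ R' ×ˢ Metric.ball (0 : F) R' \ {v})) =
          X ∪ e '' {p | p.1 ∈ J ∧ |p.2.1| < R' ∧ ‖p.2.2‖ < R' ∧ p.2 ∉ S ∧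
            p.2 ∉ insert v (∅ : Finset (ℝ × F))} := by
        refine subset_antisymm (union_subset_union_right _ (image_mono ?_))
          (union_subset subset_union_left ?_)
        · rintro ⟨τ, x, z⟩ ⟨hτ, ⟨⟨hx1, hx2⟩, hz⟩, hw⟩
          dsimp only at hx1 hx2 hz hτ
          rw [mem_ball_zero_iff] at hz
          refine ⟨hτ, abs_lt.2 ⟨by linarith, hx2⟩, hz, fun h => ?_, by simpa using hw⟩
          have := hS _ h
          dsimp only at this
          linarith
        · rintro _ ⟨⟨τ, x, z⟩, ⟨hτ, hx, hz, hw, hwv⟩, rfl⟩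
          dsimp only at hτ hx hz hw
          rcases lt_or_ge γ x with h | h
          · exact Or.inr ⟨_, ⟨hτ, ⟨⟨h, (abs_lt.1 hx).2⟩, by simpa using hz⟩,
              by simpa using hwv⟩, rfl⟩
          · exact Or.inl ((hXe τ hτ (x, z) hx hz).2 ⟨hw, Or.inr (Or.inl (by simp only; linarith))⟩)
      rw [← hset]
      obtain ⟨e1⟩ := key
      obtain ⟨e2⟩ := eX
      exact ⟨e1.symm.trans e2⟩
    · refine continuousOn_fst.comp continuousOn_snd (fun p hp => mem_univ _) |>.prodMk ?_
      exact hk.comp (f := fun p : ℝ × (ℝ × (ℝ × F)) => (p.1, p.2.2)) (by fun_prop)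
        fun p hp => ⟨hp.1, hp.2.2.2⟩
  · -- the slab between the crossed lines and the next one contains the single line `v`
    have hlt : ∀ w ∈ V, v.1 < w.1 := fun w hw => lt_of_le_of_ne (hmin w hw) fun h => hvV (by
      rwa [hinj (Finset.mem_insert_self _ _) (Finset.mem_insert_of_mem hw) h])
    obtain ⟨β, hvβ, hβR, hβ⟩ : ∃ β, v.1 < β ∧ β < R ∧ ∀ w ∈ V, β < w.1 := by
      have h1 : ∀ᶠ β : ℝ in 𝓝[>] v.1, ∀ w ∈ V, β < w.1 := by
        rw [Finset.eventually_all]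
        exact fun w hw => mem_nhdsWithin_of_mem_nhds (Iio_mem_nhds (hlt w hw))
      obtain ⟨β, h2, h3⟩ := (h1.and (Ioo_mem_nhdsGT hv.1)).exists
      exact ⟨β, h3.1, h3.2, h2⟩
    -- the part of the slab `γ < w.1 < β` that is present contracts: first `w.1` moves to `κ < α`,
    -- where `w.2` is unrestricted, and then `τ` and `w.2` move
    obtain ⟨τ₀, hτ₀⟩ := hJn
    let κ : ℝ := (γ + α) / 2
    let k : ℝ → ℝ × (ℝ × F) → ℝ × (ℝ × F) := fun u p =>
      (p.1 + clampUnit (2 * u - 1) • (τ₀ - p.1), p.2.1 + clampUnit (2 * u) • (κ - p.2.1),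
        p.2.2 + clampUnit (2 * u - 1) • (0 - p.2.2))
    have hiff : ∀ p : ℝ × (ℝ × F), p ∈ J ×ˢ (Ioo γ β ×ˢ Metric.ball (0 : F) R') →
        (e p ∈ X ↔ R < ‖p.2.2‖ ∨ p.2.1 < α) := by
      rintro ⟨τ, x, z⟩ ⟨hτ, ⟨hx1, hx2⟩, hz⟩
      dsimp only at hx1 hx2 hz hτ
      rw [mem_ball_zero_iff] at hz
      rw [hXe τ hτ (x, z) (abs_lt.2 ⟨by linarith, by linarith⟩) hz]
      have hxS : (x, z) ∉ S := fun h => by linarith [hS _ h]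
      have hxR : ¬ R < x := by linarith
      simp [hxS, hxR]
    have hkB : ∀ u ∈ Icc (0 : ℝ) 1, ∀ p ∈ J ×ˢ (Ioo γ β ×ˢ Metric.ball (0 : F) R'),
        k u p ∈ J ×ˢ (Ioo γ β ×ˢ Metric.ball (0 : F) R') := by
      rintro u hu ⟨τ, x, z⟩ ⟨hτ, hx, hz⟩
      exact ⟨hJ.add_smul_sub_mem hτ hτ₀ (clampUnit_mem _),
        (convex_Ioo γ β).add_smul_sub_mem hx ⟨by simp only [κ]; linarith,
          by simp only [κ]; linarith⟩ (clampUnit_mem _),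
        (convex_ball _ _).add_smul_sub_mem hz (Metric.mem_ball_self hR') (clampUnit_mem _)⟩
    have hkX : ∀ u ∈ Icc (0 : ℝ) 1, ∀ p : ℝ × (ℝ × F), (R < ‖p.2.2‖ ∨ p.2.1 < α) →
        (R < ‖(k u p).2.2‖ ∨ (k u p).2.1 < α) := by
      rintro u hu ⟨τ, x, z⟩ hp
      simp only [k] at hp ⊢
      rcases le_total (2 * u) 1 with h | h
      · rw [clampUnit_of_le_zero (x := 2 * u - 1) (by linarith), zero_smul, add_zero]
        refine hp.imp id fun hx => ?_
        exact (convex_Iio α).add_smul_sub_mem hx (show κ < α by simp only [κ]; linarith)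
          (clampUnit_mem _)
      · right
        rw [clampUnit_of_one_le h, one_smul, add_sub_cancel]
        simp only [κ]; linarith
    have hv' : ∀ p : ℝ × (ℝ × F), (R < ‖p.2.2‖ ∨ p.2.1 < α) → p.2 ≠ v := by
      rintro ⟨τ, w⟩ hp rfl
      rcases hp with h | h
      · exact absurd hv.2 h.not_gt
      · exact absurd hvα h.not_gt
    have hd : ∀ p : ℝ × (ℝ × F), p ∈ J ×ˢ (Ioo γ β ×ˢ Metric.ball (0 : F) R' \ {v}) →
        p ∈ J ×ˢ (Ioo γ β ×ˢ Metric.ball (0 : F) R') := fun p hp => ⟨hp.1, hp.2.1⟩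
    have ht : (τ₀, κ, (0 : F)) ∈ J ×ˢ (Ioo γ β ×ˢ Metric.ball (0 : F) R') :=
      ⟨hτ₀, ⟨by simp only [κ]; linarith, by simp only [κ]; linarith⟩, Metric.mem_ball_self hR'⟩
    have ht' : R < ‖(τ₀, κ, (0 : F)).2.2‖ ∨ (τ₀, κ, (0 : F)).2.1 < α :=
      Or.inr (by simp only [κ]; linarith)
    have hBo : IsOpen (J ×ˢ (Ioo γ β ×ˢ Metric.ball (0 : F) R' \ {v})) :=
      hJo.prod ((hopen γ β).sdiff isClosed_singleton)
    have hBe : J ×ˢ (Ioo γ β ×ˢ Metric.ball (0 : F) R' \ {v}) ⊆ e.source :=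
      (prod_mono subset_rfl (subset_univ _)).trans he
    have key := nonempty_union_image_homotopyEquiv_bouquet e hX
      (B := J ×ˢ (Ioo γ β ×ˢ Metric.ball (0 : F) R' \ {v})) (t := (τ₀, κ, 0)) hBo hBe
      ((hiff _ ht).2 ht') ⟨ht.1, ht.2, hv' _ ht'⟩ k ?_ ?_ ?_ ?_ ?_ eX
      (nonempty_prod_set_homotopyEquiv hJ ⟨τ₀, hτ₀⟩
        (nonempty_convex_diff_singleton_homotopyEquiv hfin (hconv γ β) (hopen γ β)
          ⟨⟨hγα.trans hvα, hvβ⟩, by simpa using hv.2.trans hRR'⟩))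
    · have hX' := hX.union (e.isOpen_image_of_subset_source hBo hBe)
      have := ih hne (fun w hw => hVR w (Finset.mem_insert_of_mem hw))
        (hinj.mono (by simp)) (insert v S) v.1 β _ (g + 1) ?_ (by linarith) hvβ hβ hX' ?_ key
      · have hset : X ∪ e '' (J ×ˢ (Ioo γ β ×ˢ Metric.ball (0 : F) R' \ {v})) ∪
            e '' {p | p.1 ∈ J ∧ |p.2.1| < R' ∧ ‖p.2.2‖ < R' ∧ p.2 ∉ insert v S ∧ p.2 ∉ V} =
            X ∪ e '' {p | p.1 ∈ J ∧ |p.2.1| < R' ∧ ‖p.2.2‖ < R' ∧ p.2 ∉ S ∧ p.2 ∉ insert v V} := by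
          have h1 : {p : ℝ × (ℝ × F) | p.1 ∈ J ∧ |p.2.1| < R' ∧ ‖p.2.2‖ < R' ∧ p.2 ∉ insert v S ∧
              p.2 ∉ V} =
              {p | p.1 ∈ J ∧ |p.2.1| < R' ∧ ‖p.2.2‖ < R' ∧ p.2 ∉ S ∧ p.2 ∉ insert v V} := by
            ext p
            simp only [Finset.mem_insert, not_or, mem_ofPred_eq]
            tauto
          rw [h1, union_assoc, ← image_union]
          congr 2
          refine union_eq_self_of_subset_left ?_
          rintro ⟨τ, x, z⟩ ⟨hτ, ⟨⟨hx1, hx2⟩, hz⟩, hw⟩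
          dsimp only at hx1 hx2 hz hτ
          rw [mem_ball_zero_iff] at hz
          refine ⟨hτ, abs_lt.2 ⟨by linarith, by linarith⟩, hz, fun h => ?_, fun h => ?_⟩
          · have := hS _ h
            dsimp only at this
            linarith
          · rcases Finset.mem_insert.1 h with h | h
            · exact hw h
            · have := hβ _ h
              dsimp only at this
              linarith
        have hcard : g + 1 + (V.card - 1) = g + ((insert v V).card - 1) := by
          rw [Finset.card_insert_of_notMem hvV]
          have := hne.card_pos
          omega
        rwa [hset, hcard] at this
      · intro s hs
        rcases Finset.mem_insert.1 hs with rfl | hs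
        · exact le_rfl
        · linarith [hS s hs]
      · rintro τ hτ ⟨x, z⟩ hx hz
        have hmem : e (τ, x, z) ∈ e '' (J ×ˢ (Ioo γ β ×ˢ Metric.ball (0 : F) R' \ {v})) ↔
            (γ < x ∧ x < β) ∧ (x, z) ≠ v := by
          rw [e.injOn.mem_image_iff hBe (he ⟨hτ, mem_univ _⟩)]
          simp only [mem_prod, Set.mem_sdiff, mem_Ioo, mem_ball_zero_iff, mem_singleton_iff]
          tauto
        rw [mem_union, hXe τ hτ (x, z) hx hz, hmem, Finset.mem_insert, not_or]
        dsimp only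
        constructor
        · rintro (⟨h1, h2⟩ | ⟨h1, h2⟩)
          · refine ⟨⟨?_, h1⟩, ?_⟩
            · rintro rfl
              dsimp only at hv hvα
              rcases h2 with h2 | h2 | h2 <;> linarith
            · rcases h2 with h2 | h2 | h2
              · exact Or.inl h2
              · exact Or.inr (Or.inl (by linarith))
              · exact Or.inr (Or.inr h2)
          · refine ⟨⟨h2, fun h => ?_⟩, Or.inr (Or.inl h1.2)⟩
            have := hS _ h
            dsimp only at this
            linarith
        · rintro ⟨⟨h1, h2⟩, h3⟩
          rcases h3 with h3 | h3 | h3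
          · exact Or.inl ⟨h2, Or.inl h3⟩
          · rcases lt_or_ge γ x with h4 | h4
            · exact Or.inr ⟨⟨h4, h3⟩, h1⟩
            · exact Or.inl ⟨h2, Or.inr (Or.inl (by linarith))⟩
          · exact Or.inl ⟨h2, Or.inr (Or.inr h3)⟩
    · exact Continuous.continuousOn (by fun_prop)
    · intro u hu p hp hpX
      have h1 := hkB u hu p (hd p hp)
      have h2 := hkX u hu p ((hiff p (hd p hp)).1 hpX)
      exact ⟨⟨h1.1, h1.2, hv' _ h2⟩, (hiff _ h1).2 h2⟩
    · rintro ⟨τ, x, z⟩ -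
      simp only [k]
      rw [clampUnit_of_le_zero (by norm_num), clampUnit_of_le_zero (by norm_num)]
      simp
    · rintro ⟨τ, x, z⟩ -
      simp only [k]
      rw [clampUnit_of_one_le (by norm_num), clampUnit_of_one_le (by norm_num)]
      simp
    · intro u hu
      simp [k]

end Fill

end Cluster

/-! ### Slabs that begin or end at a collision -/

section Slabs

open Set Topology Filter Module

/-- The lines that pass through `q` at time `t`. -/
noncomputable def linesThrough {E : Type*} [NormedAddCommGroup E] [NormedSpace ℝ E]
    (L : Finset (E × E)) (t : ℝ) (q : E) : Finset (E × E) :=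
  open scoped Classical in L.filter fun p => p.1 + t • p.2 = q

section Cone

variable {E : Type*} [NormedAddCommGroup E] [NormedSpace ℝ E]

lemma mem_linesThrough {L : Finset (E × E)} {t : ℝ} {q : E} {p : E × E} :
    p ∈ linesThrough L t q ↔ p ∈ L ∧ p.1 + t • p.2 = q := by
  classical
  exact Finset.mem_filter

lemma mem_slicePoints_iff {L : Finset (E × E)} {t : ℝ} {q : E} :
    q ∈ slicePoints L t ↔ ∃ p ∈ L, p.1 + t • p.2 = q := by
  classical
  exact Finset.mem_image

/-- The coordinates `(τ, w)` of the point `(t₀ + τ, q + τ • w)`, in which the lines through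
`(t₀, q)` are parallel. -/
noncomputable def coneChart (t₀ : ℝ) (q : E) : OpenPartialHomeomorph (ℝ × E) (ℝ × E) where
  toFun p := (t₀ + p.1, q + p.1 • p.2)
  invFun z := (z.1 - t₀, (z.1 - t₀)⁻¹ • (z.2 - q))
  source := Ioi 0 ×ˢ univ
  target := Ioi t₀ ×ˢ univ
  map_source' p hp := ⟨by simpa using hp.1, mem_univ _⟩
  map_target' p hp := ⟨by simpa using hp.1, mem_univ _⟩
  left_inv' p hp := by
    have : p.1 ≠ 0 := ne_of_gt hp.1
    simp [smul_smul, this]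
  right_inv' p hp := by
    have : p.1 - t₀ ≠ 0 := sub_ne_zero.2 (ne_of_gt hp.1)
    simp [smul_smul, this]
  open_source := isOpen_Ioi.prod isOpen_univ
  open_target := isOpen_Ioi.prod isOpen_univ
  continuousOn_toFun := by fun_prop
  continuousOn_invFun := by
    refine ContinuousOn.prodMk (by fun_prop) (ContinuousOn.smul (ContinuousOn.inv₀ (by fun_prop)
      fun p hp => sub_ne_zero.2 (ne_of_gt hp.1)) (by fun_prop))

lemma coneChart_apply (t₀ : ℝ) (q : E) (p : ℝ × E) :
    coneChart t₀ q p = (t₀ + p.1, q + p.1 • p.2) := rfl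

/-- The part of the complement of the lines outside the solid cones of slope `R` with apices
`(t₀, q)`, `q ∈ Q`. -/
def coneComplement (L : Finset (E × E)) (I : Set ℝ) (t₀ R : ℝ) (Q : Set E) : Set (ℝ × E) :=
  {z | z ∈ lineComplement L I ∧ ∀ q ∈ Q, R * (z.1 - t₀) < ‖z.2 - q‖}

lemma isOpen_lineComplement (L : Finset (E × E)) {I : Set ℝ} (hI : IsOpen I) :
    IsOpen (lineComplement L I) := by
  have : lineComplement L I = Prod.fst ⁻¹' I ∩ ⋂ p ∈ L, {z : ℝ × E | z.2 ≠ p.1 + z.1 • p.2} := by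
    ext z; simp [lineComplement]
  rw [this]
  exact (hI.preimage continuous_fst).inter (isOpen_biInter_finset fun p _ =>
    isOpen_ne_fun (by fun_prop) (by fun_prop))

lemma isOpen_coneComplement (L : Finset (E × E)) {I : Set ℝ} (hI : IsOpen I) (t₀ R : ℝ) {Q : Set E}
    (hQ : Q.Finite) : IsOpen (coneComplement L I t₀ R Q) := by
  have : coneComplement L I t₀ R Q = lineComplement L I ∩
      ⋂ q ∈ Q, {z : ℝ × E | R * (z.1 - t₀) < ‖z.2 - q‖} := by
    ext z; simp [coneComplement]
  rw [this]
  exact (isOpen_lineComplement L hI).inter (hQ.isOpen_biInter fun q _ =>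
    isOpen_lt (by fun_prop) (by fun_prop))

/-- A line lies inside the double cone of slope `R` around each of its points if its own slope is
smaller than `R`. -/
lemma ne_line_of_le {p : E × E} {t₀ R : ℝ} (hp : ‖p.2‖ < R) {z : ℝ × E} (hz : z.1 ≠ t₀)
    (h : R * |z.1 - t₀| ≤ ‖z.2 - (p.1 + t₀ • p.2)‖) : z.2 ≠ p.1 + z.1 • p.2 := by
  intro h1
  rw [h1, show p.1 + z.1 • p.2 - (p.1 + t₀ • p.2) = (z.1 - t₀) • p.2 by module, norm_smul,
    Real.norm_eq_abs] at h
  have := abs_pos.2 (sub_ne_zero.2 hz)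
  nlinarith

/-- The coordinate box of radius `2 * R` at one apex is disjoint from the cone of slope `R` at
another apex, as long as the slab is thin. -/
lemma lt_norm_coneChart_sub {t₀ R D τ : ℝ} (hτ : τ ∈ Ioo 0 D) {q q' w : E}
    (hw : ‖w‖ < 2 * R) (hq : 4 * R * D ≤ ‖q - q'‖) : R * τ < ‖(coneChart t₀ q (τ, w)).2 - q'‖ := by
  rw [coneChart_apply]
  have h1 : ‖q - q'‖ ≤ ‖q + τ • w - q'‖ + ‖τ • w‖ := by
    have := norm_sub_le (q + τ • w - q') (τ • w)
    rwa [show q + τ • w - q' - τ • w = q - q' by abel] at this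
  rw [norm_smul, Real.norm_of_nonneg hτ.1.le] at h1
  have h2 : 0 < R := by linarith [norm_nonneg w]
  have h3 := mul_lt_mul_of_pos_left hw hτ.1
  have h4 := mul_lt_mul_of_pos_left hτ.2 h2
  dsimp only
  nlinarith [mul_pos h2 hτ.1]

end Cone

variable {F : Type} [NormedAddCommGroup F] [NormedSpace ℝ F]

/-- Families of lines in generic position with respect to the first coordinate: two lines either
have different first slopes, or are parallel and have different first coordinates. -/
def IsGenericFamily (L : Finset ((ℝ × F) × (ℝ × F))) : Prop :=
  ∀ p ∈ L, ∀ p' ∈ L, p ≠ p' → p.2.1 ≠ p'.2.1 ∨ (p.2 = p'.2 ∧ p.1.1 ≠ p'.1.1)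

variable [FiniteDimensional ℝ F] {m : ℕ}

/-- The complement of the lines arises from the complement of the cones by filling in the cones. -/
theorem fill_cones (hm : finrank ℝ F = m) {L : Finset ((ℝ × F) × (ℝ × F))} (hL : IsGenericFamily L)
    {a t₀ s R : ℝ} (ha : a ≤ t₀) (hs : t₀ < s) (hR : 0 < R) (hRL : ∀ p ∈ L, ‖p.2‖ < R)
    (hsep : ∀ q ∈ slicePoints L t₀, ∀ q' ∈ slicePoints L t₀, q ≠ q' → 4 * R * (s - t₀) ≤ ‖q - q'‖)
    {g : ℕ} (h : Nonempty (coneComplement L (Ioo a s) t₀ R (slicePoints L t₀) ≃ₕ bouquet g m)) :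
    Nonempty (lineComplement L (Ioo a s) ≃ₕ
      bouquet (g + ∑ q ∈ slicePoints L t₀, ((linesThrough L t₀ q).card - 1)) m) := by
  classical
  have hD : 0 < s - t₀ := by linarith
  have key : ∀ Q ⊆ slicePoints L t₀,
      Nonempty (coneComplement L (Ioo a s) t₀ R (slicePoints L t₀ \ Q : Finset (ℝ × F)) ≃ₕ
        bouquet (g + ∑ q ∈ Q, ((linesThrough L t₀ q).card - 1)) m) := by
    intro Q
    induction Q using Finset.induction_on with
    | empty =>
      intro _
      rwa [Finset.sdiff_empty, Finset.sum_empty, add_zero]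
    | insert q Q hqQ ih =>
      intro hQ
      have hq : q ∈ slicePoints L t₀ := hQ (Finset.mem_insert_self _ _)
      have hnorm : ∀ w : ℝ × F, |w.1| < 2 * R → ‖w.2‖ < 2 * R → ‖w‖ < 2 * R := fun w h1 h2 =>
        max_lt h1 h2
      -- outside its own cone, a point of the chart is off all lines and all other cones
      have hcone : ∀ q' ∈ slicePoints L t₀, q' ≠ q → ∀ τ ∈ Ioo 0 (s - t₀), ∀ w : ℝ × F,
          ‖w‖ < 2 * R → R * τ < ‖(coneChart t₀ q (τ, w)).2 - q'‖ := fun q' hq' hne τ hτ w hw =>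
        lt_norm_coneChart_sub hτ hw (hsep q hq q' hq' hne.symm)
      have hline : ∀ p ∈ L, p.1 + t₀ • p.2 ≠ q → ∀ τ ∈ Ioo 0 (s - t₀), ∀ w : ℝ × F,
          ‖w‖ < 2 * R → (coneChart t₀ q (τ, w)).2 ≠ p.1 + (t₀ + τ) • p.2 := by
        intro p hp hne τ hτ w hw
        have h1 := hcone _ (mem_slicePoints hp t₀) hne τ hτ w hw
        refine ne_line_of_le (z := coneChart t₀ q (τ, w)) (t₀ := t₀) (hRL p hp) ?_ ?_
        · simpa [coneChart_apply] using hτ.1.ne'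
        · rw [coneChart_apply, add_sub_cancel_left, abs_of_pos hτ.1]
          exact h1.le
      have hline' : ∀ p ∈ L, p.1 + t₀ • p.2 = q → ∀ τ ∈ Ioo 0 (s - t₀), ∀ w : ℝ × F,
          (coneChart t₀ q (τ, w)).2 = p.1 + (t₀ + τ) • p.2 ↔ w = p.2 := by
        rintro p hp rfl τ hτ w
        rw [coneChart_apply, add_smul, ← add_assoc, add_right_inj]
        exact smul_right_inj hτ.1.ne'
      have hinj : InjOn Prod.fst ((linesThrough L t₀ q).image Prod.snd : Set (ℝ × F)) := by
        intro b hb b' hb' hbb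
        simp only [Finset.coe_image, mem_image, Finset.mem_coe, mem_linesThrough] at hb hb'
        obtain ⟨p, ⟨hp, hpq⟩, rfl⟩ := hb
        obtain ⟨p', ⟨hp', hpq'⟩, rfl⟩ := hb'
        by_cases hpp : p = p'
        · rw [hpp]
        · exact ((hL p hp p' hp' hpp).resolve_left (not_not.2 hbb)).1
      have hsnd : InjOn Prod.snd (linesThrough L t₀ q : Set ((ℝ × F) × (ℝ × F))) := by
        intro p hp p' hp' hpp
        simp only [Finset.mem_coe, mem_linesThrough] at hp hp'
        refine Prod.ext ?_ hpp
        have := hp.2.trans hp'.2.symm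
        rw [hpp] at this
        exact add_right_cancel this
      have hcard : ((linesThrough L t₀ q).image Prod.snd).card = (linesThrough L t₀ q).card :=
        Finset.card_image_of_injOn hsnd
      have hfill := fill_box hm (coneChart t₀ q) (J := Ioo 0 (s - t₀)) (convex_Ioo _ _) isOpen_Ioo
        (nonempty_Ioo.2 hD) (prod_mono (fun x hx => hx.1) subset_rfl) hR
        (by linarith : R < 2 * R) ((linesThrough L t₀ q).image Prod.snd) ?_ ?_ hinj ∅ (-(2 * R))
        (-R) (coneComplement L (Ioo a s) t₀ R (slicePoints L t₀ \ Q : Finset (ℝ × F)))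
        _ (by simp) le_rfl (by linarith) ?_
        (isOpen_coneComplement L isOpen_Ioo _ _ (Finset.finite_toSet _)) ?_
        (ih ((Finset.subset_insert _ _).trans hQ))
      · rw [hcard] at hfill
        rw [Finset.sum_insert hqQ, add_comm (_ - 1), ← add_assoc]
        suffices hset : coneComplement L (Ioo a s) t₀ R
            (slicePoints L t₀ \ insert q Q : Finset (ℝ × F)) =
            coneComplement L (Ioo a s) t₀ R (slicePoints L t₀ \ Q : Finset (ℝ × F)) ∪
            coneChart t₀ q '' {p | p.1 ∈ Ioo 0 (s - t₀) ∧ |p.2.1| < 2 * R ∧ ‖p.2.2‖ < 2 * R ∧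
              p.2 ∉ (∅ : Finset (ℝ × F)) ∧ p.2 ∉ (linesThrough L t₀ q).image Prod.snd} by
          rwa [hset]
        ext z
        constructor
        · intro hz
          by_cases hzq : R * (z.1 - t₀) < ‖z.2 - q‖
          · left
            refine ⟨hz.1, fun q' hq' => ?_⟩
            by_cases hqq : q' = q
            · rwa [hqq]
            · refine hz.2 q' ?_
              simp only [Finset.coe_sdiff, Set.mem_sdiff, Finset.mem_coe,
                Finset.mem_insert] at hq' ⊢
              tauto
          · right
            obtain ⟨p, hp, hpq⟩ := mem_slicePoints_iff.1 hq
            have hzt : t₀ < z.1 := by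
              rcases lt_trichotomy z.1 t₀ with h1 | h1 | h1
              · nlinarith [norm_nonneg (z.2 - q)]
              · refine absurd ?_ (hz.1.2 p hp)
                rw [h1, hpq]
                rw [h1, sub_self, mul_zero, not_lt, norm_le_zero_iff, sub_eq_zero] at hzq
                exact hzq
              · exact h1
            have hτ : z.1 - t₀ ∈ Ioo 0 (s - t₀) := ⟨by linarith, by linarith [hz.1.1.2]⟩
            have hinv := (coneChart t₀ q).right_inv (x := z) ⟨hzt, mem_univ _⟩
            have hsymm : (coneChart t₀ q).symm z = (z.1 - t₀, (z.1 - t₀)⁻¹ • (z.2 - q)) := rfl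
            rw [hsymm] at hinv
            have hw : ‖(z.1 - t₀)⁻¹ • (z.2 - q)‖ < 2 * R := by
              rw [norm_smul, norm_inv, Real.norm_of_nonneg hτ.1.le, inv_mul_lt_iff₀ hτ.1]
              nlinarith [hτ.1]
            refine ⟨_, ⟨hτ, (norm_fst_le _).trans_lt hw, (norm_snd_le _).trans_lt hw,
              by simp, ?_⟩, hinv⟩
            simp only [Finset.mem_image, mem_linesThrough]
            rintro ⟨p', ⟨hp', hpq'⟩, h1⟩
            have h2 := (hline' p' hp' hpq' _ hτ _).2 h1.symm
            rw [hinv] at h2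
            refine hz.1.2 p' hp' ?_
            rwa [add_sub_cancel] at h2
        · rintro (hz | ⟨⟨τ, w⟩, ⟨hτ, hw1, hw2, -, hw⟩, rfl⟩)
          · refine ⟨hz.1, fun q' hq' => hz.2 q' ?_⟩
            simp only [Finset.coe_sdiff, Set.mem_sdiff, Finset.mem_coe,
                Finset.mem_insert] at hq' ⊢
            tauto
          · dsimp only at hτ hw1 hw2 hw
            have hw' := hnorm w hw1 hw2
            refine ⟨⟨⟨by simp only [coneChart_apply]; linarith [hτ.1],
              by simp only [coneChart_apply]; linarith [hτ.2]⟩, fun p hp => ?_⟩, fun q' hq' => ?_⟩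
            · by_cases hpq : p.1 + t₀ • p.2 = q
              · intro h1
                refine hw (Finset.mem_image.2 ⟨p, mem_linesThrough.2 ⟨hp, hpq⟩, ?_⟩)
                exact ((hline' p hp hpq τ hτ w).1 h1).symm
              · exact hline p hp hpq τ hτ w hw'
            · simp only [Finset.coe_sdiff, Set.mem_sdiff, Finset.mem_coe, Finset.mem_insert,
                not_or] at hq'
              have := hcone q' hq'.1 hq'.2.1 τ hτ w hw'
              rwa [coneChart_apply, add_sub_cancel_left]
      · obtain ⟨p, hp, hpq⟩ := mem_slicePoints_iff.1 hq
        exact ⟨p.2, Finset.mem_image_of_mem _ (mem_linesThrough.2 ⟨hp, hpq⟩)⟩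
      · intro b hb
        simp only [Finset.mem_image, mem_linesThrough] at hb
        obtain ⟨p, ⟨hp, -⟩, rfl⟩ := hb
        exact ⟨(le_abs_self _).trans_lt ((norm_fst_le _).trans_lt (hRL p hp)),
          (norm_snd_le _).trans_lt (hRL p hp)⟩
      · intro b hb
        simp only [Finset.mem_image, mem_linesThrough] at hb
        obtain ⟨p, ⟨hp, -⟩, rfl⟩ := hb
        exact (abs_lt.1 ((norm_fst_le _).trans_lt (hRL p hp))).1
      · intro τ hτ w hw1 hw2
        have hw' := hnorm w hw1 hw2
        have hwR : R * τ < ‖(coneChart t₀ q (τ, w)).2 - q‖ ↔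
            (R < ‖w.2‖ ∨ w.1 < -R ∨ R < w.1) := by
          rw [coneChart_apply, add_sub_cancel_left, norm_smul, Real.norm_of_nonneg hτ.1.le,
            mul_comm R, mul_lt_mul_iff_right₀ hτ.1, Prod.norm_def, lt_max_iff, Real.norm_eq_abs,
            lt_abs, lt_neg]
          tauto
        rw [← hwR]
        constructor
        · intro hX
          refine ⟨by simp, ?_⟩
          have := hX.2 q (by simp [hq, hqQ])
          rwa [coneChart_apply, add_sub_cancel_left] at this
        · rintro ⟨-, hR'⟩
          refine ⟨⟨⟨by simp only [coneChart_apply]; linarith [hτ.1],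
              by simp only [coneChart_apply]; linarith [hτ.2]⟩, fun p hp => ?_⟩, fun q' hq' => ?_⟩
          · by_cases hpq : p.1 + t₀ • p.2 = q
            · refine ne_line_of_le (z := coneChart t₀ q (τ, w)) (t₀ := t₀) (hRL p hp) ?_ ?_
              · simpa [coneChart_apply] using hτ.1.ne'
              · rw [hpq, coneChart_apply, add_sub_cancel_left, abs_of_pos hτ.1]
                exact hR'.le
            · exact hline p hp hpq τ hτ w hw'
          · by_cases hqq : q' = q
            · subst hqq
              rwa [coneChart_apply, add_sub_cancel_left]
            · simp only [Finset.coe_sdiff, Set.mem_sdiff, Finset.mem_coe] at hq'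
              have := hcone q' hq'.1 hqq τ hτ w hw'
              rwa [coneChart_apply, add_sub_cancel_left]
  have h1 := key _ subset_rfl
  have h2 : coneComplement L (Ioo a s) t₀ R
      (slicePoints L t₀ \ slicePoints L t₀ : Finset (ℝ × F)) = lineComplement L (Ioo a s) := by
    ext z; simp [coneComplement]
  rwa [h2] at h1

end Slabs

/-! ### Crossing one collision time -/

section Crossing

open Set Topology Filter Module

lemma slicePoints_nonempty {E : Type*} [NormedAddCommGroup E] [NormedSpace ℝ E]
    {L : Finset (E × E)} (hL : L.Nonempty) (t : ℝ) : (slicePoints L t).Nonempty :=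
  let ⟨_, hp⟩ := hL
  ⟨_, mem_slicePoints hp t⟩

lemma card_slicePoints {E : Type*} [NormedAddCommGroup E] [NormedSpace ℝ E] {L : Finset (E × E)}
    {t : ℝ} (h : InjOn (fun p : E × E => p.1 + t • p.2) L) : (slicePoints L t).card = L.card := by
  classical
  exact Finset.card_image_of_injOn h

lemma exists_mem_lt_infDist {E : Type*} [NormedAddCommGroup E] {P : Finset E} (hP : P.Nonempty)
    {y : E} {r : ℝ} (h : ∀ q ∈ P, r < ‖y - q‖) : r < Metric.infDist y P := by
  obtain ⟨q, hq, h1⟩ := P.finite_toSet.isCompact.exists_infDist_eq_dist hP y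
  rw [h1, dist_eq_norm]
  exact h q hq

lemma infDist_le_norm_sub {E : Type*} [NormedAddCommGroup E] {P : Finset E} {q : E} (hq : q ∈ P)
    (y : E) : Metric.infDist y P ≤ ‖y - q‖ := by
  rw [← dist_eq_norm]
  exact Metric.infDist_le_dist_of_mem hq

/-- The complement of the cones is deformed into the past of the apices: a point off the cones is
moved back in time at a constant place, until it has left the reflected cones as well. Between the
cones and their reflections there are no lines. -/
lemma nonempty_coneComplement_homotopyEquiv {E : Type*} [NormedAddCommGroup E] [NormedSpace ℝ E]
    {L : Finset (E × E)} (hne : L.Nonempty) {a t₀ s R : ℝ} (hs : t₀ < s)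
    (hsa : s - t₀ < t₀ - a) (hR : 0 < R) (hRL : ∀ p ∈ L, ‖p.2‖ < R) :
    Nonempty (lineComplement L (Ioo a t₀) ≃ₕ
      coneComplement L (Ioo a s) t₀ R (slicePoints L t₀)) := by
  classical
  have hP : (slicePoints L t₀).Nonempty := slicePoints_nonempty hne _
  set P := slicePoints L t₀ with hPdef
  -- the cones and their reflections leave free the times within `w y` of `t₀`
  let w : E → ℝ := fun y => min (Metric.infDist y P / R) (s - t₀)
  have hw0 : ∀ y, 0 ≤ w y := fun y => le_min (div_nonneg Metric.infDist_nonneg hR.le) (by linarith)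
  have hwD : ∀ y, w y ≤ s - t₀ := fun y => min_le_right _ _
  have hwq : ∀ y, ∀ q ∈ P, R * w y ≤ ‖y - q‖ := fun y q hq => by
    have h1 : w y ≤ Metric.infDist y P / R := min_le_left _ _
    rw [le_div_iff₀ hR] at h1
    linarith [infDist_le_norm_sub hq y]
  let τ : ℝ → ℝ × E → ℝ := fun u z => z.1 - u * max 0 (z.1 - (t₀ - w z.2))
  have hτle : ∀ u ∈ Icc (0 : ℝ) 1, ∀ z, τ u z ≤ z.1 := fun u hu z =>
    sub_le_self _ (mul_nonneg hu.1 (le_max_left _ _))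
  have hτge : ∀ u ∈ Icc (0 : ℝ) 1, ∀ z, t₀ - w z.2 ≤ z.1 → t₀ - w z.2 ≤ τ u z := by
    intro u hu z h
    simp only [τ]
    rw [max_eq_right (by linarith)]
    nlinarith [hu.2]
  have hτeq : ∀ u z, z.1 ≤ t₀ - w z.2 → τ u z = z.1 := by
    intro u z h
    simp only [τ]
    rw [max_eq_left (by linarith), mul_zero, sub_zero]
  have hτa : ∀ u ∈ Icc (0 : ℝ) 1, ∀ z : ℝ × E, a < z.1 → a < τ u z := by
    intro u hu z hz
    rcases le_total z.1 (t₀ - w z.2) with h | h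
    · rwa [hτeq u z h]
    · linarith [hτge u hu z h, hwD z.2]
  have hX : ∀ z ∈ coneComplement L (Ioo a s) t₀ R (P : Set E), z.1 - t₀ < w z.2 := by
    intro z hz
    refine lt_min ?_ (by linarith [hz.1.1.2])
    rw [lt_div_iff₀ hR, mul_comm]
    exact exists_mem_lt_infDist hP hz.2
  have hmem : ∀ u ∈ Icc (0 : ℝ) 1, ∀ z ∈ coneComplement L (Ioo a s) t₀ R (P : Set E),
      (τ u z, z.2) ∈ coneComplement L (Ioo a s) t₀ R (P : Set E) := by
    intro u hu z hz
    have hle := hτle u hu z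
    refine ⟨⟨⟨hτa u hu z hz.1.1.1, hle.trans_lt hz.1.1.2⟩, fun p hp => ?_⟩, fun q hq => ?_⟩
    · rcases le_total z.1 (t₀ - w z.2) with h | h
      · rw [hτeq u z h]; exact hz.1.2 p hp
      · have h1 := hτge u hu z h
        have h2 := hX z hz
        have h3 := hwq z.2 _ (mem_slicePoints hp t₀)
        by_cases h4 : τ u z = t₀
        · rw [h4]
          intro h5
          dsimp only at h5
          rw [sub_eq_zero.2 h5, norm_zero] at h3
          exact (mul_pos hR (show 0 < w z.2 by linarith)).not_ge h3
        · refine ne_line_of_le (z := (τ u z, z.2)) (hRL p hp) h4 (le_trans ?_ h3)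
          exact mul_le_mul_of_nonneg_left (abs_le.2 ⟨by linarith, by linarith⟩) hR.le
    · exact (mul_le_mul_of_nonneg_left (by linarith) hR.le).trans_lt (hz.2 q hq)
  have hYX : lineComplement L (Ioo a t₀) ⊆ coneComplement L (Ioo a s) t₀ R (P : Set E) :=
    fun z hz => ⟨⟨⟨hz.1.1, hz.1.2.trans hs⟩, hz.2⟩, fun q _ => by
      have := hz.1.2
      nlinarith [norm_nonneg (z.2 - q)]⟩
  refine nonempty_homotopyEquiv_of_push hYX (fun u z => (τ u z, z.2)) ?_ ?_ hmem ?_ ?_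
  · have : Continuous fun y => Metric.infDist y (P : Set E) := Metric.continuous_infDist_pt _
    refine Continuous.continuousOn ?_
    have hwc : Continuous w := (this.div_const R).min continuous_const
    have : Continuous fun p : ℝ × ℝ × E => τ p.1 p.2 := by fun_prop
    fun_prop
  · rintro ⟨t, y⟩ -
    simp [τ]
  · intro u hu z hz
    have h1 := hmem u hu z (hYX hz)
    exact ⟨⟨h1.1.1.1, (hτle u hu z).trans_lt hz.1.2⟩, h1.1.2⟩
  · intro z hz
    have h1 := hmem 1 ⟨zero_le_one, le_rfl⟩ z hz
    refine ⟨⟨h1.1.1.1, ?_⟩, h1.1.2⟩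
    have h2 := hX z hz
    dsimp only
    rcases le_or_gt z.1 (t₀ - w z.2) with h | h
    · rw [hτeq 1 z h]; linarith
    · simp only [τ, one_mul]
      rw [max_eq_right (by linarith)]
      linarith

lemma nonempty_norm_gt_homotopyEquiv {E : Type*} [NormedAddCommGroup E] [NormedSpace ℝ E]
    [FiniteDimensional ℝ E] {m : ℕ} (hm : finrank ℝ E = m + 1) {R : ℝ} (hR : 0 < R) :
    Nonempty ({w : E | R < ‖w‖} ≃ₕ UnitSphere m) := by
  obtain ⟨e1⟩ := nonempty_convex_diff_singleton_homotopyEquiv hm (convex_univ (𝕜 := ℝ))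
    isOpen_univ (mem_univ (0 : E))
  have hne : ∀ w : E, w ∈ univ \ {0} → 0 < ‖w‖ := fun w hw => norm_pos_iff.2 hw.2
  have hl : ∀ u ∈ Icc (0 : ℝ) 1, ∀ w : E, w ∈ univ \ {0} →
      ‖(1 + u * (R / ‖w‖)) • w‖ = ‖w‖ + u * R := fun u hu w hw => by
    have := hne w hw
    rw [norm_smul, Real.norm_of_nonneg (by have := hu.1; positivity)]
    field_simp
  have e2 : Nonempty ({w : E | R < ‖w‖} ≃ₕ ↥((univ : Set E) \ {0})) := by
    refine nonempty_homotopyEquiv_of_push (fun w hw => ⟨mem_univ _, fun h => ?_⟩)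
      (fun u w => (1 + u * (R / ‖w‖)) • w) ?_ (by simp) ?_ ?_ ?_
    · rw [mem_singleton_iff] at h
      simp only [mem_ofPred_eq, h, norm_zero] at hw
      linarith
    · refine ContinuousOn.smul (continuousOn_const.add (continuousOn_fst.mul
        (continuousOn_const.div (by fun_prop) fun p hp => (hne _ hp.2).ne'))) (by fun_prop)
    · intro u hu w hw
      refine ⟨mem_univ _, fun h => ?_⟩
      have h1 := hl u hu w hw
      rw [h, norm_zero] at h1
      nlinarith [hne w hw, hu.1]
    · intro u hu w hw
      have hw0 : w ∈ univ \ {(0 : E)} := ⟨mem_univ _, fun h => by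
        rw [mem_singleton_iff] at h
        simp only [mem_ofPred_eq, h, norm_zero] at hw
        linarith⟩
      rw [mem_ofPred_eq, hl u hu w hw0]
      have : R < ‖w‖ := hw
      nlinarith [hu.1]
    · intro w hw
      rw [mem_ofPred_eq, hl 1 ⟨zero_le_one, le_rfl⟩ w hw]
      linarith [hne w hw]
  obtain ⟨e2⟩ := e2
  exact ⟨e2.trans e1⟩

/-- A bouquet of one sphere is a sphere. -/
def bouquetOneHomeomorph (m : ℕ) : bouquet 1 m ≃ₜ UnitSphere m where
  toFun f := f.1 0
  invFun x := ⟨fun _ => x, fun i j _ _ => Subsingleton.elim i j⟩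
  left_inv f := Subtype.ext (funext fun i => by rw [Subsingleton.elim i 0])
  right_inv _ := rfl
  continuous_toFun := (continuous_apply 0).comp continuous_subtype_val
  continuous_invFun := by fun_prop

variable {F : Type} [NormedAddCommGroup F] [NormedSpace ℝ F] [FiniteDimensional ℝ F] {m : ℕ}

/-- Space without finitely many points whose first coordinates are distinct, times an interval. -/
lemma nonempty_prod_compl_finset_homotopyEquiv (hm : finrank ℝ F = m) {P : Finset (ℝ × F)}
    (hP : P.Nonempty) (hinj : InjOn Prod.fst (P : Set (ℝ × F))) {a s : ℝ} (has : a < s) :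
    Nonempty (↥(Ioo a s ×ˢ (P : Set (ℝ × F))ᶜ) ≃ₕ bouquet P.card m) := by
  classical
  have hfin : finrank ℝ (ℝ × F) = m + 1 := by rw [finrank_prod, finrank_self, hm, add_comm]
  obtain ⟨R, hR, hRP⟩ := exists_forall_lt P fun q => ‖q‖
  have hX : IsOpen (Ioo a s ×ˢ {w : ℝ × F | R < ‖w‖}) :=
    isOpen_Ioo.prod (isOpen_lt continuous_const continuous_norm)
  obtain ⟨e1⟩ := nonempty_norm_gt_homotopyEquiv hfin hR
  have h := fill_box hm (OpenPartialHomeomorph.refl (ℝ × ℝ × F)) (J := Ioo a s) (convex_Ioo a s)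
    isOpen_Ioo (nonempty_Ioo.2 has) (subset_univ _) hR (by linarith : R < 2 * R) P hP
    (fun v hv => ⟨(le_abs_self _).trans_lt ((norm_fst_le _).trans_lt (hRP v hv)),
      (norm_snd_le _).trans_lt (hRP v hv)⟩) hinj ∅ (-(2 * R)) (-R)
    (Ioo a s ×ˢ {w : ℝ × F | R < ‖w‖}) 1 (by simp) le_rfl (by linarith)
    (fun v hv => (abs_lt.1 ((norm_fst_le _).trans_lt (hRP v hv))).1) hX ?_
    (nonempty_prod_set_homotopyEquiv (convex_Ioo a s) (nonempty_Ioo.2 has)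
      ⟨e1.trans (bouquetOneHomeomorph m).symm.toHomotopyEquiv⟩)
  · have hcard : 1 + (P.card - 1) = P.card := by
      have := hP.card_pos
      omega
    have hset : Ioo a s ×ˢ {w : ℝ × F | R < ‖w‖} ∪ OpenPartialHomeomorph.refl (ℝ × ℝ × F) ''
        {p | p.1 ∈ Ioo a s ∧ |p.2.1| < 2 * R ∧ ‖p.2.2‖ < 2 * R ∧ p.2 ∉ (∅ : Finset (ℝ × F)) ∧
          p.2 ∉ P} = Ioo a s ×ˢ (P : Set (ℝ × F))ᶜ := by
      have hid : (OpenPartialHomeomorph.refl (ℝ × ℝ × F) : ℝ × ℝ × F → ℝ × ℝ × F) = id := rfl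
      rw [hid, image_id]
      ext ⟨t, w⟩
      constructor
      · rintro (⟨ht, hw⟩ | ⟨ht, -, -, -, hw⟩)
        · exact ⟨ht, fun h => (hRP w h).not_gt hw⟩
        · exact ⟨ht, hw⟩
      · rintro ⟨ht, hw⟩
        rcases lt_or_ge R ‖w‖ with h | h
        · exact Or.inl ⟨ht, h⟩
        · have h' : ‖w‖ < 2 * R := by linarith
          exact Or.inr ⟨ht, (norm_fst_le w).trans_lt h', (norm_snd_le w).trans_lt h', by simp, hw⟩
    rwa [hcard, hset] at h
  · intro τ hτ w hw1 hw2
    simp only [OpenPartialHomeomorph.refl_apply, mem_prod, hτ, true_and, mem_ofPred_eq,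
      Prod.norm_def, lt_max_iff, Real.norm_eq_abs, lt_abs, lt_neg (a := R), Finset.notMem_empty,
      not_false_eq_true, id]
    tauto

/-- A thin slab that begins at a time when the lines are apart. All its cones contain a single line,
so that filling them in adds nothing to the homotopy type of the first slice. -/
theorem eventually_nhdsGT_homotopyEquiv_of_injOn (hm : finrank ℝ F = m)
    {L : Finset ((ℝ × F) × (ℝ × F))} (hL : IsGenericFamily L) (hne : L.Nonempty) {a : ℝ}
    (hinj : InjOn (fun p : (ℝ × F) × (ℝ × F) => (p.1 + a • p.2).1) L) :
    ∀ᶠ s in 𝓝[>] a, Nonempty (lineComplement L (Ioo a s) ≃ₕ bouquet L.card m) := by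
  classical
  obtain ⟨R, hR, hRL⟩ := exists_forall_lt L fun p => ‖p.2‖
  obtain ⟨r, hr, hsep⟩ := exists_pos_le_norm_sub (slicePoints L a)
  have hrR : 0 < r / (4 * R) := by positivity
  filter_upwards [Ioo_mem_nhdsGT (show a < a + r / (4 * R) by linarith)] with s hs
  have hP : (slicePoints L a).Nonempty := slicePoints_nonempty hne _
  have hD : 4 * R * (s - a) ≤ r := by
    have h1 : s - a ≤ r / (4 * R) := by linarith [hs.2]
    rw [le_div_iff₀ (by positivity)] at h1
    linarith
  have hD0 : 0 < s - a := by linarith [hs.1]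
  have hcardP : (slicePoints L a).card = L.card :=
    card_slicePoints fun p hp p' hp' h => hinj hp hp' (congrArg Prod.fst h)
  have hinjP : InjOn Prod.fst (slicePoints L a : Set (ℝ × F)) := by
    intro q hq q' hq' h
    obtain ⟨p, hp, rfl⟩ := mem_slicePoints_iff.1 hq
    obtain ⟨p', hp', rfl⟩ := mem_slicePoints_iff.1 hq'
    rw [hinj hp hp' h]
  have hsum : ∑ q ∈ slicePoints L a, ((linesThrough L a q).card - 1) = 0 := by
    refine Finset.sum_eq_zero fun q hq => ?_
    rw [tsub_eq_zero_iff_le, Finset.card_le_one]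
    intro p hp p' hp'
    rw [mem_linesThrough] at hp hp'
    exact hinj hp.1 hp'.1 (congrArg Prod.fst (hp.2.trans hp'.2.symm))
  obtain ⟨e1⟩ := nonempty_prod_compl_finset_homotopyEquiv hm hP hinjP hs.1
  set P := slicePoints L a with hPdef
  have hmem : ∀ z : ℝ × (ℝ × F), z.1 ∈ Ioo a s → (∀ q ∈ P, R * (z.1 - a) < ‖z.2 - q‖) →
      z ∈ coneComplement L (Ioo a s) a R (P : Set (ℝ × F)) := fun z hz h =>
    ⟨⟨hz, fun p hp => ne_line_of_le (hRL p hp) (ne_of_gt hz.1) (by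
      rw [abs_of_pos (by linarith [hz.1])]
      exact (h _ (mem_slicePoints hp a)).le)⟩, h⟩
  -- a point is moved towards the initial time until it is outside the cones
  let κ : ℝ × F → ℝ := fun y => min 1 (Metric.infDist y (P : Set (ℝ × F)) / (R * (s - a)))
  have hPc : IsClosed (P : Set (ℝ × F)) := P.finite_toSet.isClosed
  have hκ0 : ∀ y ∈ (P : Set (ℝ × F))ᶜ, 0 < κ y := fun y hy => lt_min one_pos
    (div_pos ((hPc.notMem_iff_infDist_pos hP).1 hy) (by positivity))
  have hκ1 : ∀ y, κ y ≤ 1 := fun y => min_le_left _ _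
  let l : ℝ → ℝ × F → ℝ := fun u y => (1 - u) + u * κ y
  have hl : ∀ u ∈ Icc (0 : ℝ) 1, ∀ y ∈ (P : Set (ℝ × F))ᶜ, 0 < l u y ∧ l u y ≤ 1 := by
    intro u hu y hy
    simp only [l]
    constructor
    · rcases hu.1.eq_or_lt with h | h
      · rw [← h]; simp
      · nlinarith [hu.2, mul_pos h (hκ0 y hy)]
    · nlinarith [hu.1, hκ1 y]
  have htime : ∀ u ∈ Icc (0 : ℝ) 1, ∀ z : ℝ × (ℝ × F), z ∈ Ioo a s ×ˢ (P : Set (ℝ × F))ᶜ →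
      a < a + l u z.2 * (z.1 - a) ∧ a + l u z.2 * (z.1 - a) ≤ z.1 := by
    intro u hu z hz
    have h1 := hl u hu z.2 hz.2
    have h2 : 0 < z.1 - a := by linarith [hz.1.1]
    exact ⟨by nlinarith, by nlinarith⟩
  have hYX : coneComplement L (Ioo a s) a R (P : Set (ℝ × F)) ⊆
      Ioo a s ×ˢ (P : Set (ℝ × F))ᶜ := by
    refine fun z hz => ⟨hz.1.1, fun h => ?_⟩
    have h1 := hz.2 z.2 h
    rw [sub_self, norm_zero] at h1
    nlinarith [hz.1.1.1]
  have e2 : Nonempty (coneComplement L (Ioo a s) a R (P : Set (ℝ × F)) ≃ₕ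
      ↥(Ioo a s ×ˢ (P : Set (ℝ × F))ᶜ)) := by
    refine nonempty_homotopyEquiv_of_push hYX (fun u z => (a + l u z.2 * (z.1 - a), z.2))
      ?_ ?_ ?_ ?_ ?_
    · have : Continuous fun y => Metric.infDist y (P : Set (ℝ × F)) :=
        Metric.continuous_infDist_pt _
      have hκc : Continuous κ := continuous_const.min (this.div_const _)
      exact Continuous.continuousOn (by fun_prop)
    · rintro ⟨t, y⟩ -
      simp [l]
    · intro u hu z hz
      have h1 := htime u hu z hz
      exact ⟨⟨h1.1, h1.2.trans_lt hz.1.2⟩, hz.2⟩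
    · intro u hu z hz
      have h1 := htime u hu z (hYX hz)
      refine hmem _ ⟨h1.1, h1.2.trans_lt hz.1.1.2⟩ fun q hq => lt_of_le_of_lt ?_ (hz.2 q hq)
      exact mul_le_mul_of_nonneg_left (by dsimp only; linarith) hR.le
    · intro z hz
      have h1 := htime 1 ⟨zero_le_one, le_rfl⟩ z hz
      refine hmem _ ⟨h1.1, h1.2.trans_lt hz.1.2⟩ fun q hq => ?_
      refine lt_of_lt_of_le ?_ (infDist_le_norm_sub hq z.2)
      have h2 : κ z.2 ≤ _ := min_le_right _ _
      have h3 := (hPc.notMem_iff_infDist_pos hP).1 hz.2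
      rw [le_div_iff₀ (by positivity)] at h2
      have h4 : z.1 - a < s - a := by linarith [hz.1.2]
      have h5 := hκ0 z.2 hz.2
      simp only [l, sub_self, zero_add, one_mul, add_sub_cancel_left]
      calc R * (κ z.2 * (z.1 - a)) < R * (κ z.2 * (s - a)) := by gcongr
        _ = κ z.2 * (R * (s - a)) := by ring
        _ ≤ _ := h2
  obtain ⟨e2⟩ := e2
  have := fill_cones hm hL le_rfl hs.1 hR hRL (fun q hq q' hq' h => hD.trans (hsep q hq q' hq' h))
    ⟨e2.trans e1⟩
  rwa [hsum, add_zero, hcardP] at this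

/-- Passing a collision time adds one sphere less than the number of lines for every collision
point. -/
theorem eventually_nhdsGT_homotopyEquiv (hm : finrank ℝ F = m)
    {L : Finset ((ℝ × F) × (ℝ × F))} (hL : IsGenericFamily L) (hne : L.Nonempty) {a t₀ : ℝ}
    (ha : a < t₀) {g : ℕ} (h : Nonempty (lineComplement L (Ioo a t₀) ≃ₕ bouquet g m)) :
    ∀ᶠ s in 𝓝[>] t₀, Nonempty (lineComplement L (Ioo a s) ≃ₕ
      bouquet (g + ∑ q ∈ slicePoints L t₀, ((linesThrough L t₀ q).card - 1)) m) := by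
  obtain ⟨R, hR, hRL⟩ := exists_forall_lt L fun p => ‖p.2‖
  obtain ⟨r, hr, hsep⟩ := exists_pos_le_norm_sub (slicePoints L t₀)
  have hrR : 0 < r / (4 * R) := by positivity
  filter_upwards [Ioo_mem_nhdsGT (show t₀ < t₀ + r / (4 * R) by linarith),
    Ioo_mem_nhdsGT (show t₀ < t₀ + (t₀ - a) by linarith)] with s hs hs'
  have hD : 4 * R * (s - t₀) ≤ r := by
    have h1 : s - t₀ ≤ r / (4 * R) := by linarith [hs.2]
    rw [le_div_iff₀ (by positivity)] at h1
    linarith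
  obtain ⟨e1⟩ := nonempty_coneComplement_homotopyEquiv (a := a) hne hs.1
    (by linarith [hs'.2]) hR hRL
  obtain ⟨e⟩ := h
  exact fill_cones hm hL ha.le hs.1 hR hRL (fun q hq q' hq' h => hD.trans (hsep q hq q' hq' h))
    ⟨e1.symm.trans e⟩

end Crossing

/-! ### The sweep over all times -/

section Sweep

open Set Topology Filter Module

/-- A property of real numbers that holds just after `a`, and passes to suprema and to the right of
each point, holds everywhere after `a`. -/
lemma forall_gt_of_eventually {P : ℝ → Prop} {a : ℝ} (h0 : ∀ᶠ s in 𝓝[>] a, P s)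
    (hl : ∀ t > a, (∀ s ∈ Ioo a t, P s) → P t) (hr : ∀ t > a, P t → ∀ᶠ s in 𝓝[>] t, P s) :
    ∀ s > a, P s := by
  by_contra! hbad
  obtain ⟨b, hb, hPb⟩ := hbad
  let B : Set ℝ := {s | a < s ∧ ¬ P s}
  have hB : B.Nonempty := ⟨b, hb, hPb⟩
  have hBb : BddBelow B := ⟨a, fun s hs => hs.1.le⟩
  set t := sInf B with ht
  have hlow : ∀ s ∈ Ioo a t, P s := fun s hs => by
    by_contra h
    exact (csInf_le hBb ⟨hs.1, h⟩).not_gt hs.2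
  have hat : a < t := by
    obtain ⟨c, hc, hc'⟩ := mem_nhdsGT_iff_exists_Ioo_subset.1 h0
    refine lt_of_lt_of_le hc (le_csInf hB fun s hs => ?_)
    by_contra h
    exact hs.2 (hc' ⟨hs.1, not_le.1 h⟩)
  have hPt := hl t hat hlow
  obtain ⟨c, hc, hc'⟩ := mem_nhdsGT_iff_exists_Ioo_subset.1 (hr t hat hPt)
  obtain ⟨s, hs, hsc⟩ := exists_lt_of_csInf_lt hB (show sInf B < c from hc)
  rcases (csInf_le hBb hs).eq_or_lt with h | h
  · exact hs.2 (h ▸ hPt)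
  · exact hs.2 (hc' ⟨h, hsc⟩)

/-- The number of spheres that are added when time `t` is passed. -/
noncomputable def collisionDefect {E : Type*} [NormedAddCommGroup E] [NormedSpace ℝ E]
    (L : Finset (E × E)) (t : ℝ) : ℕ :=
  ∑ q ∈ slicePoints L t, ((linesThrough L t q).card - 1)

/-- The family of lines with time reversed. -/
noncomputable def reverseLines {E : Type*} [NormedAddCommGroup E] [NormedSpace ℝ E]
    (L : Finset (E × E)) : Finset (E × E) :=
  open scoped Classical in L.image fun p => (p.1, -p.2)

lemma mem_reverseLines {E : Type*} [NormedAddCommGroup E] [NormedSpace ℝ E] {L : Finset (E × E)}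
    {p : E × E} : p ∈ reverseLines L ↔ ∃ p' ∈ L, (p'.1, -p'.2) = p := by
  classical
  exact Finset.mem_image

/-- Time reversal. -/
noncomputable def reverseHomeomorph {E : Type*} [NormedAddCommGroup E] [NormedSpace ℝ E]
    (L : Finset (E × E)) {I I' : Set ℝ} (h : ∀ t, t ∈ I ↔ -t ∈ I') :
    lineComplement (reverseLines L) I ≃ₜ lineComplement L I' :=
  ((Homeomorph.neg ℝ).prodCongr (Homeomorph.refl E)).subtype fun z => by
    refine and_congr (h z.1) ⟨fun hz p hp => ?_, fun hz p hp => ?_⟩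
    · simpa using hz (p.1, -p.2) (mem_reverseLines.2 ⟨p, hp, rfl⟩)
    · obtain ⟨p', hp', rfl⟩ := mem_reverseLines.1 hp
      simpa using hz p' hp'

variable {F : Type} [NormedAddCommGroup F] [NormedSpace ℝ F]

lemma IsGenericFamily.eventually_atBot_injOn {L : Finset ((ℝ × F) × (ℝ × F))}
    (hL : IsGenericFamily L) :
    ∀ᶠ a : ℝ in atBot, InjOn (fun p : (ℝ × F) × (ℝ × F) => (p.1 + a • p.2).1) L := by
  have h : ∀ᶠ a : ℝ in atBot, ∀ p ∈ L, ∀ p' ∈ L, p.1.1 + a * p.2.1 = p'.1.1 + a * p'.2.1 →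
      p = p' := by
    rw [Finset.eventually_all]
    intro p hp
    rw [Finset.eventually_all]
    intro p' hp'
    by_cases hpp : p = p'
    · exact Eventually.of_forall fun _ _ => hpp
    rcases hL p hp p' hp' hpp with h | ⟨h, h'⟩
    · filter_upwards [eventually_lt_atBot ((p'.1.1 - p.1.1) / (p.2.1 - p'.2.1))] with a ha h1
      exfalso
      have h2 : p.2.1 - p'.2.1 ≠ 0 := sub_ne_zero.2 h
      refine ha.ne ((eq_div_iff h2).2 ?_)
      linear_combination h1
    · refine Eventually.of_forall fun a h1 => absurd ?_ h'
      rw [h] at h1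
      exact add_right_cancel h1
  filter_upwards [h] with a ha p hp p' hp' h1
  exact ha p hp p' hp' h1

variable [FiniteDimensional ℝ F] {m : ℕ}

/-- The complement of the lines in a slab that begins before all collisions. -/
theorem nonempty_lineComplement_Ioo_homotopyEquiv (hm : finrank ℝ F = m)
    {L : Finset ((ℝ × F) × (ℝ × F))} (hL : IsGenericFamily L) (hne : L.Nonempty) {a : ℝ}
    (hinj : InjOn (fun p : (ℝ × F) × (ℝ × F) => (p.1 + a • p.2).1) L) {C : Finset ℝ}
    (hC : ∀ t, collisionDefect L t ≠ 0 → t ∈ C) (hCa : ∀ t ∈ C, a < t) :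
    ∀ s > a, Nonempty (lineComplement L (Ioo a s) ≃ₕ
      bouquet (L.card + ∑ t ∈ C with t < s, collisionDefect L t) m) := by
  refine forall_gt_of_eventually ?_ ?_ ?_
  · -- no collision is passed just after `a`
    have h1 : ∀ᶠ s : ℝ in 𝓝[>] a, ∀ t ∈ C, s < t := by
      rw [Finset.eventually_all]
      exact fun t ht => mem_nhdsWithin_of_mem_nhds (Iio_mem_nhds (hCa t ht))
    filter_upwards [h1, eventually_nhdsGT_homotopyEquiv_of_injOn hm hL hne hinj] with s hs h
    rw [Finset.filter_false_of_mem fun t ht => (hs t ht).not_gt]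
    rwa [Finset.sum_empty, add_zero]
  · intro t hat hlow
    have h1 : ∀ᶠ s : ℝ in 𝓝[<] t, ∀ t' ∈ C, t' < t → t' < s := by
      rw [Finset.eventually_all]
      intro t' _
      by_cases h : t' < t
      · filter_upwards [mem_nhdsWithin_of_mem_nhds (Ioi_mem_nhds h)] with s hs _ using hs
      · exact Eventually.of_forall fun _ h' => absurd h' h
    obtain ⟨s, hs, ⟨e1⟩, hsa⟩ := (h1.and ((eventually_nhdsLT_homotopyEquiv L hat).and
      (Ioo_mem_nhdsLT hat))).exists
    obtain ⟨e2⟩ := hlow s hsa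
    have hF : C.filter (· < t) = C.filter (· < s) := Finset.filter_congr fun t' ht' =>
      ⟨fun h => hs t' ht' h, fun h => h.trans hsa.2⟩
    rw [hF]
    exact ⟨e1.symm.trans e2⟩
  · intro t hat h
    have h1 : ∀ᶠ s : ℝ in 𝓝[>] t, ∀ t' ∈ C, t < t' → s < t' := by
      rw [Finset.eventually_all]
      intro t' _
      by_cases h : t < t'
      · filter_upwards [mem_nhdsWithin_of_mem_nhds (Iio_mem_nhds h)] with s hs _ using hs
      · exact Eventually.of_forall fun _ h' => absurd h' h
    filter_upwards [h1, eventually_nhdsGT_homotopyEquiv hm hL hne hat h, self_mem_nhdsWithin]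
      with s hs e hts
    have hF : ∑ t' ∈ C with t' < s, collisionDefect L t' =
        ∑ t' ∈ C with t' < t, collisionDefect L t' + collisionDefect L t := by
      by_cases ht : t ∈ C
      · have h2 : C.filter (· < s) = insert t (C.filter (· < t)) := by
          ext t'
          simp only [Finset.mem_filter, Finset.mem_insert]
          constructor
          · rintro ⟨h3, h4⟩
            rcases lt_trichotomy t' t with h5 | h5 | h5
            · exact Or.inr ⟨h3, h5⟩
            · exact Or.inl h5
            · exact absurd h4 (hs t' h3 h5).not_gt
          · rintro (rfl | ⟨h3, h4⟩)
            · exact ⟨ht, hts⟩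
            · exact ⟨h3, h4.trans hts⟩
        rw [h2, Finset.sum_insert (by simp), add_comm]
      · have h2 : C.filter (· < s) = C.filter (· < t) := Finset.filter_congr fun t' ht' =>
          ⟨fun h3 => by
            by_contra h4
            rcases (not_lt.1 h4).eq_or_lt with h5 | h5
            · exact ht (h5 ▸ ht')
            · exact (hs t' ht' h5).not_gt h3, fun h3 => h3.trans hts⟩
        rw [h2, not_imp_comm.1 (hC t) ht, add_zero]
    rw [hF, ← add_assoc]
    exact e

/-- The homotopy type of the complement of a generic family of lines. -/
theorem nonempty_lineComplement_univ_homotopyEquiv (hm : finrank ℝ F = m)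
    {L : Finset ((ℝ × F) × (ℝ × F))} (hL : IsGenericFamily L) (hne : L.Nonempty) {C : Finset ℝ}
    (hC : ∀ t, collisionDefect L t ≠ 0 → t ∈ C) :
    Nonempty (lineComplement L univ ≃ₕ bouquet (L.card + ∑ t ∈ C, collisionDefect L t) m) := by
  have h1 : ∀ᶠ a : ℝ in atBot, ∀ t ∈ C, a < t := by
    rw [Finset.eventually_all]
    exact fun t _ => eventually_lt_atBot t
  -- the past is cut off by cutting off the future of the reversed family
  have h2 := tendsto_neg_atBot_atTop.eventually
    (eventually_atTop_homotopyEquiv (reverseLines L) (subset_univ (Ici 0)))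
  obtain ⟨a, ha, hinj, ⟨e1⟩⟩ := (h1.and (hL.eventually_atBot_injOn.and h2)).exists
  have h3 : ∀ᶠ s : ℝ in atTop, ∀ t ∈ C, t < s := by
    rw [Finset.eventually_all]
    exact fun t _ => eventually_gt_atTop t
  obtain ⟨s, hs, ⟨e2⟩, hsa⟩ := (h3.and ((eventually_atTop_homotopyEquiv L
    (show Ici (a + 1) ⊆ Ioi a from fun x hx => by
      simp only [mem_Ici, mem_Ioi] at hx ⊢; linarith)).and (eventually_gt_atTop a))).exists
  obtain ⟨e3⟩ := nonempty_lineComplement_Ioo_homotopyEquiv hm hL hne hinj hC ha s hsa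
  rw [Ioi_inter_Iio] at e2
  rw [Finset.filter_true_of_mem hs] at e3
  let r1 := reverseHomeomorph L (I := univ ∩ Iio (-a)) (I' := Ioi a) fun t => by
    simp [lt_neg]
  let r2 := reverseHomeomorph L (I := univ) (I' := univ) fun t => by simp
  exact ⟨((r2.symm.toHomotopyEquiv.trans e1.symm).trans r1.toHomotopyEquiv).trans
    (e2.symm.trans e3)⟩

end Sweep

/-! ### Generic coordinates and the count of the spheres -/

section Coordinates

open Set Topology Filter Module

/-- Linear coordinates whose first member does not vanish on given non-zero vectors. -/
lemma exists_equiv_fst_ne_zero {V : Type*} [NormedAddCommGroup V] [NormedSpace ℝ V]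
    [FiniteDimensional ℝ V] {r : ℕ} (hV : finrank ℝ V = r + 1) (S : Finset V)
    (hS : ∀ v ∈ S, v ≠ 0) :
    ∃ e : V ≃L[ℝ] ℝ × EuclideanSpace ℝ (Fin r), ∀ v ∈ S, (e v).1 ≠ 0 := by
  classical
  have : Nontrivial V := nontrivial_of_finrank_pos (R := ℝ) (by omega)
  obtain ⟨v₀, hv₀⟩ := exists_ne (0 : V)
  obtain ⟨f, hf⟩ := Module.exists_dual_forall_apply_ne_zero (K := ℝ) (ι := ↥(insert v₀ S))
    (fun v => (v : V)) fun v => by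
      rcases Finset.mem_insert.1 v.2 with h | h
      · rwa [h]
      · exact hS _ h
  have hf0 : f v₀ ≠ 0 := hf ⟨v₀, Finset.mem_insert_self _ _⟩
  have hq : finrank ℝ (V ⧸ (ℝ ∙ v₀)) = finrank ℝ (EuclideanSpace ℝ (Fin r)) := by
    have h1 := Submodule.finrank_quotient_add_finrank (ℝ ∙ v₀)
    rw [finrank_span_singleton hv₀, hV] at h1
    simpa using h1
  let φ : V →ₗ[ℝ] ℝ × EuclideanSpace ℝ (Fin r) :=
    f.prod ((LinearEquiv.ofFinrankEq _ _ hq).toLinearMap ∘ₗ (ℝ ∙ v₀).mkQ)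
  have hφ : Function.Injective φ := by
    rw [injective_iff_map_eq_zero]
    intro v hv
    have h1 : f v = 0 := congrArg Prod.fst hv
    have h2 : (LinearEquiv.ofFinrankEq _ _ hq) ((ℝ ∙ v₀).mkQ v) = 0 := congrArg Prod.snd hv
    rw [LinearEquiv.map_eq_zero_iff, Submodule.mkQ_apply, Submodule.Quotient.mk_eq_zero,
      Submodule.mem_span_singleton] at h2
    obtain ⟨c, rfl⟩ := h2
    rw [map_smul, smul_eq_mul] at h1
    rw [(mul_eq_zero.1 h1).resolve_right hf0, zero_smul]
  have hdim : finrank ℝ V = finrank ℝ (ℝ × EuclideanSpace ℝ (Fin r)) := by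
    rw [hV, finrank_prod, finrank_self, finrank_euclideanSpace_fin, add_comm]
  refine ⟨(LinearMap.linearEquivOfInjective φ hφ hdim).toContinuousLinearEquiv, fun v hv => ?_⟩
  exact hf ⟨v, Finset.mem_insert_of_mem hv⟩

/-- In linear coordinates whose first member does not vanish on its direction, a line is a graph. -/
lemma IsAffineLine.exists_graph {n : ℕ} {ℓ : AffineSubspace ℝ (EuclideanSpace ℝ (Fin n))}
    (hℓ : IsAffineLine ℓ) : ∃ v : EuclideanSpace ℝ (Fin n), v ≠ 0 ∧
      ∀ (E : Type) [NormedAddCommGroup E] [NormedSpace ℝ E]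
        (Ψ : EuclideanSpace ℝ (Fin n) ≃L[ℝ] ℝ × E), (Ψ v).1 ≠ 0 →
        ∃ p : E × E, ∀ x, x ∈ ℓ ↔ (Ψ x).2 = p.1 + (Ψ x).1 • p.2 := by
  obtain ⟨⟨x₀, hx₀⟩, hdim⟩ := hℓ
  obtain ⟨⟨v, hv⟩, hv0, hspan⟩ := finrank_eq_one_iff'.1 hdim
  refine ⟨v, fun h => hv0 (Subtype.ext h), fun E _ _ Ψ hΨ => ?_⟩
  have hmem : ∀ x, x ∈ ℓ ↔ ∃ c : ℝ, x = x₀ + c • v := by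
    intro x
    constructor
    · intro hx
      obtain ⟨c, hc⟩ := hspan ⟨x -ᵥ x₀, AffineSubspace.vsub_mem_direction hx hx₀⟩
      have hc' : c • v = x - x₀ := congrArg Subtype.val hc
      exact ⟨c, by rw [hc']; abel⟩
    · rintro ⟨c, rfl⟩
      have := AffineSubspace.vadd_mem_of_mem_direction (ℓ.direction.smul_mem c hv) hx₀
      rwa [vadd_eq_add, add_comm] at this
  obtain ⟨b, hvb⟩ : ∃ b, (Ψ v).2 = (Ψ v).1 • b :=
    ⟨(Ψ v).1⁻¹ • (Ψ v).2, by rw [smul_smul, mul_inv_cancel₀ hΨ, one_smul]⟩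
  refine ⟨((Ψ x₀).2 - (Ψ x₀).1 • b, b), fun x => ?_⟩
  rw [hmem]
  constructor
  · rintro ⟨c, rfl⟩
    simp only [map_add, map_smul, Prod.snd_add, Prod.fst_add, Prod.smul_snd, Prod.smul_fst, hvb,
      smul_eq_mul]
    module
  · intro h
    refine ⟨((Ψ x).1 - (Ψ x₀).1) / (Ψ v).1, Ψ.injective ?_⟩
    simp only [map_add, map_smul]
    refine Prod.ext ?_ ?_
    · simp only [Prod.fst_add, Prod.smul_fst, smul_eq_mul]
      field_simp
      ring
    · simp only [Prod.snd_add, Prod.smul_snd]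
      rw [h, hvb, smul_smul, div_mul_cancel₀ _ hΨ]
      module

/-- Linear coordinates in which the lines of an arrangement form a generic family of graphs. -/
theorem exists_generic_coordinates {m : ℕ}
    (A : Finset (AffineSubspace ℝ (EuclideanSpace ℝ (Fin (m + 2)))))
    (hA : ∀ ℓ ∈ A, IsAffineLine ℓ) :
    ∃ (Ψ : EuclideanSpace ℝ (Fin (m + 2)) ≃L[ℝ] ℝ × (ℝ × EuclideanSpace ℝ (Fin m)))
      (f : AffineSubspace ℝ (EuclideanSpace ℝ (Fin (m + 2))) →
        (ℝ × EuclideanSpace ℝ (Fin m)) × (ℝ × EuclideanSpace ℝ (Fin m))),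
      InjOn f A ∧ (∀ ℓ ∈ A, ∀ x, x ∈ ℓ ↔ (Ψ x).2 = (f ℓ).1 + (Ψ x).1 • (f ℓ).2) ∧
      ∀ L : Finset ((ℝ × EuclideanSpace ℝ (Fin m)) × (ℝ × EuclideanSpace ℝ (Fin m))),
        (L : Set _) = f '' A → IsGenericFamily L := by
  classical
  have h1 : ∀ ℓ : AffineSubspace ℝ (EuclideanSpace ℝ (Fin (m + 2))), ∃ v, ℓ ∈ A → v ≠ 0 ∧
      ∀ (E : Type) [NormedAddCommGroup E] [NormedSpace ℝ E]
        (Ψ : EuclideanSpace ℝ (Fin (m + 2)) ≃L[ℝ] ℝ × E), (Ψ v).1 ≠ 0 →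
        ∃ p : E × E, ∀ x, x ∈ ℓ ↔ (Ψ x).2 = p.1 + (Ψ x).1 • p.2 := by
    intro ℓ
    by_cases hℓ : ℓ ∈ A
    · obtain ⟨v, hv⟩ := (hA ℓ hℓ).exists_graph
      exact ⟨v, fun _ => hv⟩
    · exact ⟨0, fun h => absurd h hℓ⟩
  choose v hv using h1
  obtain ⟨Φ, hΦ⟩ := exists_equiv_fst_ne_zero (r := m + 1) (by simp) (A.image v) (by
    intro x hx
    obtain ⟨ℓ, hℓ, rfl⟩ := Finset.mem_image.1 hx
    exact (hv ℓ hℓ).1)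
  have h2 : ∀ ℓ : AffineSubspace ℝ (EuclideanSpace ℝ (Fin (m + 2))),
      ∃ p : EuclideanSpace ℝ (Fin (m + 1)) × EuclideanSpace ℝ (Fin (m + 1)), ℓ ∈ A →
        ∀ x, x ∈ ℓ ↔ (Φ x).2 = p.1 + (Φ x).1 • p.2 := by
    intro ℓ
    by_cases hℓ : ℓ ∈ A
    · obtain ⟨p, hp⟩ := (hv ℓ hℓ).2 _ Φ (hΦ _ (Finset.mem_image_of_mem v hℓ))
      exact ⟨p, fun _ => hp⟩
    · exact ⟨0, fun h => absurd h hℓ⟩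
  choose p hp using h2
  -- the second functional separates distinct slopes and distinct starting points
  obtain ⟨Θ, hΘ⟩ := exists_equiv_fst_ne_zero (r := m) (by simp)
    (((A ×ˢ A).image fun q => (p q.1).1 - (p q.2).1) ∪
      ((A ×ˢ A).image fun q => (p q.1).2 - (p q.2).2) |>.filter (· ≠ 0))
    fun v hv => (Finset.mem_filter.1 hv).2
  have hΘ1 : ∀ ℓ ∈ A, ∀ ℓ' ∈ A, (p ℓ).1 ≠ (p ℓ').1 → (Θ (p ℓ).1).1 ≠ (Θ (p ℓ').1).1 := by
    intro ℓ hℓ ℓ' hℓ' h h'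
    refine hΘ ((p ℓ).1 - (p ℓ').1) (Finset.mem_filter.2 ⟨Finset.mem_union_left _
      (Finset.mem_image.2 ⟨(ℓ, ℓ'), Finset.mem_product.2 ⟨hℓ, hℓ'⟩, rfl⟩), sub_ne_zero.2 h⟩) ?_
    rw [map_sub, Prod.fst_sub, h', sub_self]
  have hΘ2 : ∀ ℓ ∈ A, ∀ ℓ' ∈ A, (p ℓ).2 ≠ (p ℓ').2 → (Θ (p ℓ).2).1 ≠ (Θ (p ℓ').2).1 := by
    intro ℓ hℓ ℓ' hℓ' h h'
    refine hΘ ((p ℓ).2 - (p ℓ').2) (Finset.mem_filter.2 ⟨Finset.mem_union_right _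
      (Finset.mem_image.2 ⟨(ℓ, ℓ'), Finset.mem_product.2 ⟨hℓ, hℓ'⟩, rfl⟩), sub_ne_zero.2 h⟩) ?_
    rw [map_sub, Prod.fst_sub, h', sub_self]
  refine ⟨Φ.trans ((ContinuousLinearEquiv.refl ℝ ℝ).prodCongr Θ),
    fun ℓ => (Θ (p ℓ).1, Θ (p ℓ).2), ?_, ?_, ?_⟩
  · intro ℓ hℓ ℓ' hℓ' h
    have h3 : p ℓ = p ℓ' := Prod.ext (Θ.injective (congrArg Prod.fst h))
      (Θ.injective (congrArg Prod.snd h))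
    ext x
    rw [hp ℓ hℓ, hp ℓ' hℓ', h3]
  · intro ℓ hℓ x
    rw [hp ℓ hℓ, ← Θ.injective.eq_iff]
    simp
  · intro L hL q hq q' hq' hne
    rw [← Finset.mem_coe, hL] at hq hq'
    obtain ⟨ℓ, hℓ, rfl⟩ := hq
    obtain ⟨ℓ', hℓ', rfl⟩ := hq'
    by_cases h : (p ℓ).2 = (p ℓ').2
    · refine Or.inr ⟨by simp only [h], hΘ1 ℓ hℓ ℓ' hℓ' fun h3 => hne ?_⟩
      simp only [h, h3]
    · exact Or.inl (hΘ2 ℓ hℓ ℓ' hℓ' h)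

/-- The lines of a generic family meet at finitely many times: two of them determine the time by
their first coordinates. -/
lemma IsGenericFamily.exists_collision_times {F : Type} [NormedAddCommGroup F] [NormedSpace ℝ F]
    {L : Finset ((ℝ × F) × (ℝ × F))} (hL : IsGenericFamily L) :
    ∃ C : Finset ℝ, ∀ t q, 2 ≤ (linesThrough L t q).card → t ∈ C := by
  classical
  refine ⟨(L ×ˢ L).image fun p => (p.2.1.1 - p.1.1.1) / (p.1.2.1 - p.2.2.1), fun t q h => ?_⟩
  obtain ⟨p, hp, p', hp', hne⟩ := Finset.one_lt_card.1 h
  rw [mem_linesThrough] at hp hp'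
  have h1 := hp.2.trans hp'.2.symm
  refine Finset.mem_image.2 ⟨(p, p'), Finset.mem_product.2 ⟨hp.1, hp'.1⟩, ?_⟩
  rcases hL p hp.1 p' hp'.1 hne with h2 | ⟨h2, h3⟩
  · have h4 : p.1.1 + t * p.2.1 = p'.1.1 + t * p'.2.1 := congrArg Prod.fst h1
    rw [div_eq_iff (sub_ne_zero.2 h2)]
    linear_combination -h4
  · rw [h2] at h1
    exact absurd (congrArg Prod.fst (add_right_cancel h1)) h3

/-- The collision defects are counted by the multiplicities of the points. -/
theorem sum_collisionDefect {n : ℕ} {E : Type} [NormedAddCommGroup E] [NormedSpace ℝ E]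
    (A : Finset (AffineSubspace ℝ (EuclideanSpace ℝ (Fin n))))
    (Ψ : EuclideanSpace ℝ (Fin n) ≃L[ℝ] ℝ × E)
    (f : AffineSubspace ℝ (EuclideanSpace ℝ (Fin n)) → E × E) (hf : InjOn f A)
    (hΨ : ∀ ℓ ∈ A, ∀ x, x ∈ ℓ ↔ (Ψ x).2 = (f ℓ).1 + (Ψ x).1 • (f ℓ).2)
    {L : Finset (E × E)} (hL : (L : Set (E × E)) = f '' A) {C : Finset ℝ}
    (hC : ∀ t q, 2 ≤ (linesThrough L t q).card → t ∈ C) :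
    ∑ t ∈ C, collisionDefect L t =
      ∑ i ∈ Finset.Icc 2 A.card, (i - 1) * numPointsOfMultiplicity A i := by
  classical
  have hmult : ∀ x, pointMultiplicity A x = (linesThrough L (Ψ x).1 (Ψ x).2).card := by
    intro x
    rw [pointMultiplicity, ← Set.ncard_coe_finset]
    have h1 : (linesThrough L (Ψ x).1 (Ψ x).2 : Set (E × E)) = f '' {ℓ | ℓ ∈ A ∧ x ∈ ℓ} := by
      ext p
      rw [Finset.mem_coe, mem_linesThrough, ← Finset.mem_coe, hL]
      constructor
      · rintro ⟨⟨ℓ, hℓ, rfl⟩, h⟩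
        exact ⟨ℓ, ⟨hℓ, (hΨ ℓ hℓ x).2 h.symm⟩, rfl⟩
      · rintro ⟨ℓ, ⟨hℓ, hx⟩, rfl⟩
        exact ⟨⟨ℓ, hℓ, rfl⟩, ((hΨ ℓ hℓ x).1 hx).symm⟩
    rw [h1, (hf.mono fun ℓ hℓ => hℓ.1).ncard_image]
  have hle : ∀ x, pointMultiplicity A x ≤ A.card := by
    intro x
    rw [pointMultiplicity, ← Set.ncard_coe_finset]
    exact ncard_le_ncard (fun ℓ hℓ => hℓ.1) A.finite_toSet
  let S : Finset (EuclideanSpace ℝ (Fin n)) :=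
    (C.sigma fun t => slicePoints L t).image fun z => Ψ.symm (z.1, z.2)
  have hS : ∀ x, 2 ≤ pointMultiplicity A x → x ∈ S := by
    intro x hx
    rw [hmult] at hx
    obtain ⟨p, hp⟩ := Finset.card_pos.1 (by omega : 0 < (linesThrough L (Ψ x).1 (Ψ x).2).card)
    rw [mem_linesThrough] at hp
    exact Finset.mem_image.2 ⟨⟨(Ψ x).1, (Ψ x).2⟩, Finset.mem_sigma.2 ⟨hC _ _ hx,
      mem_slicePoints_iff.2 ⟨p, hp⟩⟩, by simp⟩
  have h1 : ∑ t ∈ C, collisionDefect L t = ∑ x ∈ S, (pointMultiplicity A x - 1) := by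
    simp only [collisionDefect]
    rw [Finset.sum_sigma', Finset.sum_image]
    · simp [hmult]
    · rintro ⟨t, q⟩ _ ⟨t', q'⟩ _ h
      have := Ψ.symm.injective h
      simp only [Prod.mk.injEq] at this
      obtain ⟨rfl, rfl⟩ := this
      rfl
  have h2 : ∑ x ∈ S, (pointMultiplicity A x - 1) =
      ∑ x ∈ S with 2 ≤ pointMultiplicity A x, (pointMultiplicity A x - 1) := by
    rw [Finset.sum_filter_of_ne]
    intro x _ hx
    omega
  rw [h1, h2, ← Finset.sum_fiberwise_of_maps_to (t := Finset.Icc 2 A.card)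
    (g := fun x => pointMultiplicity A x) fun x hx => Finset.mem_Icc.2
      ⟨(Finset.mem_filter.1 hx).2, hle x⟩]
  refine Finset.sum_congr rfl fun i hi => ?_
  have hi2 := (Finset.mem_Icc.1 hi).1
  have h3 : numPointsOfMultiplicity A i =
      ((S.filter fun x => 2 ≤ pointMultiplicity A x).filter
        fun x => pointMultiplicity A x = i).card := by
    rw [numPointsOfMultiplicity, ← Set.ncard_coe_finset]
    congr 1
    ext x
    simp only [mem_ofPred_eq, Finset.coe_filter, Finset.mem_filter]
    exact ⟨fun h => ⟨⟨hS x (h ▸ hi2), h ▸ hi2⟩, h⟩, fun h => h.2⟩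
  rw [h3, mul_comm, ← smul_eq_mul, ← Finset.sum_const]
  exact Finset.sum_congr rfl fun x hx => by rw [(Finset.mem_filter.1 hx).2]

/-- The complement of an arrangement of lines is a bouquet of spheres up to homotopy. -/
theorem nonempty_arrangementComplement_homotopyEquiv_bouquet {m : ℕ}
    (A : Finset (AffineSubspace ℝ (EuclideanSpace ℝ (Fin (m + 2)))))
    (hA : ∀ ℓ ∈ A, IsAffineLine ℓ) :
    Nonempty (arrangementComplement A ≃ₕ bouquet
      (A.card + ∑ i ∈ Finset.Icc 2 A.card, (i - 1) * numPointsOfMultiplicity A i) m) := by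
  classical
  rcases A.eq_empty_or_nonempty with rfl | hne
  · have h1 : ContractibleSpace (arrangementComplement
        (∅ : Finset (AffineSubspace ℝ (EuclideanSpace ℝ (Fin (m + 2)))))) := by
      have : arrangementComplement
          (∅ : Finset (AffineSubspace ℝ (EuclideanSpace ℝ (Fin (m + 2))))) = univ := by
        simp [arrangementComplement]
      rw [this]
      exact (convex_univ (𝕜 := ℝ)).contractibleSpace univ_nonempty
    have : Unique (bouquet 0 m) := ⟨⟨bouquetBase 0 m⟩, fun x => Subtype.ext (Subsingleton.elim _ _)⟩
    obtain ⟨e⟩ := ContractibleSpace.hequiv_unit (arrangementComplement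
      (∅ : Finset (AffineSubspace ℝ (EuclideanSpace ℝ (Fin (m + 2))))))
    exact ⟨e.trans (Homeomorph.homeomorphOfUnique Unit (bouquet 0 m)).toHomotopyEquiv⟩
  · obtain ⟨Ψ, f, hf, hΨ, hgen⟩ := exists_generic_coordinates A hA
    have hcoe : ((A.image f : Finset _) : Set _) = f '' A := Finset.coe_image
    have hL := hgen _ hcoe
    obtain ⟨C, hC⟩ := hL.exists_collision_times
    have hC' : ∀ t, collisionDefect (A.image f) t ≠ 0 → t ∈ C := by
      intro t ht
      obtain ⟨q, -, hq⟩ := Finset.exists_ne_zero_of_sum_ne_zero ht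
      exact hC t q (by omega)
    obtain ⟨e⟩ := nonempty_lineComplement_univ_homotopyEquiv (m := m) (by simp) hL
      (hne.image f) hC'
    rw [sum_collisionDefect A Ψ f hf hΨ hcoe hC, Finset.card_image_of_injOn hf] at e
    have e0 : arrangementComplement A ≃ₜ lineComplement (A.image f) univ :=
      Ψ.toHomeomorph.subtype fun x => by
        simp only [arrangementComplement, lineComplement, mem_compl_iff, mem_iUnion, not_exists,
          mem_ofPred_eq, mem_univ, true_and, Finset.forall_mem_image]
        exact forall₂_congr fun ℓ hℓ => not_congr (hΨ ℓ hℓ x)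
    exact ⟨e0.toHomotopyEquiv.trans e⟩

end Coordinates

theorem corollary1p4 (n : ℕ) (hn : 2 ≤ n)
    (A : Finset (AffineSubspace ℝ (EuclideanSpace ℝ (Fin n))))
    (hA : ∀ ℓ ∈ A, IsAffineLine ℓ) :
    Nonempty (arrangementComplement A ≃ₕ
      SphereBouquet
        (A.card + ∑ i ∈ Finset.Icc 2 A.card, (i - 1) * numPointsOfMultiplicity A i) (n - 2)) ∧
    IsMinimalSpace (arrangementComplement A) := by
  obtain ⟨m, rfl⟩ := Nat.exists_eq_add_of_le' hn
  have h := nonempty_arrangementComplement_homotopyEquiv_bouquet A hA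
  refine ⟨?_, isMinimalSpace_of_homotopyEquiv_bouquet h⟩
  obtain ⟨e⟩ := h
  obtain ⟨e'⟩ := nonempty_sphereBouquet_homeomorph
    (A.card + ∑ i ∈ Finset.Icc 2 A.card, (i - 1) * numPointsOfMultiplicity A i) m
  exact ⟨e.trans e'.symm.toHomotopyEquiv⟩
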